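/- Let $k\ge 1$, let $z_1,\dots,z_n\in\mathbb C$ be distinct, let $m=(m_1,\dots,m_n)$ be positive integers with $m_j\le k-1$ for $j\le n_0$ and $m_j>k-1$ for $j>n_0$, and let $\kappa\in\mathbb C$, $\kappa\neq 0$. Let $U\subset\mathbb C^k$ be the complement of the hyperplanes $t_i-t_l=0$ $(1\le i<l\le k)$ and $t_i-z_a=0$ $(1\le i\le k,\ 1\le a\le n)$. For the complement of an arrangement of affine hyperplanes $f_h=0$, let $A^p$ denote the Orlik–Solomon space of $p$-forms spanned by all products $d\log f_{h_1}\wedge\dots\wedge d\log f_{h_p}$. Let $A^p_-(U)\subset A^p(U)$ be the subspace of forms that are skew-symmetric under the action of $S_k$ by permutation of the coordinates. For $K=(k_1,\dots,k_n)\in\mathbb Z_{\ge0}^n$ with $|K|=\sum_i k_i\in\{k-1,k\}$, put $l_0=0$, $l_i=k_1+\dots+k_i$, $\eta_{K,i}=d\log(t_{l_{i-1}+1}-z_i)\wedge\dots\wedge d\log(t_{l_i}-z_i)$ and $\alpha_K=(\kappa^{|K|}k_1!\cdots k_n!)^{-1}$. Let $\omega_K=\sum_{\sigma\in S_k}\operatorname{sgn}(\sigma)\,\sigma\bigl(\epsilon_K\alpha_K\,\eta_{K,1}\wedge\dots\wedge\eta_{K,n}\bigr)$,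 where $\epsilon_K=1$ if $|K|=k$ and $\epsilon_K=(-1)^k$ if $|K|=k-1$. Put $\beta^K_m=\prod_{i=1}^n k_i!\prod_{\ell=1}^{k_i}(m_i+1-\ell)$. The space of skew-symmetric flag forms is $\mathcal F^p_-=\operatorname{span}\langle\beta^K_m\,\omega_K\rangle_{|K|=p}$ for $p\in\{k-1,k\}$, and $\mathcal F^p_-=0$ for all other $p$. For $j\le n_0$ and $I\subset\{1,\dots,k\}$ with $|I|=m_j+1$, blow up the edge $t_i=z_j$ $(i\in I)$ of $\mathbb C^k$. Put $b=\min I$, and use on the blow-up the coordinates $s=t_b-z_j$, $u_i=(t_i-z_j)/(t_b-z_j)$ for $i\in I\setminus\{b\}$, and $t_i$ for $i\notin I$. The exceptional divisor is $s=0$, and $C^j_I$ denotes its open stratum, the complement in the divisor of the hyperplanes $u_i=0$, $u_i=1$, $u_i=u_l$ (indices in $I\setminus\{b\}$) and $t_i=t_l$, $t_i=z_a$ (indices not in $I$). Its Orlik–Solomon spaces $A^q(C^j_I)$ are those of this arrangement. The group $S_k$ permutes the strata $C^j_I$ with $j$ fixed, and $A^q_-\bigl(\bigcup_{|I|=m_j+1}C^j_I\bigr)\subset\bigoplus_I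 A^q(C^j_I)$ denotes the skew-symmetric part. If the pull-back of a form $\eta\in A^p(U)$ to the blow-up is written as $\frac{ds}{s}\wedge\alpha+\beta$ with $\alpha,\beta$ regular near $C^j_I$, then the residue of $\eta$ along $C^j_I$ is $\alpha|_{C^j_I}\in A^{p-1}(C^j_I)$ (it is $0$ if $p=0$). Then for every $p\ge 0$ the space $\mathcal F^p_-$ is equal to the kernel of the residue map $$A^{p}_-(U)\ \to\ \bigoplus_{j=1}^{n_0}A^{p-1}_-\Bigl(\bigcup_{|I|=m_j+1}C^j_I\Bigr).$$ -/

import Mathlib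

open Filter Topology

noncomputable section

namespace Discr

/-! ### Differential forms and Orlik-Solomon spaces of affine arrangements -/

/-- Differential `q`-forms (with no regularity imposed) on a subset `V` of the affine space
`ℂ^ι`: at each point of `V`, an alternating `q`-linear function of tangent vectors. -/
abbrev Form {ι : Type} (V : Set (ι → ℂ)) (q : ℕ) : Type :=
  V → (ι → ℂ) [⋀^Fin q]→ₗ[ℂ] ℂ

/-- The exterior product `φ 0 ∧ ⋯ ∧ φ (q - 1)` of covectors, whose value on
`v 0, …, v (q - 1)` is the determinant of the matrix with entries `φ b (v a)`. -/
def wedge {ι : Type} {q : ℕ} (φ : Fin q → ((ι → ℂ) →ₗ[ℂ] ℂ)) : (ι → ℂ) [⋀^Fin q]→ₗ[ℂ] ℂ :=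
  (Matrix.detRowAlternating (n := Fin q) (R := ℂ)).compLinearMap (LinearMap.pi φ)

/-- The value at `x` of the logarithmic form `d log f = df / f` of an affine function `f`. -/
def dlog {ι : Type} (f : (ι → ℂ) →ᵃ[ℂ] ℂ) (x : ι → ℂ) : (ι → ℂ) →ₗ[ℂ] ℂ :=
  (f x)⁻¹ • f.linear

/-- The complement of the arrangement of the zero loci of the functions `f h`. -/
def complement {ι H : Type} (f : H → (ι → ℂ) →ᵃ[ℂ] ℂ) : Set (ι → ℂ) :=
  {x | ∀ h, f h x ≠ 0}

/-- The form `d log f_{s 0} ∧ ⋯ ∧ d log f_{s (q - 1)}` on the complement. -/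
def logForm {ι H : Type} (f : H → (ι → ℂ) →ᵃ[ℂ] ℂ) {q : ℕ} (s : Fin q → H) :
    Form (complement f) q :=
  fun x => wedge fun a => dlog (f (s a)) x

/-- The Orlik-Solomon space `A^q` of the complement of an arrangement. -/
def orlikSolomon {ι H : Type} (f : H → (ι → ℂ) →ᵃ[ℂ] ℂ) (q : ℕ) :
    Submodule ℂ (Form (complement f) q) :=
  Submodule.span ℂ (Set.range fun s : Fin q → H => logForm f s)

/-- The coordinate function `x ↦ x i`. -/
def coordFn {ι : Type} (i : ι) : (ι → ℂ) →ᵃ[ℂ] ℂ :=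
  (LinearMap.proj i : (ι → ℂ) →ₗ[ℂ] ℂ).toAffineMap

/-- The constant function. -/
def constFn {ι : Type} (c : ℂ) : (ι → ℂ) →ᵃ[ℂ] ℂ :=
  AffineMap.const ℂ (ι → ℂ) c

/-! ### The discriminantal arrangement and its skew-symmetric forms -/

/-- Index set of the hyperplanes `H_{i,l} : t_i = t_l` (`i < l`) and `H_i^a : t_i = z_a`. -/
inductive DiscrHyp (k n : ℕ) : Type
  | diag (i l : Fin k) (h : i < l)
  | pt (i : Fin k) (a : Fin n)

/-- The functions `t_i - t_l` and `t_i - z_a`. -/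
def discrFn {k n : ℕ} (z : Fin n ↪ ℂ) : DiscrHyp k n → (Fin k → ℂ) →ᵃ[ℂ] ℂ
  | .diag i l _ => coordFn i - coordFn l
  | .pt i a => coordFn i - constFn (z a)

/-- The complement `U ⊂ ℂ^k` of the discriminantal arrangement. -/
abbrev discrU {n : ℕ} (k : ℕ) (z : Fin n ↪ ℂ) : Set (Fin k → ℂ) :=
  complement (discrFn (k := k) z)

/-- The Orlik-Solomon space `A^p(U)`. -/
abbrev discrOS {n : ℕ} (k : ℕ) (z : Fin n ↪ ℂ) (p : ℕ) : Submodule ℂ (Form (discrU k z) p) :=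
  orlikSolomon (discrFn (k := k) z) p

theorem mem_discrU_iff {k n : ℕ} (z : Fin n ↪ ℂ) (t : Fin k → ℂ) :
    t ∈ discrU k z ↔ (∀ i l, i ≠ l → t i ≠ t l) ∧ ∀ i a, t i ≠ z a := by
  constructor
  · intro h
    refine ⟨fun i l hil => ?_, fun i a => ?_⟩
    · rcases lt_or_gt_of_ne hil with h' | h'
      · have := h (.diag i l h')
        simpa [discrFn, coordFn, sub_eq_zero] using this
      · have := h (.diag l i h')
        refine Ne.symm ?_
        simpa [discrFn, coordFn, sub_eq_zero] using this
    · have := h (.pt i a)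
      simpa [discrFn, coordFn, constFn, sub_eq_zero] using this
  · rintro ⟨h1, h2⟩ (⟨i, l, h⟩ | ⟨i, a⟩)
    · simpa [discrFn, coordFn, sub_eq_zero] using h1 i l h.ne
    · simpa [discrFn, coordFn, constFn, sub_eq_zero] using h2 i a

theorem comp_mem_discrU {k n : ℕ} (z : Fin n ↪ ℂ) (σ : Equiv.Perm (Fin k)) {t : Fin k → ℂ}
    (ht : t ∈ discrU k z) : t ∘ σ ∈ discrU k z := by
  rw [mem_discrU_iff] at ht ⊢
  exact ⟨fun i l hil => ht.1 _ _ (fun h => hil (σ.injective h)), fun i a => ht.2 _ _⟩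

/-- The action of `σ ∈ S_k` on forms on `U`: the pull-back along the inverse of the map
`t ↦ t ∘ σ⁻¹` which permutes the coordinates. -/
def permForm {k n : ℕ} (z : Fin n ↪ ℂ) {p : ℕ} (σ : Equiv.Perm (Fin k)) :
    Form (discrU k z) p →ₗ[ℂ] Form (discrU k z) p where
  toFun η := fun t =>
    (η ⟨t.1 ∘ σ, comp_mem_discrU z σ t.2⟩).compLinearMap (LinearMap.funLeft ℂ ℂ σ)
  map_add' _ _ := by ext; simp
  map_smul' _ _ := by ext; simp

/-- The skew-symmetric part `A^p_-(U)` of the Orlik-Solomon space. -/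
def skewOS {n : ℕ} (k : ℕ) (z : Fin n ↪ ℂ) (p : ℕ) : Submodule ℂ (Form (discrU k z) p) where
  carrier := {η | η ∈ discrOS k z p ∧
    ∀ σ : Equiv.Perm (Fin k), permForm z σ η = (((Equiv.Perm.sign σ : ℤˣ) : ℤ) : ℂ) • η}
  add_mem' h₁ h₂ := ⟨add_mem h₁.1 h₂.1, fun σ => by rw [map_add, h₁.2, h₂.2, smul_add]⟩
  zero_mem' := ⟨zero_mem _, fun σ => by rw [map_zero, smul_zero]⟩
  smul_mem' c _ h := ⟨Submodule.smul_mem _ _ h.1, fun σ => by rw [map_smul, h.2, smul_comm]⟩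

/-- The skew-symmetrization `∑ σ, sign σ • σ η` of a form. -/
def skew {k n : ℕ} (z : Fin n ↪ ℂ) {p : ℕ} (η : Form (discrU k z) p) : Form (discrU k z) p :=
  ∑ σ : Equiv.Perm (Fin k), (((Equiv.Perm.sign σ : ℤˣ) : ℤ) : ℂ) • permForm z σ η

/-! ### Skew-symmetric flag forms -/

/-- For `K = (k_1, …, k_n)` with `|K| = p`, the label of `a ∈ {1, …, p}`: the index `i` with
`k_1 + ⋯ + k_{i-1} < a ≤ k_1 + ⋯ + k_i` (written with `a` and `i` counted from zero). -/
def label {n p : ℕ} (K : Fin n → ℕ) (hK : ∑ i, K i = p) (a : Fin p) : Fin n :=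
  (finSigmaFinEquiv.symm (Fin.cast hK.symm a)).1

/-- The form `η_{K,1} ∧ ⋯ ∧ η_{K,n}`, where
`η_{K,i} = d log (t_{l_{i-1}+1} - z_i) ∧ ⋯ ∧ d log (t_{l_i} - z_i)`, `l_i = k_1 + ⋯ + k_i`. -/
def etaForm {k n p : ℕ} (z : Fin n ↪ ℂ) (hp : p ≤ k) (K : Fin n → ℕ) (hK : ∑ i, K i = p) :
    Form (discrU k z) p :=
  logForm (discrFn z) fun a => DiscrHyp.pt (Fin.castLE hp a) (label K hK a)

/-- The form `ω_K`: the skew-symmetrization of `α_K η_{K,1} ∧ ⋯ ∧ η_{K,n}` if `|K| = k`, and of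
`(-1)^k α_K η_{K,1} ∧ ⋯ ∧ η_{K,n}` if `|K| = k - 1`, where
`α_K = (κ^{|K|} k_1! ⋯ k_n!)⁻¹`. -/
def omegaForm {k n p : ℕ} (z : Fin n ↪ ℂ) (κ : ℂ) (hp : p ≤ k) (K : Fin n → ℕ)
    (hK : ∑ i, K i = p) : Form (discrU k z) p :=
  skew z (((if p = k then 1 else (-1) ^ k) * (κ ^ p * ∏ i, ((K i).factorial : ℂ))⁻¹) •
    etaForm z hp K hK)

/-- The number `β^K_m = ∏_i k_i! ∏_{l = 1}^{k_i} (m_i + 1 - l)`. -/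
def beta {n : ℕ} (m K : Fin n → ℕ) : ℂ :=
  ∏ i, (((K i).factorial : ℂ) * ∏ l ∈ Finset.Icc 1 (K i), ((m i : ℂ) + 1 - (l : ℂ)))

/-- The space `F^p_-` of skew-symmetric flag forms: the span of the forms `β^K_m ω_K`, `|K| = p`,
for `p = k` and `p = k - 1`, and zero for other `p`. -/
def flagForms {n : ℕ} (k : ℕ) (z : Fin n ↪ ℂ) (m : Fin n → ℕ) (κ : ℂ) (p : ℕ) :
    Submodule ℂ (Form (discrU k z) p) :=
  Submodule.span ℂ {η | ∃ (hp : p ≤ k) (K : Fin n → ℕ) (hK : ∑ i, K i = p),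
    (p = k ∨ p + 1 = k) ∧ η = beta m K • omegaForm z κ hp K hK}

/-! ### The strata `C_I` of the exceptional divisors, in the affine chart with base index `b` -/

/-- The coordinate hyperplanes of the affine chart of `ℙ^{|I|-1} × ℂ^{k-|I|}` in which the
coordinates are `u_i = (t_i - c) / (t_b - c)` for `i ∈ I`, `i ≠ b`, and `t_i` for `i ∉ I`. -/
inductive StratumHyp {k : ℕ} (n : ℕ) (I : Finset (Fin k)) (b : Fin k) : Type
  | zero (i : {i : Fin k // i ≠ b}) (hi : i.1 ∈ I)
  | one (i : {i : Fin k // i ≠ b}) (hi : i.1 ∈ I)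
  | diagIn (i l : {i : Fin k // i ≠ b}) (h : i < l) (hi : i.1 ∈ I) (hl : l.1 ∈ I)
  | diagOut (i l : {i : Fin k // i ≠ b}) (h : i < l) (hi : i.1 ∉ I) (hl : l.1 ∉ I)
  | pt (i : {i : Fin k // i ≠ b}) (hi : i.1 ∉ I) (a : Fin n)

/-- The functions `u_i`, `u_i - 1`, `u_i - u_l` (for indices in `I`), and `t_i - t_l`,
`t_i - z_a` (for indices outside of `I`). -/
def stratumFn {k n : ℕ} (z : Fin n ↪ ℂ) (I : Finset (Fin k)) (b : Fin k) :
    StratumHyp n I b → ({i : Fin k // i ≠ b} → ℂ) →ᵃ[ℂ] ℂ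
  | .zero i _ => coordFn i
  | .one i _ => coordFn i - constFn 1
  | .diagIn i l _ _ _ => coordFn i - coordFn l
  | .diagOut i l _ _ _ => coordFn i - coordFn l
  | .pt i _ a => coordFn i - constFn (z a)

/-- The stratum `C_I`. Since it does not meet the locus where the homogeneous coordinate of
index `b` vanishes, it lies in the affine chart. -/
abbrev stratum {k n : ℕ} (z : Fin n ↪ ℂ) (I : Finset (Fin k)) (b : Fin k) :
    Set ({i : Fin k // i ≠ b} → ℂ) :=
  complement (stratumFn z I b)

/-- The coordinates, with the value `1` given to the coordinate of index `b`. -/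
def hom {k : ℕ} (b : Fin k) (x : {i : Fin k // i ≠ b} → ℂ) (i : Fin k) : ℂ :=
  if h : i = b then 1 else x ⟨i, h⟩

/-- The blow-down map in the chart (with `b ∈ I`) of the blow-up of `ℂ^k` along the edge
`t_i = c`, `i ∈ I`. The coordinates of the chart are `s = t_b - c`, `u_i = (t_i - c) / (t_b - c)`
for `i ∈ I`, `i ≠ b`, and `t_i` for `i ∉ I`; the exceptional divisor is `s = 0`. -/
def blowDown {k : ℕ} (I : Finset (Fin k)) (b : Fin k) (c : ℂ)
    (y : ({i : Fin k // i ≠ b} → ℂ) × ℂ) : Fin k → ℂ :=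
  fun i => if i ∈ I then c + y.2 * hom b y.1 i else hom b y.1 i

open Classical in
/-- The coefficients of a form on `U`, extended by zero to the whole space. -/
def extendZero {k p : ℕ} {V : Set (Fin k → ℂ)} (η : Form V p) (t : Fin k → ℂ) :
    (Fin k → ℂ) [⋀^Fin p]→ₗ[ℂ] ℂ :=
  if h : t ∈ V then η ⟨t, h⟩ else 0

/-- The form `ρ` on the stratum `C_I` is the residue of the form `η` on `U` along the
exceptional divisor `s = 0` of the blow-up of the edge `t_i = c`, `i ∈ I`: at every point `x` of
`C_I`, the contraction of the pull-back of `η` with `s ∂_s` tends to `ρ` as `s → 0`, `s ≠ 0`.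
If the pull-back is `ds / s ∧ α + β` with `α` and `β` regular along `s = 0`, then the limit is
the restriction of `α` to `s = 0`. For fixed `x` in `C_I` and small `s ≠ 0` the point
`blowDown I b c (x, s)` belongs to `U`. -/
def HasResidue {k n q : ℕ} (z : Fin n ↪ ℂ) (I : Finset (Fin k)) (b : Fin k) (c : ℂ)
    (η : Form (discrU k z) (q + 1)) (ρ : Form (stratum z I b) q) : Prop :=
  ∀ (x : stratum z I b) (v : Fin q → ({i : Fin k // i ≠ b} → ℂ)),
    Tendsto (fun s : ℂ => s * extendZero η (blowDown I b c (x.1, s))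
        (Fin.cons (fderiv ℂ (blowDown I b c) (x.1, s) (0, 1))
          fun a => fderiv ℂ (blowDown I b c) (x.1, s) (v a, 0)))
      (𝓝[≠] 0) (𝓝 (ρ x v))

/-- The subsets `I` of `{1, …, k}` with `r + 1` elements. -/
abbrev Edge (k r : ℕ) : Type := {I : Finset (Fin k) // I.card = r + 1}

/-- The base index of the affine chart used for `I`: the smallest element of `I`. -/
def Edge.base {k r : ℕ} (I : Edge k r) : Fin k :=
  I.1.min' (Finset.card_pos.1 (by rw [I.2]; exact Nat.succ_pos r))

theorem Edge.base_mem {k r : ℕ} (I : Edge k r) : I.base ∈ I.1 := Finset.min'_mem _ _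

/-- The image `σ I`. -/
def Edge.perm {k r : ℕ} (σ : Equiv.Perm (Fin k)) (I : Edge k r) : Edge k r :=
  ⟨I.1.map σ.toEmbedding, by rw [Finset.card_map, I.2]⟩

theorem Edge.mem_perm_inv {k r : ℕ} (σ : Equiv.Perm (Fin k)) (I : Edge k r) (i : Fin k) :
    i ∈ (I.perm σ⁻¹).1 ↔ σ i ∈ I.1 := by
  simp only [Edge.perm, Finset.mem_map_equiv]
  rfl

/-- The isomorphism `C_I → C_{σ⁻¹ I}` induced by `t ↦ t ∘ σ`, in the charts with base indices
`b` and `b'`: the homogeneous coordinates are permuted and normalized. -/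
def chartMap {k : ℕ} (σ : Equiv.Perm (Fin k)) (I : Finset (Fin k)) (b b' : Fin k)
    (x : {i : Fin k // i ≠ b} → ℂ) : {i : Fin k // i ≠ b'} → ℂ :=
  fun i => if σ i.1 ∈ I then hom b x (σ i.1) / hom b x (σ b') else hom b x (σ i.1)

theorem hom_self {k : ℕ} (b : Fin k) (x : {i : Fin k // i ≠ b} → ℂ) : hom b x b = 1 := by
  simp [hom]

theorem hom_ne {k : ℕ} {b i : Fin k} (x : {i : Fin k // i ≠ b} → ℂ) (h : i ≠ b) :
    hom b x i = x ⟨i, h⟩ := by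
  simp [hom, h]

theorem mem_stratum_iff {k n : ℕ} (z : Fin n ↪ ℂ) {I : Finset (Fin k)} {b : Fin k} (hb : b ∈ I)
    (x : {i : Fin k // i ≠ b} → ℂ) :
    x ∈ stratum z I b ↔ (∀ i ∈ I, hom b x i ≠ 0) ∧
      (∀ i ∈ I, ∀ l ∈ I, i ≠ l → hom b x i ≠ hom b x l) ∧
      (∀ i, i ∉ I → ∀ l, l ∉ I → i ≠ l → hom b x i ≠ hom b x l) ∧
      ∀ i, i ∉ I → ∀ a, hom b x i ≠ z a := by
  have hbo : ∀ i, i ∉ I → i ≠ b := fun i hi h => hi (h ▸ hb)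
  constructor
  · intro h
    refine ⟨fun i hi => ?_, fun i hi l hl hil => ?_, fun i hi l hl hil => ?_, fun i hi a => ?_⟩
    · by_cases hib : i = b
      · subst hib; simp [hom_self]
      · have := h (.zero ⟨i, hib⟩ hi)
        simpa [stratumFn, coordFn, hom_ne x hib] using this
    · by_cases hib : i = b
      · subst hib
        have := h (.one ⟨l, hil.symm⟩ hl)
        rw [hom_self, hom_ne x hil.symm]
        refine Ne.symm ?_
        simpa [stratumFn, coordFn, constFn, sub_eq_zero] using this
      · by_cases hlb : l = b
        · subst hlb
          have := h (.one ⟨i, hib⟩ hi)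
          rw [hom_self, hom_ne x hib]
          simpa [stratumFn, coordFn, constFn, sub_eq_zero] using this
        · rw [hom_ne x hib, hom_ne x hlb]
          rcases lt_or_gt_of_ne hil with h' | h'
          · have := h (.diagIn ⟨i, hib⟩ ⟨l, hlb⟩ h' hi hl)
            simpa [stratumFn, coordFn, sub_eq_zero] using this
          · have := h (.diagIn ⟨l, hlb⟩ ⟨i, hib⟩ h' hl hi)
            refine Ne.symm ?_
            simpa [stratumFn, coordFn, sub_eq_zero] using this
    · rw [hom_ne x (hbo i hi), hom_ne x (hbo l hl)]
      rcases lt_or_gt_of_ne hil with h' | h'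
      · have := h (.diagOut ⟨i, hbo i hi⟩ ⟨l, hbo l hl⟩ h' hi hl)
        simpa [stratumFn, coordFn, sub_eq_zero] using this
      · have := h (.diagOut ⟨l, hbo l hl⟩ ⟨i, hbo i hi⟩ h' hl hi)
        refine Ne.symm ?_
        simpa [stratumFn, coordFn, sub_eq_zero] using this
    · rw [hom_ne x (hbo i hi)]
      have := h (.pt ⟨i, hbo i hi⟩ hi a)
      simpa [stratumFn, coordFn, constFn, sub_eq_zero] using this
  · rintro ⟨h1, h2, h3, h4⟩ (⟨i, hi⟩ | ⟨i, hi⟩ | ⟨i, l, h, hi, hl⟩ | ⟨i, l, h, hi, hl⟩ | ⟨i, hi, a⟩)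
    · have := h1 i.1 hi
      rw [hom_ne x i.2] at this
      simpa [stratumFn, coordFn] using this
    · have := h2 i.1 hi b hb i.2
      rw [hom_ne x i.2, hom_self] at this
      simpa [stratumFn, coordFn, constFn, sub_eq_zero] using this
    · have := h2 i.1 hi l.1 hl (fun e => h.ne (Subtype.ext e))
      rw [hom_ne x i.2, hom_ne x l.2] at this
      simpa [stratumFn, coordFn, sub_eq_zero] using this
    · have := h3 i.1 hi l.1 hl (fun e => h.ne (Subtype.ext e))
      rw [hom_ne x i.2, hom_ne x l.2] at this
      simpa [stratumFn, coordFn, sub_eq_zero] using this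
    · have := h4 i.1 hi a
      rw [hom_ne x i.2] at this
      simpa [stratumFn, coordFn, constFn, sub_eq_zero] using this

theorem hom_chartMap {k : ℕ} (σ : Equiv.Perm (Fin k)) {I : Finset (Fin k)} {b b' : Fin k}
    (hb' : σ b' ∈ I) (x : {i : Fin k // i ≠ b} → ℂ) (hx : hom b x (σ b') ≠ 0) (i : Fin k) :
    hom b' (chartMap σ I b b' x) i =
      if σ i ∈ I then hom b x (σ i) / hom b x (σ b') else hom b x (σ i) := by
  by_cases h : i = b'
  · subst h; rw [hom_self, if_pos hb', div_self hx]
  · rw [hom_ne _ h]; rfl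

theorem chartMap_mem {k n r : ℕ} (z : Fin n ↪ ℂ) (σ : Equiv.Perm (Fin k)) (I : Edge k r)
    {x : {i : Fin k // i ≠ I.base} → ℂ} (hx : x ∈ stratum z I.1 I.base) :
    chartMap σ I.1 I.base (I.perm σ⁻¹).base x ∈ stratum z (I.perm σ⁻¹).1 (I.perm σ⁻¹).base := by
  have hb' : σ (I.perm σ⁻¹).base ∈ I.1 := (I.mem_perm_inv σ _).1 (I.perm σ⁻¹).base_mem
  rw [mem_stratum_iff z I.base_mem] at hx
  obtain ⟨h1, h2, h3, h4⟩ := hx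
  have h0 := h1 _ hb'
  rw [mem_stratum_iff z (I.perm σ⁻¹).base_mem]
  simp only [I.mem_perm_inv, hom_chartMap σ hb' x h0]
  refine ⟨fun i hi => ?_, fun i hi l hl hil => ?_, fun i hi l hl hil => ?_, fun i hi a => ?_⟩
  · rw [if_pos hi]; exact div_ne_zero (h1 _ hi) h0
  · rw [if_pos hi, if_pos hl]
    intro h
    exact h2 _ hi _ hl (fun e => hil (σ.injective e)) ((div_left_inj' h0).1 h)
  · rw [if_neg hi, if_neg hl]; exact h3 _ hi _ hl (fun e => hil (σ.injective e))
  · rw [if_neg hi]; exact h4 _ hi a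

/-- Families of forms on the strata `C_I`, `|I| = r + 1`, that is, forms on their disjoint
union. -/
abbrev EdgeForm {n : ℕ} (k : ℕ) (z : Fin n ↪ ℂ) (r q : ℕ) : Type :=
  ∀ I : Edge k r, Form (stratum z I.1 I.base) q

/-- The action of `σ ∈ S_k` on forms on the union of the strata `C_I`: the pull-back along the
isomorphisms `C_I → C_{σ⁻¹ I}` given by the action of `σ⁻¹`. -/
def permEdgeForm {k n : ℕ} (z : Fin n ↪ ℂ) {r q : ℕ} (σ : Equiv.Perm (Fin k)) :
    EdgeForm k z r q →ₗ[ℂ] EdgeForm k z r q where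
  toFun ρ := fun I x =>
    (ρ (I.perm σ⁻¹) ⟨chartMap σ I.1 I.base (I.perm σ⁻¹).base x.1, chartMap_mem z σ I x.2⟩
      ).compLinearMap (fderiv ℂ (chartMap σ I.1 I.base (I.perm σ⁻¹).base) x.1).toLinearMap
  map_add' _ _ := by ext; simp
  map_smul' _ _ := by ext; simp

/-- The skew-symmetric part `A^q_-` of the Orlik-Solomon space `⊕_I A^q(C_I)` of the union of
the strata `C_I`, `|I| = r + 1`. -/
def skewEdgeOS {n : ℕ} (k : ℕ) (z : Fin n ↪ ℂ) (r q : ℕ) : Submodule ℂ (EdgeForm k z r q) where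
  carrier := {ρ | (∀ I : Edge k r, ρ I ∈ orlikSolomon (stratumFn z I.1 I.base) q) ∧
    ∀ σ : Equiv.Perm (Fin k), permEdgeForm z σ ρ = (((Equiv.Perm.sign σ : ℤˣ) : ℤ) : ℂ) • ρ}
  add_mem' h₁ h₂ := ⟨fun I => add_mem (h₁.1 I) (h₂.1 I),
    fun σ => by rw [map_add, h₁.2, h₂.2, smul_add]⟩
  zero_mem' := ⟨fun _ => zero_mem _, fun σ => by rw [map_zero, smul_zero]⟩
  smul_mem' c _ h := ⟨fun I => Submodule.smul_mem _ _ (h.1 I),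
    fun σ => by rw [map_smul, h.2, smul_comm]⟩

/-! ### Existence and uniqueness of the residues -/

/-- The derivative of `hom b x i` with respect to `x`. -/
def homD {k : ℕ} (b i : Fin k) : ({i : Fin k // i ≠ b} → ℂ) →L[ℂ] ℂ :=
  if h : i = b then 0 else ContinuousLinearMap.proj ⟨i, h⟩

theorem homD_self {k : ℕ} (b : Fin k) : homD b b = 0 := by simp [homD]

theorem homD_ne {k : ℕ} {b i : Fin k} (v : {i : Fin k // i ≠ b} → ℂ) (h : i ≠ b) :
    homD b i v = v ⟨i, h⟩ := by simp [homD, h]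

theorem hasFDerivAt_hom {k : ℕ} (b i : Fin k) (x : {i : Fin k // i ≠ b} → ℂ) :
    HasFDerivAt (fun x => hom b x i) (homD b i) x := by
  by_cases h : i = b
  · subst h
    simp only [hom_self, homD_self]
    exact hasFDerivAt_const _ _
  · simp only [hom, homD, h, dite_false]
    exact hasFDerivAt_apply _ _

theorem fderiv_blowDown {k : ℕ} (I : Finset (Fin k)) (b : Fin k) (c : ℂ)
    (x v : {i : Fin k // i ≠ b} → ℂ) (s w : ℂ) (i : Fin k) :
    fderiv ℂ (blowDown I b c) (x, s) (v, w) i =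
      if i ∈ I then s * homD b i v + w * hom b x i else homD b i v := by
  have key : HasFDerivAt (blowDown I b c) (ContinuousLinearMap.pi fun i =>
      if i ∈ I then s • (homD b i).comp (ContinuousLinearMap.fst ℂ _ ℂ) +
        hom b x i • ContinuousLinearMap.snd ℂ _ ℂ
      else (homD b i).comp (ContinuousLinearMap.fst ℂ _ ℂ)) (x, s) := by
    rw [hasFDerivAt_pi]
    intro i
    have h1 : HasFDerivAt (fun y : ({i : Fin k // i ≠ b} → ℂ) × ℂ => hom b y.1 i)
        ((homD b i).comp (ContinuousLinearMap.fst ℂ _ ℂ)) (x, s) :=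
      HasFDerivAt.comp (g := fun x => hom b x i) (x, s) (hasFDerivAt_hom b i x) hasFDerivAt_fst
    by_cases hi : i ∈ I
    · simp only [blowDown, hi, if_true]
      exact (hasFDerivAt_snd.mul h1).const_add c
    · simp only [blowDown, hi, if_false]
      exact h1
  rw [key.fderiv]
  by_cases hi : i ∈ I
  · simp [hi, mul_comm]
  · simp [hi]

theorem fderiv_chartMap {k : ℕ} (σ : Equiv.Perm (Fin k)) {I : Finset (Fin k)} {b b' : Fin k}
    (hb' : σ b' ∈ I) (x v : {i : Fin k // i ≠ b} → ℂ) (hx : hom b x (σ b') ≠ 0) (i : Fin k) :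
    homD b' i (fderiv ℂ (chartMap σ I b b') x v) =
      if σ i ∈ I then homD b (σ i) v / hom b x (σ b') -
        hom b x (σ i) * homD b (σ b') v / hom b x (σ b') ^ 2
      else homD b (σ i) v := by
  by_cases h : i = b'
  · subst h
    rw [homD_self, if_pos hb']
    field_simp
    simp
  rw [homD_ne _ h]
  have key : HasFDerivAt (chartMap σ I b b') (ContinuousLinearMap.pi
      fun i : {i : Fin k // i ≠ b'} => if σ i.1 ∈ I then
        hom b x (σ i.1) • (-(hom b x (σ b') ^ 2)⁻¹ • homD b (σ b')) +
          (hom b x (σ b'))⁻¹ • homD b (σ i.1)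
      else homD b (σ i.1)) x := by
    rw [hasFDerivAt_pi]
    intro i
    by_cases hi : σ i.1 ∈ I
    · simp only [chartMap, hi, if_true, div_eq_mul_inv]
      have h2 : HasFDerivAt (fun x => (hom b x (σ b'))⁻¹)
          (-(hom b x (σ b') ^ 2)⁻¹ • homD b (σ b')) x :=
        HasDerivAt.comp_hasFDerivAt x (hasDerivAt_inv hx) (hasFDerivAt_hom b (σ b') x)
      exact (hasFDerivAt_hom b (σ i.1) x).mul h2
    · simp only [chartMap, hi, if_false]
      exact hasFDerivAt_hom b (σ i.1) x
  rw [key.fderiv]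
  by_cases hi : σ i ∈ I
  · simp [hi]
    ring
  · simp [hi]

/-- The form `d log` of a function of the arrangement, or zero. -/
def optLog {ι H : Type} (f : H → (ι → ℂ) →ᵃ[ℂ] ℂ) (g : Option H) (x : ι → ℂ) :
    (ι → ℂ) →ₗ[ℂ] ℂ :=
  g.elim 0 fun h => dlog (f h) x

theorem limit_polar (P N₁ N₂ : ℂ → ℂ) {G D L : ℂ} (hG : G ≠ 0) (hP : ∀ s, P s = s * G)
    (h₁ : ∀ s, N₁ s = G) (h₂ : ∀ s, N₂ s = s * D) (hL : L = G⁻¹ * D) :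
    (∀ᶠ s : ℂ in 𝓝[≠] 0, P s ≠ 0) ∧
      Tendsto (fun s : ℂ => s * ((P s)⁻¹ * N₁ s)) (𝓝[≠] 0) (𝓝 1) ∧
      Tendsto (fun s : ℂ => (P s)⁻¹ * N₂ s) (𝓝[≠] 0) (𝓝 L) := by
  have h0 : ∀ᶠ s : ℂ in 𝓝[≠] 0, s ≠ 0 := eventually_mem_nhdsWithin
  simp only [hP, h₁, h₂, hL]
  refine ⟨h0.mono fun s hs => mul_ne_zero hs hG, ?_, ?_⟩
  · refine tendsto_const_nhds.congr' (h0.mono fun s hs => ?_)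
    field_simp
  · refine tendsto_const_nhds.congr' (h0.mono fun s hs => ?_)
    field_simp

theorem limit_regular (P N₁ N₂ : ℂ → ℂ) {F₀ F₁ D₀ D₁ L : ℂ} (hF : F₀ ≠ 0)
    (hP : ∀ s, P s = F₀ + s * F₁) (h₁ : ∀ s, N₁ s = F₁) (h₂ : ∀ s, N₂ s = D₀ + s * D₁)
    (hL : L = F₀⁻¹ * D₀) :
    (∀ᶠ s : ℂ in 𝓝[≠] 0, P s ≠ 0) ∧
      Tendsto (fun s : ℂ => s * ((P s)⁻¹ * N₁ s)) (𝓝[≠] 0) (𝓝 0) ∧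
      Tendsto (fun s : ℂ => (P s)⁻¹ * N₂ s) (𝓝[≠] 0) (𝓝 L) := by
  simp only [hP, h₁, h₂, hL]
  have hc : ContinuousAt (fun s : ℂ => F₀ + s * F₁) 0 := by fun_prop
  have hc0 : F₀ + (0 : ℂ) * F₁ ≠ 0 := by simpa using hF
  have hi : ContinuousAt (fun s : ℂ => (F₀ + s * F₁)⁻¹) 0 := hc.inv₀ hc0
  refine ⟨(hc.eventually_ne hc0).filter_mono nhdsWithin_le_nhds, ?_, ?_⟩
  · have : ContinuousAt (fun s : ℂ => s * ((F₀ + s * F₁)⁻¹ * F₁)) 0 := by fun_prop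
    simpa using this.tendsto.mono_left (nhdsWithin_le_nhds (s := {(0 : ℂ)}ᶜ))
  · have : ContinuousAt (fun s : ℂ => (F₀ + s * F₁)⁻¹ * (D₀ + s * D₁)) 0 := by fun_prop
    simpa using this.tendsto.mono_left (nhdsWithin_le_nhds (s := {(0 : ℂ)}ᶜ))

/-- The pull-back of each `d log` is `e ds / s` plus a form with restriction `g` to `s = 0`. -/
theorem exists_limit_dlog {k n : ℕ} (z : Fin n ↪ ℂ) {I : Finset (Fin k)} {b : Fin k}
    (hb : b ∈ I) (j : Fin n) (h : DiscrHyp k n) :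
    ∃ (e : ℂ) (g : Option (StratumHyp n I b)), ∀ x ∈ stratum z I b,
      ∀ v : {i : Fin k // i ≠ b} → ℂ,
      (∀ᶠ s : ℂ in 𝓝[≠] 0, discrFn z h (blowDown I b (z j) (x, s)) ≠ 0) ∧
      Tendsto (fun s : ℂ => s * dlog (discrFn z h) (blowDown I b (z j) (x, s))
        (fderiv ℂ (blowDown I b (z j)) (x, s) (0, 1))) (𝓝[≠] 0) (𝓝 e) ∧
      Tendsto (fun s : ℂ => dlog (discrFn z h) (blowDown I b (z j) (x, s))
        (fderiv ℂ (blowDown I b (z j)) (x, s) (v, 0))) (𝓝[≠] 0)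
        (𝓝 (optLog (stratumFn z I b) g x v)) := by
  have hbo : ∀ i, i ∉ I → i ≠ b := fun i hi h => hi (h ▸ hb)
  obtain ⟨i, l, hil⟩ | ⟨i, a⟩ := h
  · by_cases hi : i ∈ I <;> by_cases hl : l ∈ I
    · obtain ⟨g, hg⟩ : ∃ g : Option (StratumHyp n I b), ∀ x v,
          optLog (stratumFn z I b) g x v =
            (hom b x i - hom b x l)⁻¹ * (homD b i v - homD b l v) := by
        by_cases hib : i = b
        · subst hib
          refine ⟨some (.one ⟨l, hil.ne'⟩ hl), fun x v => ?_⟩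
          rw [hom_self, homD_self, hom_ne x hil.ne', homD_ne v hil.ne']
          rw [← neg_sub (x _) 1, inv_neg]
          simp [optLog, dlog, stratumFn, coordFn, constFn]
        · by_cases hlb : l = b
          · subst hlb
            refine ⟨some (.one ⟨i, hib⟩ hi), fun x v => ?_⟩
            rw [hom_self, homD_self, hom_ne x hib, homD_ne v hib]
            simp [optLog, dlog, stratumFn, coordFn, constFn]
          · refine ⟨some (.diagIn ⟨i, hib⟩ ⟨l, hlb⟩ hil hi hl), fun x v => ?_⟩
            rw [hom_ne x hib, homD_ne v hib, hom_ne x hlb, homD_ne v hlb]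
            simp [optLog, dlog, stratumFn, coordFn]
      refine ⟨1, g, fun x hx v => ?_⟩
      obtain ⟨h1, h2, h3, h4⟩ := (mem_stratum_iff z hb x).1 hx
      refine limit_polar (D := homD b i v - homD b l v)
        (fun s => discrFn z (.diag i l hil) (blowDown I b (z j) (x, s)))
        (fun s => (discrFn z (.diag i l hil)).linear (fderiv ℂ (blowDown I b (z j)) (x, s) (0, 1)))
        (fun s => (discrFn z (.diag i l hil)).linear (fderiv ℂ (blowDown I b (z j)) (x, s) (v, 0)))
        (sub_ne_zero.2 (h2 i hi l hl hil.ne)) (fun s => ?_) (fun s => ?_) (fun s => ?_) (hg x v)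
      · simp [discrFn, coordFn, blowDown, hi, hl]; ring
      · simp [discrFn, coordFn, fderiv_blowDown, hi, hl]
      · simp [discrFn, coordFn, fderiv_blowDown, hi, hl]; ring
    · refine ⟨0, some (.pt ⟨l, hbo l hl⟩ hl j), fun x hx v => ?_⟩
      obtain ⟨h1, h2, h3, h4⟩ := (mem_stratum_iff z hb x).1 hx
      refine limit_regular (fun s => discrFn z (.diag i l hil) (blowDown I b (z j) (x, s)))
        (fun s => (discrFn z (.diag i l hil)).linear (fderiv ℂ (blowDown I b (z j)) (x, s) (0, 1)))
        (fun s => (discrFn z (.diag i l hil)).linear (fderiv ℂ (blowDown I b (z j)) (x, s) (v, 0)))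
        (F₁ := hom b x i) (D₀ := -homD b l v) (D₁ := homD b i v)
        (sub_ne_zero.2 (h4 l hl j).symm) (fun s => ?_) (fun s => ?_) (fun s => ?_) ?_
      · simp [discrFn, coordFn, blowDown, hi, hl]; ring
      · simp [discrFn, coordFn, fderiv_blowDown, hi, hl]
      · simp [discrFn, coordFn, fderiv_blowDown, hi, hl]; ring
      · rw [hom_ne x (hbo l hl), homD_ne v (hbo l hl), ← neg_sub (x _) (z j), inv_neg]
        simp [optLog, dlog, stratumFn, coordFn, constFn]
    · refine ⟨0, some (.pt ⟨i, hbo i hi⟩ hi j), fun x hx v => ?_⟩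
      obtain ⟨h1, h2, h3, h4⟩ := (mem_stratum_iff z hb x).1 hx
      refine limit_regular (fun s => discrFn z (.diag i l hil) (blowDown I b (z j) (x, s)))
        (fun s => (discrFn z (.diag i l hil)).linear (fderiv ℂ (blowDown I b (z j)) (x, s) (0, 1)))
        (fun s => (discrFn z (.diag i l hil)).linear (fderiv ℂ (blowDown I b (z j)) (x, s) (v, 0)))
        (F₁ := -hom b x l) (D₀ := homD b i v) (D₁ := -homD b l v)
        (sub_ne_zero.2 (h4 i hi j)) (fun s => ?_) (fun s => ?_) (fun s => ?_) ?_
      · simp [discrFn, coordFn, blowDown, hi, hl]; ring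
      · simp [discrFn, coordFn, fderiv_blowDown, hi, hl]
      · simp [discrFn, coordFn, fderiv_blowDown, hi, hl]; ring
      · rw [hom_ne x (hbo i hi), homD_ne v (hbo i hi)]
        simp [optLog, dlog, stratumFn, coordFn, constFn]
    · refine ⟨0, some (.diagOut ⟨i, hbo i hi⟩ ⟨l, hbo l hl⟩ hil hi hl), fun x hx v => ?_⟩
      obtain ⟨h1, h2, h3, h4⟩ := (mem_stratum_iff z hb x).1 hx
      refine limit_regular (fun s => discrFn z (.diag i l hil) (blowDown I b (z j) (x, s)))
        (fun s => (discrFn z (.diag i l hil)).linear (fderiv ℂ (blowDown I b (z j)) (x, s) (0, 1)))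
        (fun s => (discrFn z (.diag i l hil)).linear (fderiv ℂ (blowDown I b (z j)) (x, s) (v, 0)))
        (F₁ := 0) (D₀ := homD b i v - homD b l v) (D₁ := 0)
        (sub_ne_zero.2 (h3 i hi l hl hil.ne)) (fun s => ?_) (fun s => ?_) (fun s => ?_) ?_
      · simp [discrFn, coordFn, blowDown, hi, hl]
      · simp [discrFn, coordFn, fderiv_blowDown, hi, hl]
      · simp [discrFn, coordFn, fderiv_blowDown, hi, hl]
      · rw [hom_ne x (hbo i hi), homD_ne v (hbo i hi), hom_ne x (hbo l hl), homD_ne v (hbo l hl)]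
        simp [optLog, dlog, stratumFn, coordFn]
  · by_cases hi : i ∈ I
    · by_cases haj : a = j
      · subst haj
        obtain ⟨g, hg⟩ : ∃ g : Option (StratumHyp n I b), ∀ x v,
            optLog (stratumFn z I b) g x v = (hom b x i)⁻¹ * homD b i v := by
          by_cases hib : i = b
          · subst hib
            exact ⟨none, fun x v => by simp [optLog, homD_self]⟩
          · refine ⟨some (.zero ⟨i, hib⟩ hi), fun x v => ?_⟩
            rw [hom_ne x hib, homD_ne v hib]
            simp [optLog, dlog, stratumFn, coordFn]
        refine ⟨1, g, fun x hx v => ?_⟩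
        obtain ⟨h1, h2, h3, h4⟩ := (mem_stratum_iff z hb x).1 hx
        refine limit_polar (fun s => discrFn z (.pt i a) (blowDown I b (z a) (x, s)))
          (fun s => (discrFn z (.pt i a)).linear (fderiv ℂ (blowDown I b (z a)) (x, s) (0, 1)))
          (fun s => (discrFn z (.pt i a)).linear (fderiv ℂ (blowDown I b (z a)) (x, s) (v, 0)))
          (h1 i hi) (fun s => ?_) (fun s => ?_) (fun s => ?_) (hg x v)
        · simp [discrFn, coordFn, constFn, blowDown, hi]
        · simp [discrFn, coordFn, constFn, fderiv_blowDown, hi]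
        · simp [discrFn, coordFn, constFn, fderiv_blowDown, hi]
      · refine ⟨0, none, fun x hx v => ?_⟩
        refine limit_regular (fun s => discrFn z (.pt i a) (blowDown I b (z j) (x, s)))
          (fun s => (discrFn z (.pt i a)).linear (fderiv ℂ (blowDown I b (z j)) (x, s) (0, 1)))
          (fun s => (discrFn z (.pt i a)).linear (fderiv ℂ (blowDown I b (z j)) (x, s) (v, 0)))
          (F₁ := hom b x i) (D₀ := 0) (D₁ := homD b i v)
          (sub_ne_zero.2 fun e => haj (z.injective e.symm)) (fun s => ?_) (fun s => ?_)
          (fun s => ?_) ?_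
        · simp [discrFn, coordFn, constFn, blowDown, hi]; ring
        · simp [discrFn, coordFn, constFn, fderiv_blowDown, hi]
        · simp [discrFn, coordFn, constFn, fderiv_blowDown, hi]
        · simp [optLog]
    · refine ⟨0, some (.pt ⟨i, hbo i hi⟩ hi a), fun x hx v => ?_⟩
      obtain ⟨h1, h2, h3, h4⟩ := (mem_stratum_iff z hb x).1 hx
      refine limit_regular (fun s => discrFn z (.pt i a) (blowDown I b (z j) (x, s)))
        (fun s => (discrFn z (.pt i a)).linear (fderiv ℂ (blowDown I b (z j)) (x, s) (0, 1)))
        (fun s => (discrFn z (.pt i a)).linear (fderiv ℂ (blowDown I b (z j)) (x, s) (v, 0)))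
        (F₁ := 0) (D₀ := homD b i v) (D₁ := 0)
        (sub_ne_zero.2 (h4 i hi a)) (fun s => ?_) (fun s => ?_) (fun s => ?_) ?_
      · simp [discrFn, coordFn, constFn, blowDown, hi]
      · simp [discrFn, coordFn, constFn, fderiv_blowDown, hi]
      · simp [discrFn, coordFn, constFn, fderiv_blowDown, hi]
      · rw [hom_ne x (hbo i hi), homD_ne v (hbo i hi)]
        simp [optLog, dlog, stratumFn, coordFn, constFn]

theorem finite_discrHyp (k n : ℕ) : Finite (DiscrHyp k n) := by
  refine Finite.of_injective (β := (Fin k × Fin k) ⊕ (Fin k × Fin n))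
    (fun h => match h with
      | .diag i l _ => Sum.inl (i, l)
      | .pt i a => Sum.inr (i, a)) ?_
  rintro (⟨i, l, h⟩ | ⟨i, a⟩) (⟨i', l', h'⟩ | ⟨i', a'⟩) e <;> simp_all

theorem eventually_mem_discrU {k n : ℕ} (z : Fin n ↪ ℂ) {I : Finset (Fin k)} {b : Fin k}
    (hb : b ∈ I) (j : Fin n) {x : {i : Fin k // i ≠ b} → ℂ} (hx : x ∈ stratum z I b) :
    ∀ᶠ s : ℂ in 𝓝[≠] 0, blowDown I b (z j) (x, s) ∈ discrU k z := by
  have := finite_discrHyp k n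
  have h : ∀ h : DiscrHyp k n, ∀ᶠ s : ℂ in 𝓝[≠] 0,
      discrFn z h (blowDown I b (z j) (x, s)) ≠ 0 := fun h => by
    obtain ⟨e, g, H⟩ := exists_limit_dlog z hb j h
    exact (H x hx 0).1
  exact eventually_all.2 h

theorem extendZero_of_mem {k p : ℕ} {V : Set (Fin k → ℂ)} (η : Form V p) {t : Fin k → ℂ}
    (h : t ∈ V) : extendZero η t = η ⟨t, h⟩ := dif_pos h

theorem wedge_optLog_mem {ι H : Type} (f : H → (ι → ℂ) →ᵃ[ℂ] ℂ) {q : ℕ} (g : Fin q → Option H) :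
    (fun x : complement f => wedge fun a => optLog f (g a) x.1) ∈ orlikSolomon f q := by
  by_cases h : ∃ a, g a = none
  · obtain ⟨a, ha⟩ := h
    suffices h0 : (fun x : complement f => wedge fun a => optLog f (g a) x.1) = 0 by
      rw [h0]; exact zero_mem _
    funext x
    ext v
    exact Matrix.det_eq_zero_of_column_eq_zero a fun c => by simp [ha, optLog]
  · push Not at h
    choose s hs using fun a => Option.ne_none_iff_exists'.1 (h a)
    refine Submodule.subset_span ⟨s, ?_⟩
    funext x
    simp [logForm, hs, optLog]

theorem HasResidue.unique {k n q : ℕ} {z : Fin n ↪ ℂ} {I : Finset (Fin k)} {b : Fin k} {c : ℂ}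
    {η : Form (discrU k z) (q + 1)} {ρ ρ' : Form (stratum z I b) q}
    (h : HasResidue z I b c η ρ) (h' : HasResidue z I b c η ρ') : ρ = ρ' := by
  ext x v
  exact tendsto_nhds_unique (h x v) (h' x v)

theorem HasResidue.add {k n q : ℕ} {z : Fin n ↪ ℂ} {I : Finset (Fin k)} {b : Fin k} {c : ℂ}
    {η η' : Form (discrU k z) (q + 1)} {ρ ρ' : Form (stratum z I b) q}
    (h : HasResidue z I b c η ρ) (h' : HasResidue z I b c η' ρ') :
    HasResidue z I b c (η + η') (ρ + ρ') := by
  intro x v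
  refine ((h x v).add (h' x v)).congr fun s => ?_
  simp only [extendZero]
  split_ifs <;> simp [mul_add]

theorem HasResidue.smul {k n q : ℕ} {z : Fin n ↪ ℂ} {I : Finset (Fin k)} {b : Fin k} {c : ℂ}
    {η : Form (discrU k z) (q + 1)} {ρ : Form (stratum z I b) q} (r : ℂ)
    (h : HasResidue z I b c η ρ) : HasResidue z I b c (r • η) (r • ρ) := by
  intro x v
  refine ((h x v).const_mul r).congr fun s => ?_
  simp only [extendZero]
  split_ifs <;> simp [mul_left_comm]

theorem HasResidue.zero {k n q : ℕ} {z : Fin n ↪ ℂ} {I : Finset (Fin k)} {b : Fin k} {c : ℂ} :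
    HasResidue z I b c (0 : Form (discrU k z) (q + 1)) 0 := by
  intro x v
  refine tendsto_const_nhds.congr fun s => ?_
  simp only [extendZero]
  split_ifs <;> simp

/-- Orlik-Solomon forms on `U` have residues, which are Orlik-Solomon forms on `C_I`. -/
theorem exists_residue {k n q : ℕ} (z : Fin n ↪ ℂ) {I : Finset (Fin k)} {b : Fin k}
    (hb : b ∈ I) (j : Fin n) {η : Form (discrU k z) (q + 1)} (hη : η ∈ discrOS k z (q + 1)) :
    ∃ ρ ∈ orlikSolomon (stratumFn z I b) q, HasResidue z I b (z j) η ρ := by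
  induction hη using Submodule.span_induction with
  | zero => exact ⟨0, zero_mem _, HasResidue.zero⟩
  | add η η' _ _ h h' =>
    obtain ⟨ρ, h1, h2⟩ := h
    obtain ⟨ρ', h1', h2'⟩ := h'
    exact ⟨ρ + ρ', add_mem h1 h1', h2.add h2'⟩
  | smul r η _ h =>
    obtain ⟨ρ, h1, h2⟩ := h
    exact ⟨r • ρ, Submodule.smul_mem _ _ h1, h2.smul r⟩
  | mem η h =>
    obtain ⟨s, rfl⟩ := h
    choose e g H using fun h : DiscrHyp k n => exists_limit_dlog (I := I) z hb j h
    refine ⟨∑ c : Fin (q + 1), ((-1) ^ (c : ℕ) * e (s c)) •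
      (fun x : stratum z I b => wedge fun a => optLog (stratumFn z I b) (g (s (c.succAbove a))) x.1),
      Submodule.sum_mem _ fun c _ => Submodule.smul_mem _ _ (wedge_optLog_mem _ _), fun x v => ?_⟩
    set N : Matrix (Fin (q + 1)) (Fin (q + 1)) ℂ := Matrix.of fun a c =>
      (Fin.cons (e (s c)) fun a' => optLog (stratumFn z I b) (g (s c)) x.1 (v a') :
        Fin (q + 1) → ℂ) a with hN
    have hdet : (∑ c : Fin (q + 1), ((-1) ^ (c : ℕ) * e (s c)) •
      (fun x : stratum z I b => wedge fun a => optLog (stratumFn z I b)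
        (g (s (c.succAbove a))) x.1)) x v = N.det := by
      rw [Matrix.det_succ_row_zero]
      rw [Finset.sum_apply]
      rw [show ∀ F : Fin (q + 1) → ({i : Fin k // i ≠ b} → ℂ) [⋀^Fin q]→ₗ[ℂ] ℂ,
        (∑ c, F c) v = ∑ c, F c v from fun F => by
          induction (Finset.univ : Finset (Fin (q + 1))) using Finset.induction_on <;> simp_all]
      rfl
    rw [hdet]
    let M : ℂ → Matrix (Fin (q + 1)) (Fin (q + 1)) ℂ := fun t => Matrix.of fun a c =>
      (Fin.cons (t * dlog (discrFn z (s c)) (blowDown I b (z j) (x.1, t))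
          (fderiv ℂ (blowDown I b (z j)) (x.1, t) (0, 1)))
        fun a' => dlog (discrFn z (s c)) (blowDown I b (z j) (x.1, t))
          (fderiv ℂ (blowDown I b (z j)) (x.1, t) (v a', 0)) : Fin (q + 1) → ℂ) a
    have hM : Tendsto M (𝓝[≠] 0) (𝓝 N) := by
      refine tendsto_pi_nhds.2 fun a => tendsto_pi_nhds.2 fun c => ?_
      refine Fin.cases ?_ (fun a' => ?_) a
      · exact (H (s c) x.1 x.2 0).2.1
      · exact (H (s c) x.1 x.2 (v a')).2.2
    have hMd : Tendsto (fun t => (M t).det) (𝓝[≠] 0) (𝓝 N.det) :=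
      ((continuous_id.matrix_det).tendsto N).comp hM
    refine hMd.congr' ((eventually_mem_discrU z hb j x.2).mono fun t ht => ?_)
    beta_reduce
    rw [extendZero_of_mem _ ht]
    let M' : Matrix (Fin (q + 1)) (Fin (q + 1)) ℂ := Matrix.of fun a c =>
      dlog (discrFn z (s c)) (blowDown I b (z j) (x.1, t))
        ((Fin.cons (fderiv ℂ (blowDown I b (z j)) (x.1, t) (0, 1))
          fun a => fderiv ℂ (blowDown I b (z j)) (x.1, t) (v a, 0) :
            Fin (q + 1) → Fin k → ℂ) a)
    change (M t).det = t * M'.det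
    rw [Matrix.det_succ_row_zero, Matrix.det_succ_row_zero, Finset.mul_sum]
    refine Finset.sum_congr rfl fun c _ => ?_
    have h0 : M t 0 c = t * M' 0 c := rfl
    have h1 : (M t).submatrix Fin.succ c.succAbove = M'.submatrix Fin.succ c.succAbove := rfl
    rw [h0, h1]
    ring

theorem cons_add_smul {E : Type} [AddCommGroup E] [Module ℂ E] {q : ℕ}
    (f : E [⋀^Fin (q + 1)]→ₗ[ℂ] ℂ) (w : E) (v : Fin q → E) (a : Fin q → ℂ) :
    f (Fin.cons w fun i => v i + a i • w) = f (Fin.cons w v) := by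
  have hg : ∀ u : Fin q → E, ∀ i, u i = a i • w → f.curryLeft w u = 0 := by
    intro u i hu
    rw [← Function.update_eq_self i u, hu, AlternatingMap.map_update_smul]
    refine smul_eq_zero_of_right _ ?_
    exact f.map_eq_zero_of_eq (i := 0) (j := i.succ) _ (by simp)
      (Fin.succ_ne_zero i).symm
  have := (f.curryLeft w).map_add_univ v (fun i => a i • w)
  rw [Finset.sum_eq_single Finset.univ] at this
  · rw [Finset.piecewise_univ] at this
    exact this
  · intro S _ hS
    obtain ⟨i, hi⟩ : ∃ i, i ∉ S := by
      by_contra! h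
      exact hS (Finset.eq_univ_iff_forall.2 h)
    exact hg _ i (Finset.piecewise_eq_of_notMem _ _ _ hi)
  · intro h; exact absurd (Finset.mem_univ _) h

/-- The residues of a skew-symmetric form are skew-symmetric. -/
theorem residue_skew {k n q r : ℕ} (z : Fin n ↪ ℂ) (j : Fin n) (σ : Equiv.Perm (Fin k))
    {ε : ℂ} {η : Form (discrU k z) (q + 1)} (hη : permForm z σ η = ε • η)
    {ρ : EdgeForm k z r q} (hρ : ∀ I : Edge k r, HasResidue z I.1 I.base (z j) η (ρ I)) :
    permEdgeForm z σ ρ = ε • ρ := by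
  funext I
  have hb' : σ (I.perm σ⁻¹).base ∈ I.1 := (I.mem_perm_inv σ _).1 (I.perm σ⁻¹).base_mem
  refine HasResidue.unique (η := ε • η) (c := z j) (fun x v => ?_) ((hρ I).smul ε)
  have hx0 : hom I.base x.1 (σ (I.perm σ⁻¹).base) ≠ 0 :=
    ((mem_stratum_iff z I.base_mem _).1 x.2).1 _ hb'
  set I' := I.perm σ⁻¹ with hI'
  set κ := hom I.base x.1 (σ I'.base) with hκ
  set φ := chartMap σ I.1 I.base I'.base with hφ
  have hm : ∀ i, i ∈ I'.1 ↔ σ i ∈ I.1 := I.mem_perm_inv σ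
  have hlim := hρ I' ⟨φ x.1, chartMap_mem z σ I x.2⟩ (fun a => fderiv ℂ φ x.1 (v a))
  have hs : Tendsto (fun s : ℂ => s * κ) (𝓝[≠] 0) (𝓝[≠] 0) := by
    refine tendsto_nhdsWithin_iff.2 ⟨?_, ?_⟩
    · have : ContinuousAt (fun s : ℂ => s * κ) 0 := by fun_prop
      simpa using this.tendsto.mono_left (nhdsWithin_le_nhds (s := {(0 : ℂ)}ᶜ))
    · filter_upwards [self_mem_nhdsWithin] with s hs
      exact mul_ne_zero hs hx0
  refine (hlim.comp hs).congr' ((eventually_mem_discrU z I.base_mem j x.2).mono fun s ht => ?_)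
  have hpt : blowDown I'.1 I'.base (z j) (φ x.1, s * κ) =
      blowDown I.1 I.base (z j) (x.1, s) ∘ σ := by
    funext i
    simp only [blowDown, Function.comp, hm, hφ, hom_chartMap σ hb' x.1 hx0]
    split_ifs
    · rw [← hκ]; field_simp
    · rfl
  have ht' := comp_mem_discrU z σ ht
  rw [Function.comp_apply]
  beta_reduce
  rw [extendZero_of_mem _ ht, ← hη, hpt, extendZero_of_mem _ ht']
  simp only [permForm, LinearMap.coe_mk, AddHom.coe_mk, AlternatingMap.compLinearMap_apply]
  set w := fderiv ℂ (blowDown I'.1 I'.base (z j)) (φ x.1, s * κ) (0, 1) with hw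
  have h1 : LinearMap.funLeft ℂ ℂ σ (fderiv ℂ (blowDown I.1 I.base (z j)) (x.1, s) (0, 1)) =
      κ • w := by
    funext i
    simp only [hw, LinearMap.funLeft_apply, Pi.smul_apply, fderiv_blowDown, hm, hφ,
      hom_chartMap σ hb' x.1 hx0, map_zero, smul_eq_mul]
    split_ifs
    · rw [← hκ]; field_simp; ring
    · simp
  have h2 : ∀ a, LinearMap.funLeft ℂ ℂ σ
      (fderiv ℂ (blowDown I.1 I.base (z j)) (x.1, s) (v a, 0)) =
      fderiv ℂ (blowDown I'.1 I'.base (z j)) (φ x.1, s * κ) (fderiv ℂ φ x.1 (v a), 0) +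
        (s * homD I.base (σ I'.base) (v a)) • w := by
    intro a
    funext i
    simp only [hw, LinearMap.funLeft_apply, Pi.smul_apply, Pi.add_apply, fderiv_blowDown, hm, hφ,
      hom_chartMap σ hb' x.1 hx0, fderiv_chartMap σ hb' x.1 _ hx0, map_zero, smul_eq_mul]
    split_ifs
    · rw [← hκ]; field_simp; ring
    · simp
  have h3 : (fun a => LinearMap.funLeft ℂ ℂ σ ((Fin.cons
      (fderiv ℂ (blowDown I.1 I.base (z j)) (x.1, s) (0, 1)) fun a =>
        fderiv ℂ (blowDown I.1 I.base (z j)) (x.1, s) (v a, 0) : Fin (q + 1) → Fin k → ℂ) a)) =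
      (Fin.cons (κ • w) fun a => fderiv ℂ (blowDown I'.1 I'.base (z j)) (φ x.1, s * κ)
        (fderiv ℂ φ x.1 (v a), 0) + (s * homD I.base (σ I'.base) (v a)) • w) := by
    funext a
    refine Fin.cases ?_ (fun a => ?_) a
    · exact h1
    · exact h2 a
  have h4 : ∀ (f : (Fin k → ℂ) [⋀^Fin (q + 1)]→ₗ[ℂ] ℂ) (u : Fin q → Fin k → ℂ),
      f (Fin.cons (κ • w) u) = κ * f (Fin.cons w u) := fun f u =>
    congrArg (fun g => g u) (f.curryLeft.map_smul κ w)
  have h5 : ∀ (f : (Fin k → ℂ) [⋀^Fin (q + 1)]→ₗ[ℂ] ℂ) (u : Fin q → Fin k → ℂ) (a : Fin q → ℂ),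
      f (Fin.cons (κ • w) fun i => u i + a i • w) = κ * f (Fin.cons w u) := fun f u a => by
    rw [h4, cons_add_smul]
  change _ = s * (η ⟨_, ht'⟩) (fun a => LinearMap.funLeft ℂ ℂ σ ((Fin.cons
      (fderiv ℂ (blowDown I.1 I.base (z j)) (x.1, s) (0, 1)) fun a =>
        fderiv ℂ (blowDown I.1 I.base (z j)) (x.1, s) (v a, 0) : Fin (q + 1) → Fin k → ℂ) a))
  rw [h3, h5, mul_assoc]

theorem exists_residue_family {k n q : ℕ} (z : Fin n ↪ ℂ) (r : ℕ) (j : Fin n)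
    (η : skewOS k z (q + 1)) :
    ∃ ρ : skewEdgeOS k z r q,
      ∀ I : Edge k r, HasResidue z I.1 I.base (z j) η.1 (ρ.1 I) := by
  choose ρ h₁ h₂ using fun I : Edge k r => exists_residue z I.base_mem j η.2.1
  exact ⟨⟨ρ, h₁, fun σ => residue_skew z j σ (η.2.2 σ) h₂⟩, h₂⟩

/-- The residue map `A^{q+1}_-(U) → A^q_-(⋃_{|I| = r + 1} C_I)` along the exceptional divisors
over the edges `t_i = z_j`, `i ∈ I`. -/
def residueAt {n : ℕ} (k : ℕ) (z : Fin n ↪ ℂ) (r : ℕ) (j : Fin n) (q : ℕ) :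
    skewOS k z (q + 1) →ₗ[ℂ] skewEdgeOS k z r q where
  toFun η := (exists_residue_family z r j η).choose
  map_add' η η' := Subtype.ext <| funext fun I =>
    ((exists_residue_family z r j (η + η')).choose_spec I).unique
      (((exists_residue_family z r j η).choose_spec I).add
        ((exists_residue_family z r j η').choose_spec I))
  map_smul' c η := Subtype.ext <| funext fun I =>
    ((exists_residue_family z r j (c • η)).choose_spec I).unique
      (((exists_residue_family z r j η).choose_spec I).smul c)

theorem residueAt_spec {k n : ℕ} (z : Fin n ↪ ℂ) (r : ℕ) (j : Fin n) (q : ℕ)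
    (η : skewOS k z (q + 1)) (I : Edge k r) :
    HasResidue z I.1 I.base (z j) η.1 ((residueAt k z r j q η).1 I) :=
  (exists_residue_family z r j η).choose_spec I

/-- The residue map `A^{q+1}_-(U) → ⊕_{j ≤ n₀} A^q_-(⋃_{|I| = m_j + 1} C^j_I)`. -/
def residueMap {n : ℕ} (k : ℕ) (z : Fin n ↪ ℂ) (m : Fin n → ℕ) (n₀ q : ℕ) :
    skewOS k z (q + 1) →ₗ[ℂ] ∀ j : {j : Fin n // (j : ℕ) < n₀}, skewEdgeOS k z (m j) q :=
  LinearMap.pi fun j => residueAt k z (m j) j q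

end Discr

end

noncomputable section

namespace Discr

/-! ### Wedge products -/

/-! A form on `U` is determined by its coefficients at tuples of coordinate vectors `e_{v 0}, …,
e_{v (p-1)}` with `v` injective, and a skew-symmetric form by any single one of them (`skewOS_ext`).
The proof determines which rational functions `F` occur as such coefficients and reads off the
residues from them.

The Arnold relations write the coefficient of any Orlik-Solomon form as a combination of forest
products `∏ 1/(t_{v a} - y_a)`, where the vertex `y_a` is a `z_i`, an unused coordinate, or some
`t_{v a'}` with `a' > a` (`coeffFn_edgeForm_mem`). For a skew-symmetric form, `F` is symmetric in
the `t_{v a}`, because the sign of the action and the sign from reordering the arguments cancel.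
Symmetrization collapses forests: by Lagrange interpolation the sum of a star over all choices of
its centre is a product of fractions that all end at one outside vertex (`edgeInv_mul_pure_mem`). So
`F` is a combination of products whose `y_a` lie outside the image of `v`.

Poles along `t_i = t_l` with `l` unused do not occur either. The form `d log (t_i - t_l)` vanishes
on `e_i + e_l`, so `F` plus the coefficient with `e_i` replaced by `e_l` is regular there; by
skew-symmetry both summands have the same residue, which is therefore zero (`outer_coeff_eq_zero`).
Hence `F = ∑ c y ∏ 1/(t_{v a} - z_{y a})` (`exists_point_coeff`).

If two indices are unused, exchanging them fixes `F` and also changes its sign, so `A^p_-(U) = 0`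
for `p ≤ k - 2`. For `p = k - 1` and `p = k` the space is spanned by the `ω_K`, and `β^K_m ≠ 0`
exactly when `K ≤ m`. It remains to see that vanishing residues mean that no label `j` is used more
than `m_j` times. At the stratum `C^j_I` a fraction with index in `I` contributes to the limit only
if its label is `j`, so the surviving terms are those with label `j` on all of `I`, up to pairs that
cancel by skew-symmetry (`hasResidue_zero_of_coeff`). Conversely, independence of products of simple
fractions recovers each such `c y` from a residue (`coeff_eq_zero_of_hasResidue`). For `j > n₀` one
has `m_j ≥ k`, and there is nothing to check. -/

theorem map_mem_of_mem_span {E F : Type*} [AddCommGroup E] [Module ℂ E] [AddCommGroup F]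
    [Module ℂ F] (f : E →ₗ[ℂ] F) {S : Set E} {T : Submodule ℂ F} (h : ∀ x ∈ S, f x ∈ T) {x : E}
    (hx : x ∈ Submodule.span ℂ S) : f x ∈ T :=
  (Submodule.span_le.2 h : Submodule.span ℂ S ≤ T.comap f) hx

theorem wedge_apply {ι : Type} {q : ℕ} (φ : Fin q → ((ι → ℂ) →ₗ[ℂ] ℂ)) (v : Fin q → ι → ℂ) :
    wedge φ v = (Matrix.of fun a b => φ b (v a)).det := rfl

/-- The value of a wedge product at fixed vectors, as an alternating map of the covectors. -/
def wedgeEval {ι : Type} {q : ℕ} (v : Fin q → ι → ℂ) :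
    ((ι → ℂ) →ₗ[ℂ] ℂ) [⋀^Fin q]→ₗ[ℂ] ℂ :=
  (Matrix.detRowAlternating (n := Fin q) (R := ℂ)).compLinearMap
    (LinearMap.pi fun a => LinearMap.applyₗ (v a))

theorem wedgeEval_apply {ι : Type} {q : ℕ} (φ : Fin q → ((ι → ℂ) →ₗ[ℂ] ℂ)) (v : Fin q → ι → ℂ) :
    wedgeEval v φ = wedge φ v := by
  rw [wedge_apply, ← Matrix.det_transpose]
  rfl

/-- The exterior product of a covector with an alternating form. -/
def covectorWedge {E : Type} [AddCommGroup E] [Module ℂ E] (q : ℕ) (θ : E →ₗ[ℂ] ℂ) :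
    (E [⋀^Fin q]→ₗ[ℂ] ℂ) →ₗ[ℂ] (E [⋀^Fin (q + 1)]→ₗ[ℂ] ℂ) where
  toFun ω := AlternatingMap.alternatizeUncurryFin (θ.smulRight ω)
  map_add' ω ω' := by
    ext v
    simp [AlternatingMap.alternatizeUncurryFin_apply, Finset.sum_add_distrib]
  map_smul' c ω := by
    ext v
    simp only [AlternatingMap.alternatizeUncurryFin_apply, LinearMap.smulRight_apply,
      AlternatingMap.smul_apply, smul_eq_mul, RingHom.id_apply, Finset.mul_sum, zsmul_eq_mul]
    exact Finset.sum_congr rfl fun i _ => by ring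

/-- Laplace expansion of the determinant along the column of `θ`. -/
theorem covectorWedge_wedge {ι : Type} {q : ℕ} (θ : (ι → ℂ) →ₗ[ℂ] ℂ)
    (φ : Fin q → ((ι → ℂ) →ₗ[ℂ] ℂ)) :
    covectorWedge q θ (wedge φ) = wedge (Fin.cons θ φ : Fin (q + 1) → _) := by
  ext v
  rw [wedge_apply, Matrix.det_succ_column_zero]
  simp only [covectorWedge, LinearMap.coe_mk, AddHom.coe_mk,
    AlternatingMap.alternatizeUncurryFin_apply, LinearMap.smulRight_apply,
    AlternatingMap.smul_apply, smul_eq_mul, zsmul_eq_mul]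
  refine Finset.sum_congr rfl fun i _ => ?_
  rw [mul_assoc]
  push_cast
  rfl

theorem wedge_cons_self {ι : Type} {q : ℕ} (θ : (ι → ℂ) →ₗ[ℂ] ℂ)
    (φ : Fin q → ((ι → ℂ) →ₗ[ℂ] ℂ)) :
    wedge (Fin.cons θ (Fin.cons θ φ : Fin (q + 1) → _) : Fin (q + 2) → _) = 0 := by
  ext v
  rw [← wedgeEval_apply]
  exact (wedgeEval v).map_eq_zero_of_eq (i := 0) (j := 1) _ rfl (by simp)

theorem wedge_cons_add {ι : Type} {q : ℕ} (θ θ' : (ι → ℂ) →ₗ[ℂ] ℂ)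
    (φ : Fin q → ((ι → ℂ) →ₗ[ℂ] ℂ)) :
    wedge (Fin.cons (θ + θ') φ : Fin (q + 1) → _) =
      wedge (Fin.cons θ φ : Fin (q + 1) → _) + wedge (Fin.cons θ' φ : Fin (q + 1) → _) := by
  ext v
  simp only [AlternatingMap.add_apply, ← wedgeEval_apply]
  exact congrArg (fun g => g φ) ((wedgeEval v).curryLeft.map_add θ θ')

theorem wedge_cons_smul {ι : Type} {q : ℕ} (c : ℂ) (θ : (ι → ℂ) →ₗ[ℂ] ℂ)
    (φ : Fin q → ((ι → ℂ) →ₗ[ℂ] ℂ)) :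
    wedge (Fin.cons (c • θ) φ : Fin (q + 1) → _) = c • wedge (Fin.cons θ φ : Fin (q + 1) → _) := by
  ext v
  simp only [AlternatingMap.smul_apply, ← wedgeEval_apply]
  exact congrArg (fun g => g φ) ((wedgeEval v).curryLeft.map_smul c θ)

/-- The wedge product as an alternating bilinear form in its first two factors. -/
def wedgeTwo {ι : Type} {q : ℕ} (φ : Fin q → ((ι → ℂ) →ₗ[ℂ] ℂ)) :
    ((ι → ℂ) →ₗ[ℂ] ℂ) →ₗ[ℂ] ((ι → ℂ) →ₗ[ℂ] ℂ) →ₗ[ℂ] ((ι → ℂ) [⋀^Fin (q + 2)]→ₗ[ℂ] ℂ) :=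
  LinearMap.mk₂ ℂ (fun θ θ' =>
      wedge (Fin.cons θ (Fin.cons θ' φ : Fin (q + 1) → _) : Fin (q + 2) → _))
    (fun θ₁ θ₂ θ' => wedge_cons_add _ _ _) (fun c θ θ' => wedge_cons_smul _ _ _)
    (fun θ θ₁ θ₂ => by
      simp only [← covectorWedge_wedge _ (Fin.cons _ _ : Fin (q + 1) → _), wedge_cons_add, map_add])
    (fun c θ θ' => by
      simp only [← covectorWedge_wedge _ (Fin.cons _ _ : Fin (q + 1) → _), wedge_cons_smul,
        map_smul])

theorem wedgeTwo_self {ι : Type} {q : ℕ} (φ : Fin q → ((ι → ℂ) →ₗ[ℂ] ℂ))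
    (θ : (ι → ℂ) →ₗ[ℂ] ℂ) : wedgeTwo φ θ θ = 0 := wedge_cons_self θ φ

theorem wedgeTwo_swap {ι : Type} {q : ℕ} (φ : Fin q → ((ι → ℂ) →ₗ[ℂ] ℂ))
    (θ θ' : (ι → ℂ) →ₗ[ℂ] ℂ) : wedgeTwo φ θ θ' = -wedgeTwo φ θ' θ := by
  have := wedgeTwo_self φ (θ + θ')
  simp only [map_add, LinearMap.add_apply, wedgeTwo_self, zero_add, add_zero] at this
  exact eq_neg_of_add_eq_zero_right this

/-- The Arnold relation with denominators cleared: for `u = d log f`, `v = d log g`, `w = d log h`,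
wedging `f u - g v = h w` with `v` and with `u` gives `h w ∧ v = f u ∧ v` and `h w ∧ u = g u ∧ v`;
these are subtracted. -/
theorem wedgeTwo_linear_relation {ι : Type} {q : ℕ} (φ : Fin q → ((ι → ℂ) →ₗ[ℂ] ℂ))
    {u v w : (ι → ℂ) →ₗ[ℂ] ℂ} {f g h : ℂ} (hne : h ≠ 0) (hfg : f - g = h)
    (hw : f • u - g • v = h • w) :
    wedgeTwo φ u v = wedgeTwo φ w v - wedgeTwo φ w u := by
  have h1 : h • wedgeTwo φ w v = f • wedgeTwo φ u v := by
    rw [← LinearMap.smul_apply, ← map_smul, ← hw]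
    simp [wedgeTwo_self]
  have h2 : h • wedgeTwo φ w u = g • wedgeTwo φ u v := by
    rw [← LinearMap.smul_apply, ← map_smul, ← hw, wedgeTwo_swap φ u v]
    simp [wedgeTwo_self]
  have h3 : h • wedgeTwo φ u v = h • (wedgeTwo φ w v - wedgeTwo φ w u) := by
    rw [smul_sub, h1, h2, ← sub_smul, hfg]
  exact smul_right_injective _ hne h3

/-! ### Logarithmic forms of pairs of vertices -/

/-- The value at `t` of a vertex: a coordinate of `t`, or one of the points `z a`. -/
def vval {k n : ℕ} (z : Fin n ↪ ℂ) (t : Fin k → ℂ) : Fin k ⊕ Fin n → ℂ := Sum.elim t z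

/-- The differential of a vertex. -/
def vdiff (k n : ℕ) : Fin k ⊕ Fin n → ((Fin k → ℂ) →ₗ[ℂ] ℂ) := Sum.elim LinearMap.proj 0

/-- The covector `d log (u - w)` at `t` for two vertices `u` and `w`. -/
def edgeLog {k n : ℕ} (z : Fin n ↪ ℂ) (e : (Fin k ⊕ Fin n) × (Fin k ⊕ Fin n)) (t : Fin k → ℂ) :
    (Fin k → ℂ) →ₗ[ℂ] ℂ :=
  (vval z t e.1 - vval z t e.2)⁻¹ • (vdiff k n e.1 - vdiff k n e.2)

/-- The end points of the edge that belongs to a hyperplane. -/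
def DiscrHyp.edge {k n : ℕ} : DiscrHyp k n → (Fin k ⊕ Fin n) × (Fin k ⊕ Fin n)
  | .diag i l _ => (.inl i, .inl l)
  | .pt i a => (.inl i, .inr a)

theorem discrFn_eq_vval {k n : ℕ} (z : Fin n ↪ ℂ) (h : DiscrHyp k n) (t : Fin k → ℂ) :
    discrFn z h t = vval z t h.edge.1 - vval z t h.edge.2 := by
  cases h <;> simp [discrFn, DiscrHyp.edge, vval, coordFn, constFn]

theorem dlog_discrFn {k n : ℕ} (z : Fin n ↪ ℂ) (h : DiscrHyp k n) (t : Fin k → ℂ) :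
    dlog (discrFn z h) t = edgeLog z h.edge t := by
  rw [dlog, discrFn_eq_vval, edgeLog]
  congr 1
  cases h <;> ext <;> simp [discrFn, DiscrHyp.edge, vdiff, coordFn, constFn]

theorem vval_injective {k n : ℕ} {z : Fin n ↪ ℂ} {t : Fin k → ℂ} (ht : t ∈ discrU k z) :
    Function.Injective (vval z t) := by
  rw [mem_discrU_iff] at ht
  rintro (i | a) (l | b) h
  · by_contra hne
    exact ht.1 i l (fun e => hne (e ▸ rfl)) h
  · exact absurd h (ht.2 i b)
  · exact absurd h.symm (ht.2 l a)
  · exact congrArg _ (z.injective h)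

theorem edgeLog_swap {k n : ℕ} (z : Fin n ↪ ℂ) (u w : Fin k ⊕ Fin n) (t : Fin k → ℂ) :
    edgeLog z (u, w) t = edgeLog z (w, u) t := by
  simp only [edgeLog]
  rw [← neg_sub (vval z t w), ← neg_sub (vdiff k n w), inv_neg, smul_neg, neg_smul, neg_neg]

theorem edgeLog_self {k n : ℕ} (z : Fin n ↪ ℂ) (u : Fin k ⊕ Fin n) (t : Fin k → ℂ) :
    edgeLog z (u, u) t = 0 := by
  simp [edgeLog]

/-- The Arnold relation of the triangle `x`, `y`, `y'`, arranged so that each product on the right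
contains `x` in only one factor. -/
theorem wedgeTwo_edgeLog {k n q : ℕ} {z : Fin n ↪ ℂ} {t : Fin k → ℂ} (ht : t ∈ discrU k z)
    (φ : Fin q → ((Fin k → ℂ) →ₗ[ℂ] ℂ)) (x y y' : Fin k ⊕ Fin n) (hy : y ≠ x) (hy' : y' ≠ x) :
    wedgeTwo φ (edgeLog z (x, y') t) (edgeLog z (x, y) t) =
      wedgeTwo φ (edgeLog z (x, y') t) (edgeLog z (y', y) t) -
        wedgeTwo φ (edgeLog z (x, y) t) (edgeLog z (y', y) t) := by
  by_cases hyy : y' = y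
  · subst hyy
    simp [wedgeTwo_self]
  have hi := vval_injective ht
  have h0 : ∀ {u w}, u ≠ w → vval z t u - vval z t w ≠ 0 := fun h => sub_ne_zero.2 (hi.ne h)
  have := wedgeTwo_linear_relation φ (u := edgeLog z (x, y') t) (v := edgeLog z (x, y) t)
    (w := edgeLog z (y, y') t) (f := vval z t x - vval z t y') (g := vval z t x - vval z t y)
    (h := vval z t y - vval z t y') (h0 (Ne.symm hyy)) (by ring) (by
      simp only [edgeLog]
      rw [smul_inv_smul₀ (h0 hy'.symm), smul_inv_smul₀ (h0 hy.symm), smul_inv_smul₀ (h0 (Ne.symm hyy))]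
      abel)
  rw [this, edgeLog_swap z y y', wedgeTwo_swap φ (edgeLog z (y', y) t) (edgeLog z (x, y) t),
    wedgeTwo_swap φ (edgeLog z (y', y) t) (edgeLog z (x, y') t)]
  abel

/-- The form `d log e_0 ∧ ⋯ ∧ d log e_{q-1}` of a sequence of pairs of vertices. -/
def edgeForm {k n : ℕ} (z : Fin n ↪ ℂ) {q : ℕ} (s : Fin q → (Fin k ⊕ Fin n) × (Fin k ⊕ Fin n)) :
    Form (discrU k z) q :=
  fun t => wedge fun a => edgeLog z (s a) t

theorem logForm_discrFn {k n q : ℕ} (z : Fin n ↪ ℂ) (s : Fin q → DiscrHyp k n) :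
    logForm (discrFn z) s = edgeForm z fun a => (s a).edge := by
  funext t
  simp only [logForm, edgeForm, dlog_discrFn]

theorem edgeForm_cons {k n q : ℕ} (z : Fin n ↪ ℂ) (e : (Fin k ⊕ Fin n) × (Fin k ⊕ Fin n))
    (s : Fin q → (Fin k ⊕ Fin n) × (Fin k ⊕ Fin n)) (t : discrU k z) :
    edgeForm z (Fin.cons e s : Fin (q + 1) → _) t =
      wedge (Fin.cons (edgeLog z e t) fun a => edgeLog z (s a) t : Fin (q + 1) → _) := by
  unfold edgeForm
  congr 1
  funext a
  refine Fin.cases ?_ (fun a => ?_) a <;> simp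

theorem edgeForm_cons_cons {k n q : ℕ} (z : Fin n ↪ ℂ)
    (e e' : (Fin k ⊕ Fin n) × (Fin k ⊕ Fin n))
    (s : Fin q → (Fin k ⊕ Fin n) × (Fin k ⊕ Fin n)) (t : discrU k z) :
    edgeForm z (Fin.cons e (Fin.cons e' s : Fin (q + 1) → _) : Fin (q + 2) → _) t =
      wedgeTwo (fun a => edgeLog z (s a) t) (edgeLog z e t) (edgeLog z e' t) := by
  rw [edgeForm_cons]
  change wedge _ = wedge _
  congr 2
  funext a
  refine Fin.cases ?_ (fun a => ?_) a <;> simp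

/-- Exterior multiplication by `d log e`. -/
def edgeWedge {k n : ℕ} (z : Fin n ↪ ℂ) (q : ℕ) (e : (Fin k ⊕ Fin n) × (Fin k ⊕ Fin n)) :
    Form (discrU k z) q →ₗ[ℂ] Form (discrU k z) (q + 1) :=
  LinearMap.pi fun t => (covectorWedge q (edgeLog z e t)).comp (LinearMap.proj t)

theorem edgeWedge_edgeForm {k n q : ℕ} (z : Fin n ↪ ℂ)
    (e : (Fin k ⊕ Fin n) × (Fin k ⊕ Fin n))
    (s : Fin q → (Fin k ⊕ Fin n) × (Fin k ⊕ Fin n)) :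
    edgeWedge z q e (edgeForm z s) = edgeForm z (Fin.cons e s : Fin (q + 1) → _) := by
  funext t
  rw [edgeForm_cons, ← covectorWedge_wedge]
  rfl

/-- The sequences of pairs of vertices outside of `X` in which the vertex `x` occurs at most
once, namely as the first end point of the first pair. -/
def IsReduced {k n q : ℕ} (X : Set (Fin k ⊕ Fin n)) (x : Fin k ⊕ Fin n)
    (s : Fin q → (Fin k ⊕ Fin n) × (Fin k ⊕ Fin n)) : Prop :=
  ∀ a, ((s a).1 ∉ X ∧ (s a).2 ∉ X) ∧ (s a).2 ≠ x ∧ ((a : ℕ) ≠ 0 → (s a).1 ≠ x)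

/-- Induction on the number of factors. If the tail is reduced, `x` occurs in it at most in its
first factor. When the head contains `x` too, the Arnold relation removes `x` from one of the two
factors; when it does not, the two factors are exchanged. The set `X` stays excluded throughout, so
that vertices can be eliminated one after another. -/
theorem edgeForm_mem_span_isReduced {k n : ℕ} (z : Fin n ↪ ℂ) (X : Set (Fin k ⊕ Fin n))
    (x : Fin k ⊕ Fin n) (q : ℕ) (s : Fin q → (Fin k ⊕ Fin n) × (Fin k ⊕ Fin n))
    (hs : ∀ a, (s a).1 ∉ X ∧ (s a).2 ∉ X) :
    edgeForm z s ∈ Submodule.span ℂ (edgeForm z '' {s : Fin q → _ | IsReduced X x s}) := by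
  induction q with
  | zero => exact Submodule.subset_span ⟨s, fun a => a.elim0, rfl⟩
  | succ q ih =>
    obtain ⟨e, s, rfl⟩ : ∃ e s', s = Fin.cons e s' := ⟨s 0, Fin.tail s, (Fin.cons_self_tail s).symm⟩
    have he := hs 0
    simp only [Fin.cons_zero] at he
    have hs' : ∀ a, (s a).1 ∉ X ∧ (s a).2 ∉ X := fun a => by simpa using hs a.succ
    rw [← edgeWedge_edgeForm]
    have h1 := ih s hs'
    refine map_mem_of_mem_span (edgeWedge z q e) ?_ h1
    clear h1 ih hs hs' s
    rintro _ ⟨s, hs, rfl⟩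
    rw [edgeWedge_edgeForm]
    have hmem : ∀ s : Fin (q + 1) → (Fin k ⊕ Fin n) × (Fin k ⊕ Fin n), IsReduced X x s →
        edgeForm z s ∈ Submodule.span ℂ (edgeForm z '' {s : Fin (q + 1) → _ | IsReduced X x s}) :=
      fun s hs => Submodule.subset_span ⟨s, hs, rfl⟩
    -- It suffices to treat heads whose second end point is not `x`, since `d log (u - w)` is
    -- symmetric in `u` and `w`.
    have key : ∀ e : (Fin k ⊕ Fin n) × (Fin k ⊕ Fin n), e.1 ∉ X → e.2 ∉ X → e.2 ≠ x →
        edgeForm z (Fin.cons e s : Fin (q + 1) → _) ∈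
          Submodule.span ℂ (edgeForm z '' {s : Fin (q + 1) → _ | IsReduced X x s}) := by
      intro e he1 he2 hex
      by_cases hall : ∀ a, (s a).1 ≠ x
      · refine hmem _ fun a => ?_
        refine Fin.cases ?_ (fun a => ?_) a
        · simpa using ⟨⟨he1, he2⟩, hex⟩
        · simpa using ⟨(hs a).1, (hs a).2.1, hall a⟩
      · push Not at hall
        obtain ⟨a, ha⟩ := hall
        obtain ⟨q, rfl⟩ : ∃ q', q = q' + 1 := ⟨q - 1, by have := a.2; omega⟩
        have ha0 : a = 0 := by
          by_contra h
          exact (hs a).2.2 (fun h' => h (Fin.ext h')) ha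
        subst ha0
        obtain ⟨⟨x', y⟩, s, rfl⟩ : ∃ e s', s = Fin.cons e s' :=
          ⟨s 0, Fin.tail s, (Fin.cons_self_tail s).symm⟩
        simp only [Fin.cons_zero] at ha
        subst ha
        have hy := hs 0
        simp only [Fin.cons_zero] at hy
        have hst : ∀ a, ((s a).1 ∉ X ∧ (s a).2 ∉ X) ∧ (s a).2 ≠ x' ∧ (s a).1 ≠ x' := fun a => by
          simpa using hs a.succ
        have hred : ∀ w e' : (Fin k ⊕ Fin n) × (Fin k ⊕ Fin n), (w.1 ∉ X ∧ w.2 ∉ X) → w.2 ≠ x' →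
            (e'.1 ∉ X ∧ e'.2 ∉ X) → e'.2 ≠ x' → e'.1 ≠ x' →
            IsReduced X x' (Fin.cons w (Fin.cons e' s : Fin (q + 1) → _) : Fin (q + 2) → _) := by
          intro w e' h1 h2 h3 h4 h5 a
          refine Fin.cases ?_ (fun a => ?_) a
          · simpa using ⟨h1, h2⟩
          · refine Fin.cases ?_ (fun a => ?_) a
            · simpa using ⟨h3, h4, h5⟩
            · simpa using hst a
        by_cases he1x : e.1 = x'
        · obtain ⟨e1, y'⟩ := e
          simp only at he1x
          subst he1x
          have : edgeForm z (Fin.cons (e1, y') (Fin.cons (e1, y) s : Fin (q + 1) → _) :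
              Fin (q + 2) → _) =
              edgeForm z (Fin.cons (e1, y') (Fin.cons (y', y) s : Fin (q + 1) → _) :
                Fin (q + 2) → _) -
              edgeForm z (Fin.cons (e1, y) (Fin.cons (y', y) s : Fin (q + 1) → _) :
                Fin (q + 2) → _) := by
            funext t
            simp only [Pi.sub_apply, edgeForm_cons_cons]
            exact wedgeTwo_edgeLog t.2 _ _ _ _ hy.2.1 hex
          rw [this]
          exact sub_mem (hmem _ (hred _ _ ⟨hy.1.1, he2⟩ hex ⟨he2, hy.1.2⟩ hy.2.1 hex))
            (hmem _ (hred _ _ hy.1 hy.2.1 ⟨he2, hy.1.2⟩ hy.2.1 hex))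
        · have : edgeForm z (Fin.cons e (Fin.cons (x', y) s : Fin (q + 1) → _) :
              Fin (q + 2) → _) =
              -edgeForm z (Fin.cons (x', y) (Fin.cons e s : Fin (q + 1) → _) :
                Fin (q + 2) → _) := by
            funext t
            simp only [Pi.neg_apply, edgeForm_cons_cons]
            exact wedgeTwo_swap _ _ _
          rw [this]
          exact neg_mem (hmem _ (hred _ _ hy.1 hy.2.1 ⟨he1, he2⟩ hex he1x))
    by_cases hex : e.2 = x
    · by_cases hex1 : e.1 = x
      -- A degenerate pair gives the zero covector, because `vdiff` cancels whatever the value of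
      -- `0⁻¹`.
      · have : edgeForm z (Fin.cons e s : Fin (q + 1) → _) = 0 := by
          funext t
          obtain ⟨e1, e2⟩ := e
          simp only at hex hex1
          subst hex hex1
          rw [edgeForm_cons, edgeLog_self, ← covectorWedge_wedge]
          ext v
          simp [covectorWedge, AlternatingMap.alternatizeUncurryFin_apply]
        rw [this]
        exact zero_mem _
      · have : edgeForm z (Fin.cons e s : Fin (q + 1) → _) =
            edgeForm z (Fin.cons (e.2, e.1) s : Fin (q + 1) → _) := by
          funext t
          rw [edgeForm_cons, edgeForm_cons, edgeLog_swap]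
        rw [this]
        exact key _ he.2 he.1 hex1
    · exact key _ he.1 he.2 hex

/-! ### Coefficients of logarithmic forms -/

/-- The function `1 / (t_i - v)` for a vertex `v`. -/
def edgeInv {k n : ℕ} (z : Fin n ↪ ℂ) (i : Fin k) (v : Fin k ⊕ Fin n) (t : discrU k z) : ℂ :=
  (t.1 i - vval z t v)⁻¹

/-- The coefficient of a form at the coordinate vectors with indices `v 0, …, v (p - 1)`. -/
def coeffFn {k n p : ℕ} (z : Fin n ↪ ℂ) (v : Fin p → Fin k) :
    Form (discrU k z) p →ₗ[ℂ] (discrU k z → ℂ) where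
  toFun η t := η t fun a => Pi.single (v a) 1
  map_add' _ _ := rfl
  map_smul' _ _ := rfl

theorem coeffFn_apply {k n p : ℕ} (z : Fin n ↪ ℂ) (v : Fin p → Fin k) (η : Form (discrU k z) p)
    (t : discrU k z) : coeffFn z v η t = η t fun a => Pi.single (v a) 1 := rfl

theorem edgeLog_single_of_ne {k n : ℕ} (z : Fin n ↪ ℂ) {i : Fin k}
    {e : (Fin k ⊕ Fin n) × (Fin k ⊕ Fin n)} (h1 : e.1 ≠ .inl i) (h2 : e.2 ≠ .inl i)
    (t : Fin k → ℂ) : edgeLog z e t (Pi.single i 1) = 0 := by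
  have : ∀ u : Fin k ⊕ Fin n, u ≠ .inl i → vdiff k n u (Pi.single i 1) = 0 := by
    rintro (l | a) h
    · have : l ≠ i := fun e => h (e ▸ rfl)
      simp [vdiff, this]
    · simp [vdiff]
  simp [edgeLog, this _ h1, this _ h2]

theorem edgeLog_single_left {k n : ℕ} (z : Fin n ↪ ℂ) {i : Fin k} {w : Fin k ⊕ Fin n}
    (h : w ≠ .inl i) (t : discrU k z) :
    edgeLog z (.inl i, w) t (Pi.single i 1) = edgeInv z i w t := by
  have : vdiff k n w (Pi.single i 1) = 0 := by
    rcases w with l | a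
    · have : l ≠ i := fun e => h (e ▸ rfl)
      simp [vdiff, this]
    · simp [vdiff]
  simp only [edgeLog, LinearMap.smul_apply, LinearMap.sub_apply, this]
  simp [vdiff, edgeInv, vval]

/-- After reduction with respect to `x = v 0`, only the first factor can be nonzero on `e_{v 0}`.
Expansion along the first row splits off `1/(t_x - y)`, and the remaining factors avoid `x`, which
is recorded by adding `x` to `X`. The condition on `y` says that every edge leads to a later vertex
or out of the image of `v`, so the edges form a forest. -/
theorem coeffFn_edgeForm_mem {k n : ℕ} (z : Fin n ↪ ℂ) (p : ℕ) (v : Fin p → Fin k)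
    (hv : Function.Injective v) (X : Set (Fin k ⊕ Fin n))
    (s : Fin p → (Fin k ⊕ Fin n) × (Fin k ⊕ Fin n)) (hs : ∀ a, (s a).1 ∉ X ∧ (s a).2 ∉ X) :
    coeffFn z v (edgeForm z s) ∈ Submodule.span ℂ
      ((fun y : Fin p → Fin k ⊕ Fin n => ∏ a, edgeInv z (v a) (y a)) ''
        {y | (∀ a, y a ∉ X) ∧ ∀ a a', a' ≤ a → y a ≠ .inl (v a')}) := by
  induction p generalizing X with
  | zero =>
    refine Submodule.subset_span ⟨fun a => a.elim0, ⟨fun a => a.elim0, fun a => a.elim0⟩, ?_⟩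
    funext t
    simp [coeffFn_apply, edgeForm, wedge_apply]
  | succ p ih =>
    set x : Fin k ⊕ Fin n := .inl (v 0) with hx
    refine map_mem_of_mem_span (coeffFn z v) ?_ (edgeForm_mem_span_isReduced z X x _ s hs)
    clear hs s
    rintro _ ⟨s, hs, rfl⟩
    have hs1 : ∀ a, ((Fin.tail s a).1 ∉ X ∧ (Fin.tail s a).2 ∉ X) ∧ (Fin.tail s a).2 ≠ x ∧
        (Fin.tail s a).1 ≠ x := fun a =>
      ⟨(hs a.succ).1, (hs a.succ).2.1, (hs a.succ).2.2 (by simp)⟩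
    have hval : coeffFn z v (edgeForm z s) = fun t : discrU k z => edgeLog z (s 0) t (Pi.single (v 0) 1) *
        coeffFn z (Fin.tail v) (edgeForm z (Fin.tail s)) t := by
      funext t
      simp only [coeffFn_apply, edgeForm, wedge_apply]
      rw [Matrix.det_succ_row_zero, Fin.sum_univ_succ, Finset.sum_eq_zero, add_zero]
      · simp only [Fin.val_zero, pow_zero, one_mul, Matrix.of_apply]
        rfl
      · intro a _
        have := edgeLog_single_of_ne z (i := v 0) (e := s a.succ) (hs1 a).2.2 (hs1 a).2.1 t
        simp [this]
    rw [hval]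
    by_cases h0 : (s 0).1 = x
    · have hs0 := hs 0
      set e := s 0 with he
      obtain ⟨x', y⟩ := e
      simp only at h0
      subst h0
      have := ih (Fin.tail v) (hv.comp (Fin.succ_injective _)) (insert x X) (Fin.tail s) (fun a => by
        simpa [not_or] using ⟨⟨(hs1 a).2.2, (hs1 a).1.1⟩, (hs1 a).2.1, (hs1 a).1.2⟩)
      let M : (discrU k z → ℂ) →ₗ[ℂ] (discrU k z → ℂ) := LinearMap.mulLeft ℂ (edgeInv z (v 0) y)
      have hM : (fun t : discrU k z => edgeLog z (x, y) t (Pi.single (v 0) 1) *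
          coeffFn z (Fin.tail v) (edgeForm z (Fin.tail s)) t) =
          M (coeffFn z (Fin.tail v) (edgeForm z (Fin.tail s))) := by
        funext t
        rw [edgeLog_single_left z hs0.2.1]
        rfl
      rw [hM]
      refine map_mem_of_mem_span M ?_ this
      rintro _ ⟨w, ⟨hw1, hw2⟩, rfl⟩
      refine Submodule.subset_span ⟨Fin.cons y w, ⟨fun a => ?_, fun a a' => ?_⟩, ?_⟩
      · refine Fin.cases ?_ (fun a => ?_) a
        · exact hs0.1.2
        · exact fun h => hw1 a (Set.mem_insert_of_mem _ h)
      · refine Fin.cases (fun h => ?_) (fun a h => ?_) a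
        · rw [Fin.le_zero_iff.1 h]
          exact hs0.2.1
        · revert h
          refine Fin.cases (fun h => ?_) (fun a' h => ?_) a'
          · exact fun h => hw1 a (Set.mem_insert_iff.2 (Or.inl h))
          · exact hw2 a a' (Fin.succ_le_succ_iff.1 h)
      · exact Fin.prod_univ_succ _
    · convert Submodule.zero_mem _ using 1
      funext t
      rw [edgeLog_single_of_ne z h0 (hs 0).2.1, zero_mul]
      rfl

/-! ### Symmetrization of forest functions -/

/-- The action of a permutation of the coordinates on functions. -/
def permFn {k n : ℕ} (z : Fin n ↪ ℂ) (σ : Equiv.Perm (Fin k)) :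
    (discrU k z → ℂ) →ₗ[ℂ] (discrU k z → ℂ) :=
  LinearMap.funLeft ℂ ℂ fun t => ⟨t.1 ∘ σ, comp_mem_discrU z σ t.2⟩

theorem permFn_apply {k n : ℕ} (z : Fin n ↪ ℂ) (σ : Equiv.Perm (Fin k)) (G : discrU k z → ℂ)
    (t : discrU k z) : permFn z σ G t = G ⟨t.1 ∘ σ, comp_mem_discrU z σ t.2⟩ := rfl

theorem permFn_permFn {k n : ℕ} (z : Fin n ↪ ℂ) (σ τ : Equiv.Perm (Fin k)) (G : discrU k z → ℂ) :
    permFn z σ (permFn z τ G) = permFn z (σ * τ) G := rfl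

theorem permFn_mul {k n : ℕ} (z : Fin n ↪ ℂ) (σ : Equiv.Perm (Fin k)) (F G : discrU k z → ℂ) :
    permFn z σ (F * G) = permFn z σ F * permFn z σ G := rfl

theorem permFn_prod {k n : ℕ} (z : Fin n ↪ ℂ) (σ : Equiv.Perm (Fin k)) {α : Type} (S : Finset α)
    (F : α → discrU k z → ℂ) : permFn z σ (∏ i ∈ S, F i) = ∏ i ∈ S, permFn z σ (F i) := by
  funext t
  simp [permFn_apply, Finset.prod_apply]

theorem permFn_edgeInv {k n : ℕ} (z : Fin n ↪ ℂ) (σ : Equiv.Perm (Fin k)) (i : Fin k)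
    (w : Fin k ⊕ Fin n) : permFn z σ (edgeInv z i w) = edgeInv z (σ i) (Sum.map σ id w) := by
  funext t
  cases w <;> simp [permFn_apply, edgeInv, vval]

theorem map_vertex_of_fixed {k n : ℕ} (σ : Equiv.Perm (Fin k)) (w : Fin k ⊕ Fin n)
    (h : ∀ l, w = .inl l → σ l = l) : Sum.map σ id w = w := by
  rcases w with l | a
  · simp [h l rfl]
  · rfl

/-- The span of the products of the functions `1 / (t_i - v_i)`, `i ∈ S`, for vertices `v_i`
that are not coordinates with index in `S`. -/
def pureFns {k n : ℕ} (z : Fin n ↪ ℂ) (S : Finset (Fin k)) : Submodule ℂ (discrU k z → ℂ) :=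
  Submodule.span ℂ ((fun y : Fin k → Fin k ⊕ Fin n => ∏ i ∈ S, edgeInv z i (y i)) ''
    {y | ∀ i ∈ S, ∀ l ∈ S, y i ≠ .inl l})

/-- The functions whose symmetrization over the coordinates in `S` is in `pureFns z S`. -/
def pureModSymm {k n : ℕ} (z : Fin n ↪ ℂ) (S : Finset (Fin k)) : Submodule ℂ (discrU k z → ℂ) :=
  pureFns z S ⊔ Submodule.span ℂ
    {F | ∃ (σ : Equiv.Perm (Fin k)) (G : discrU k z → ℂ), (∀ i ∉ S, σ i = i) ∧
      F = G - permFn z σ G}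

/-- Lagrange interpolation of the constant `1`, divided by the nodal polynomial. The nodes `-t i`
and the point `-y` are negated so that the factors come out as `t i - y` and `t i - t c`. -/
theorem prod_inv_sub_eq_sum {α : Type} [DecidableEq α] (R : Finset α) (t : α → ℂ)
    (ht : Set.InjOn t R) (y : ℂ) (hy : ∀ i ∈ R, t i ≠ y) (hR : R.Nonempty) :
    ∏ i ∈ R, (t i - y)⁻¹ = ∑ c ∈ R, (t c - y)⁻¹ * ∏ i ∈ R.erase c, (t i - t c)⁻¹ := by
  have hinj : Set.InjOn (fun i => -t i) R := fun i hi l hl h => ht hi hl (neg_injective h)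
  have h := Lagrange.eval_interpolate_not_at_node (s := R) (v := fun i => -t i) (x := -y) 1
    (fun i hi e => hy i hi (neg_injective e).symm)
  rw [Lagrange.interpolate_one hinj hR, Polynomial.eval_one, Lagrange.eval_nodal] at h
  rw [Finset.prod_inv_distrib]
  have h1 : ∏ i ∈ R, (-y - -t i) = ∏ i ∈ R, (t i - y) :=
    Finset.prod_congr rfl fun i _ => by ring
  rw [h1] at h
  rw [inv_eq_of_mul_eq_one_right h.symm]
  refine Finset.sum_congr rfl fun c _ => ?_
  rw [Lagrange.nodalWeight, Pi.one_apply, mul_one, mul_comm]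
  congr 1
  · congr 1; ring
  · exact Finset.prod_congr rfl fun i _ => by congr 1; ring

/-- The vertices of `R` are attached to `x`, which is attached to `y`. Let `A = R ∪ {x}`, and let `H
c` be the same product with `c ∈ A` as the centre of the star. Then `H c` is the image of `H x`
under the transposition of `x` and `c`, so `H x` agrees with the average of the `H c` up to terms
killed by symmetrization. By `prod_inv_sub_eq_sum` the sum of the `H c` is the product in which all
of `A` is attached directly to `y`. -/
theorem edgeInv_mul_pure_mem {k n : ℕ} (z : Fin n ↪ ℂ) {S : Finset (Fin k)} {x : Fin k}
    (hx : x ∉ S) {y : Fin k ⊕ Fin n} (hyx : y ≠ .inl x) (hyS : ∀ l ∈ S, y ≠ .inl l)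
    {w : Fin k → Fin k ⊕ Fin n} (hw : ∀ i ∈ S, ∀ l ∈ S, w i ≠ .inl l) :
    edgeInv z x y * ∏ i ∈ S, edgeInv z i (w i) ∈ pureModSymm z (insert x S) := by
  classical
  set R := S.filter fun i => w i = .inl x with hR
  set rest : discrU k z → ℂ := ∏ i ∈ S.filter (fun i => ¬ w i = .inl x), edgeInv z i (w i)
  set A := insert x R with hA
  have hRS : R ⊆ S := Finset.filter_subset _ _
  have hxR : x ∉ R := fun h => hx (hRS h)
  have hAS : A ⊆ insert x S := Finset.insert_subset_insert _ hRS
  have hyA : ∀ l ∈ A, y ≠ .inl l := fun l hl => by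
    rcases Finset.mem_insert.1 hl with rfl | h
    · exact hyx
    · exact hyS l (hRS h)
  let H : Fin k → discrU k z → ℂ := fun c =>
    edgeInv z c y * (∏ i ∈ A.erase c, edgeInv z i (.inl c)) * rest
  have hHx : edgeInv z x y * ∏ i ∈ S, edgeInv z i (w i) = H x := by
    rw [← Finset.prod_filter_mul_prod_filter_not S (fun i => w i = .inl x), ← mul_assoc]
    simp only [H, hA, Finset.erase_insert hxR]
    congr 2
    exact Finset.prod_congr rfl fun i hi => by rw [(Finset.mem_filter.1 hi).2]
  have hswap : ∀ c ∈ A, permFn z (Equiv.swap x c) (H x) = H c := by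
    intro c hc
    have hfix : ∀ i ∈ S, i ∉ R → Equiv.swap x c i = i := fun i hi hiR => by
      refine Equiv.swap_apply_of_ne_of_ne (fun e => hx (e ▸ hi)) (fun e => ?_)
      subst e
      rcases Finset.mem_insert.1 hc with e | e
      · exact hx (e ▸ hi)
      · exact hiR e
    have h1 : permFn z (Equiv.swap x c) (edgeInv z x y) = edgeInv z c y := by
      rw [permFn_edgeInv, Equiv.swap_apply_left, map_vertex_of_fixed]
      intro l hl
      exact Equiv.swap_apply_of_ne_of_ne (fun e => hyx (e ▸ hl)) (fun e => hyA c hc (e ▸ hl))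
    have h2 : permFn z (Equiv.swap x c) rest = rest := by
      rw [permFn_prod]
      refine Finset.prod_congr rfl fun i hi => ?_
      obtain ⟨hiS, hiw⟩ := Finset.mem_filter.1 hi
      rw [permFn_edgeInv, hfix i hiS (fun h => hiw (Finset.mem_filter.1 h).2), map_vertex_of_fixed]
      intro l hl
      refine Equiv.swap_apply_of_ne_of_ne (fun e => hiw (e ▸ hl)) (fun e => ?_)
      subst e
      rcases Finset.mem_insert.1 hc with e | e
      · exact hiw (e ▸ hl)
      · exact hw i hiS l (hRS e) hl
    simp only [H, permFn_mul, h1, h2, permFn_prod, permFn_edgeInv, Sum.map_inl,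
      Equiv.swap_apply_left]
    congr 2
    refine Finset.prod_nbij' (Equiv.swap x c) (Equiv.swap x c) ?_ ?_ ?_ ?_ ?_
    · intro i hi
      obtain ⟨h1, h2⟩ := Finset.mem_erase.1 hi
      refine Finset.mem_erase.2
        ⟨fun e => h1 ((Equiv.swap x c).injective (e.trans (Equiv.swap_apply_left x c).symm)), ?_⟩
      · by_cases hic : i = c
        · subst hic
          rw [Equiv.swap_apply_right]
          exact Finset.mem_insert_self _ _
        · rwa [Equiv.swap_apply_of_ne_of_ne h1 hic]
    · intro i hi
      obtain ⟨h1, h2⟩ := Finset.mem_erase.1 hi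
      refine Finset.mem_erase.2
        ⟨fun e => h1 ((Equiv.swap x c).injective (e.trans (Equiv.swap_apply_right x c).symm)), ?_⟩
      · by_cases hix : i = x
        · subst hix
          rw [Equiv.swap_apply_left]
          exact hc
        · rwa [Equiv.swap_apply_of_ne_of_ne hix h1]
    · intro i _; simp
    · intro i _; simp
    · intro i _; rfl
  have hsum : ∑ c ∈ A, H c ∈ pureFns z (insert x S) := by
    refine Submodule.subset_span ⟨fun i => if i ∈ A then y else w i, ?_, ?_⟩
    · intro i hi l hl
      beta_reduce
      split_ifs with h
      · rcases Finset.mem_insert.1 hl with rfl | h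
        · exact hyx
        · exact hyS l h
      · have hiS : i ∈ S := by
          rcases Finset.mem_insert.1 hi with rfl | h'
          · exact absurd (Finset.mem_insert_self _ _) h
          · exact h'
        rcases Finset.mem_insert.1 hl with rfl | h'
        · exact fun e => h (Finset.mem_insert_of_mem (Finset.mem_filter.2 ⟨hiS, e⟩))
        · exact hw i hiS l h'
    · beta_reduce
      have hunion : insert x S = A ∪ S.filter (fun i => ¬ w i = .inl x) := by
        rw [hA, hR, Finset.insert_union, Finset.filter_union_filter_not_eq]
      have hdisj : Disjoint A (S.filter (fun i => ¬ w i = .inl x)) := by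
        rw [hA, Finset.disjoint_insert_left]
        exact ⟨fun h => hx (Finset.mem_filter.1 h).1, Finset.disjoint_filter_filter_not _ _ _⟩
      rw [hunion, Finset.prod_union hdisj, ← Finset.sum_mul]
      congr 1
      · funext t
        have hinj := vval_injective t.2
        simp only [Finset.prod_apply, Finset.sum_apply, Pi.mul_apply]
        rw [Finset.prod_congr rfl fun i hi => by rw [if_pos hi]]
        exact prod_inv_sub_eq_sum A t.1
          (fun i _ l _ h => Sum.inl_injective (hinj (a₁ := .inl i) (a₂ := .inl l) h)) _
          (fun i hi h => hyA i hi (hinj (a₁ := .inl i) h).symm) ⟨x, Finset.mem_insert_self _ _⟩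
      · refine Finset.prod_congr rfl fun i hi => ?_
        rw [if_neg fun h => Finset.disjoint_left.1 hdisj h hi]
  have hcard : (A.card : ℂ) ≠ 0 :=
    Nat.cast_ne_zero.2 (Finset.card_ne_zero_of_mem (Finset.mem_insert_self x R))
  have hdecomp : H x = (A.card : ℂ)⁻¹ • ∑ c ∈ A, H c + (A.card : ℂ)⁻¹ • ∑ c ∈ A, (H x - H c) := by
    rw [← smul_add, ← Finset.sum_add_distrib]
    simp only [add_sub_cancel, Finset.sum_const]
    rw [← Nat.cast_smul_eq_nsmul ℂ, inv_smul_smul₀ hcard]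
  rw [hHx, hdecomp]
  refine add_mem (Submodule.smul_mem _ _ (Submodule.mem_sup_left hsum)) (Submodule.smul_mem _ _
    (Submodule.sum_mem _ fun c hc => Submodule.mem_sup_right (Submodule.subset_span
      ⟨Equiv.swap x c, H x, fun i hi => ?_, by rw [hswap c hc]⟩)))
  exact Equiv.swap_apply_of_ne_of_ne (fun e => hi (e ▸ Finset.mem_insert_self _ _))
    (fun e => hi (e ▸ hAS hc))

/-- A permutation of the indices in `S` fixes both `x` and `y`, so the new factor can be moved
inside `G - σ G`. -/
theorem edgeInv_mul_mem_pureModSymm {k n : ℕ} (z : Fin n ↪ ℂ) {S : Finset (Fin k)} {x : Fin k}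
    (hx : x ∉ S) {y : Fin k ⊕ Fin n} (hyx : y ≠ .inl x) (hyS : ∀ l ∈ S, y ≠ .inl l)
    {F : discrU k z → ℂ} (hF : F ∈ pureModSymm z S) :
    edgeInv z x y * F ∈ pureModSymm z (insert x S) := by
  obtain ⟨F₁, h₁, F₂, h₂, rfl⟩ := Submodule.mem_sup.1 hF
  rw [mul_add]
  refine add_mem ?_ ?_
  · refine map_mem_of_mem_span (LinearMap.mulLeft ℂ (edgeInv z x y)) ?_ h₁
    rintro _ ⟨w, hw, rfl⟩
    exact edgeInv_mul_pure_mem z hx hyx hyS hw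
  · refine map_mem_of_mem_span (LinearMap.mulLeft ℂ (edgeInv z x y)) ?_ h₂
    rintro _ ⟨σ, G, hσ, rfl⟩
    refine Submodule.mem_sup_right (Submodule.subset_span ⟨σ, edgeInv z x y * G, fun i hi => ?_, ?_⟩)
    · exact hσ i fun h => hi (Finset.mem_insert_of_mem h)
    · have hy : permFn z σ (edgeInv z x y) = edgeInv z x y := by
        rw [permFn_edgeInv, hσ x hx, map_vertex_of_fixed]
        exact fun l hl => hσ l fun h => hyS l h hl
      rw [permFn_mul, hy, LinearMap.mulLeft_apply, mul_sub]

/-- The last vertex is a root of the forest: its target lies outside the image of `v`. It is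
attached after the forest of the other vertices has been flattened, while it still counts as an
outside vertex for them. -/
theorem forest_mem_pureModSymm {k n : ℕ} (z : Fin n ↪ ℂ) (p : ℕ) (v : Fin p → Fin k)
    (hv : Function.Injective v) (y : Fin p → Fin k ⊕ Fin n)
    (hy : ∀ a a', a' ≤ a → y a ≠ .inl (v a')) :
    (∏ a, edgeInv z (v a) (y a)) ∈ pureModSymm z (Finset.univ.image v) := by
  induction p with
  | zero =>
    refine Submodule.mem_sup_left (Submodule.subset_span ⟨fun i => .inl i, ?_, ?_⟩)
    · simp
    · simp
  | succ p ih =>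
    have hS : Finset.univ.image v =
        insert (v (Fin.last p)) (Finset.univ.image fun a : Fin p => v a.castSucc) := by
      ext i
      simp only [Finset.mem_image, Finset.mem_univ, true_and, Finset.mem_insert]
      constructor
      · rintro ⟨a, rfl⟩
        refine Fin.lastCases (Or.inl rfl) (fun a => Or.inr ⟨a, rfl⟩) a
      · rintro (rfl | ⟨a, rfl⟩)
        exacts [⟨_, rfl⟩, ⟨_, rfl⟩]
    rw [Fin.prod_univ_castSucc, mul_comm, hS]
    refine edgeInv_mul_mem_pureModSymm z ?_ (hy _ _ le_rfl) ?_ (ih _ ?_ _ ?_)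
    · simp only [Finset.mem_image, Finset.mem_univ, true_and, not_exists]
      exact fun a h => (Fin.castSucc_lt_last a).ne (hv h)
    · intro l hl
      obtain ⟨a, _, rfl⟩ := Finset.mem_image.1 hl
      exact hy _ _ (Fin.le_last _)
    · exact hv.comp (Fin.castSucc_injective _)
    · exact fun a a' h => hy _ _ (Fin.castSucc_le_castSucc_iff.2 h)

theorem permFn_mem_pureFns {k n : ℕ} (z : Fin n ↪ ℂ) {S : Finset (Fin k)}
    {σ : Equiv.Perm (Fin k)} (hσ : ∀ i ∉ S, σ i = i) {F : discrU k z → ℂ} (hF : F ∈ pureFns z S) :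
    permFn z σ F ∈ pureFns z S := by
  have hS : ∀ i, i ∈ S ↔ σ i ∈ S := by
    intro i
    by_cases hi : i ∈ S
    · refine ⟨fun _ => ?_, fun _ => hi⟩
      by_contra h
      exact h (by rwa [σ.injective (hσ _ h)])
    · rw [hσ i hi]
  refine map_mem_of_mem_span (permFn z σ) ?_ hF
  rintro _ ⟨y, hy, rfl⟩
  refine Submodule.subset_span ⟨fun i => y (σ.symm i), fun i hi l hl => hy _ ?_ l hl, ?_⟩
  · rw [hS]; simpa using hi
  · beta_reduce
    rw [permFn_prod]
    symm
    refine Finset.prod_equiv σ hS fun i hi => ?_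
    rw [permFn_edgeInv, map_vertex_of_fixed, Equiv.symm_apply_apply]
    exact fun l hl => hσ l fun h => hy i hi l h hl

/-- Averaging over the permutations supported on `S` fixes `F`, preserves `pureFns z S`, and kills
every `G - τ G` by right translation of the sum. -/
theorem mem_pureFns_of_symmetric {k n : ℕ} (z : Fin n ↪ ℂ) {S : Finset (Fin k)}
    {F : discrU k z → ℂ} (hF : F ∈ pureModSymm z S)
    (hsymm : ∀ σ : Equiv.Perm (Fin k), (∀ i ∉ S, σ i = i) → permFn z σ F = F) :
    F ∈ pureFns z S := by
  classical
  set P : Finset (Equiv.Perm (Fin k)) := Finset.univ.filter fun σ => ∀ i ∉ S, σ i = i with hP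
  have hmem : ∀ σ, σ ∈ P ↔ ∀ i ∉ S, σ i = i := fun σ => by simp [hP]
  let A : (discrU k z → ℂ) →ₗ[ℂ] (discrU k z → ℂ) := ∑ σ ∈ P, permFn z σ
  have hA : ∀ G, A G = ∑ σ ∈ P, permFn z σ G := fun G => LinearMap.sum_apply _ _ _
  have hAF : A F ∈ pureFns z S := by
    obtain ⟨F₁, h₁, F₂, h₂, rfl⟩ := Submodule.mem_sup.1 hF
    rw [map_add]
    refine add_mem ?_ ?_
    · rw [hA]
      exact Submodule.sum_mem _ fun σ hσ => permFn_mem_pureFns z ((hmem σ).1 hσ) h₁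
    · refine map_mem_of_mem_span A ?_ h₂
      rintro _ ⟨τ, G, hτ, rfl⟩
      convert Submodule.zero_mem _ using 1
      rw [map_sub, sub_eq_zero, hA, hA]
      symm
      refine Finset.sum_equiv (Equiv.mulRight τ) (fun σ => ?_) (fun σ _ => permFn_permFn z σ τ G)
      rw [hmem, hmem]
      refine forall₂_congr fun i hi => ?_
      simp [hτ i hi]
  have hcard : (P.card : ℂ) ≠ 0 :=
    Nat.cast_ne_zero.2 (Finset.card_ne_zero_of_mem ((hmem 1).2 fun _ _ => rfl))
  have : F = (P.card : ℂ)⁻¹ • A F := by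
    rw [hA, Finset.sum_congr rfl fun σ hσ => hsymm σ ((hmem σ).1 hσ), Finset.sum_const,
      ← Nat.cast_smul_eq_nsmul ℂ, inv_smul_smul₀ hcard]
  rw [this]
  exact Submodule.smul_mem _ _ hAF

/-! ### Independence of products of simple fractions -/

theorem eventually_notMem_nhdsNE (B : Finset ℂ) (x : ℂ) : ∀ᶠ s in 𝓝[≠] x, s ∉ B := by
  have : ∀ b ∈ B, ∀ᶠ s in 𝓝[≠] x, s ≠ b := fun b _ => by
    by_cases h : x = b
    · subst h; exact self_mem_nhdsWithin
    · exact (eventually_ne_nhds h).filter_mono nhdsWithin_le_nhds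
  filter_upwards [(Finset.eventually_all B).2 this] with s hs hsB
  exact hs s hsB rfl

theorem tendsto_mul_inv_sub {Y : Type} [DecidableEq Y] {P : Y → ℂ} (hP : Function.Injective P)
    (b b₀ : Y) :
    Tendsto (fun s : ℂ => (s - P b₀) * (s - P b)⁻¹) (𝓝[≠] (P b₀))
      (𝓝 (if b = b₀ then 1 else 0)) := by
  split_ifs with h
  · subst h
    refine tendsto_const_nhds.congr' ?_
    filter_upwards [self_mem_nhdsWithin] with s hs
    rw [mul_inv_cancel₀ (sub_ne_zero.2 hs)]
  · have h1 : P b₀ - P b ≠ 0 := sub_ne_zero.2 (hP.ne (Ne.symm h))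
    have : ContinuousAt (fun s : ℂ => (s - P b₀) * (s - P b)⁻¹) (P b₀) :=
      (by fun_prop : ContinuousAt (fun s : ℂ => s - P b₀) (P b₀)).mul
        ((by fun_prop : ContinuousAt (fun s : ℂ => s - P b) (P b₀)).inv₀ h1)
    simpa using this.tendsto.mono_left (nhdsWithin_le_nhds (s := {P b₀}ᶜ))

/-- Iterated residues: for each `a ∈ J` in turn, multiply by `t a - P (y₀ a)` and let `t a` tend to
`P (y₀ a)`, which keeps the labels with `y a = y₀ a`. The relation is assumed only at distinct
values outside the finite set `B`, because it will come from points of an arrangement complement. -/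
theorem sum_coeff_eq_zero {ι Y : Type} [Fintype ι] [DecidableEq ι] [Fintype Y] [DecidableEq Y]
    {P : Y → ℂ} (hP : Function.Injective P) (B : Finset ℂ) (J : Finset ι) (c : (ι → Y) → ℂ)
    (h : ∀ t : ι → ℂ, Set.InjOn t J → (∀ a ∈ J, t a ∉ B) →
      ∑ y, c y * ∏ a ∈ J, (t a - P (y a))⁻¹ = 0) (y₀ : ι → Y) :
    ∑ y, (if ∀ a ∈ J, y a = y₀ a then c y else 0) = 0 := by
  induction J using Finset.induction_on generalizing c with
  | empty => simpa using h 0 (by simp) (by simp)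
  | insert a J ha ih =>
    have := ih (fun y => if y a = y₀ a then c y else 0) (fun t ht htB => ?_)
    · refine Eq.trans (Finset.sum_congr rfl fun y _ => ?_) this
      simp only [Finset.forall_mem_insert, ← ite_and]
      congr 1
      exact propext and_comm
    · have hlim : Tendsto (fun s : ℂ => ∑ y, c y * (((s - P (y₀ a)) * (s - P (y a))⁻¹) *
          ∏ b ∈ J, (t b - P (y b))⁻¹)) (𝓝[≠] (P (y₀ a)))
          (𝓝 (∑ y, c y * ((if y a = y₀ a then 1 else 0) * ∏ b ∈ J, (t b - P (y b))⁻¹))) :=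
        tendsto_finsetSum _ fun y _ => ((tendsto_mul_inv_sub hP _ _).mul_const _).const_mul _
      have hzero : Tendsto (fun s : ℂ => ∑ y, c y * (((s - P (y₀ a)) * (s - P (y a))⁻¹) *
          ∏ b ∈ J, (t b - P (y b))⁻¹)) (𝓝[≠] (P (y₀ a))) (𝓝 0) := by
        refine tendsto_const_nhds.congr' ?_
        -- The moving value must also avoid the remaining `t b`, to keep the point injective.
        filter_upwards [eventually_notMem_nhdsNE (B ∪ J.image t) (P (y₀ a))] with s hs
        rw [Finset.mem_union, not_or] at hs
        have hne : ∀ b ∈ J, b ≠ a := fun b hb e => ha (e ▸ hb)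
        have h1 := h (Function.update t a s) ?_ ?_
        · rw [← mul_zero (s - P (y₀ a)), ← h1, Finset.mul_sum]
          refine Finset.sum_congr rfl fun y _ => ?_
          rw [Finset.prod_insert ha, Function.update_self]
          rw [Finset.prod_congr rfl fun b hb => by rw [Function.update_of_ne (hne b hb)]]
          ring
        · rw [Finset.coe_insert, Set.injOn_insert (by simpa using ha)]
          constructor
          · intro b hb b' hb' hbb
            rw [Function.update_of_ne (hne b hb), Function.update_of_ne (hne b' hb')] at hbb
            exact ht hb hb' hbb
          · rintro ⟨b, hb, hbs⟩
            rw [Function.update_of_ne (hne b hb), Function.update_self] at hbs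
            exact hs.2 (Finset.mem_image.2 ⟨b, hb, hbs⟩)
        · intro b hb
          rcases Finset.mem_insert.1 hb with rfl | hb
          · rw [Function.update_self]; exact hs.1
          · rw [Function.update_of_ne (hne b hb)]; exact htB b hb
      refine Eq.trans (Finset.sum_congr rfl fun y _ => ?_) (tendsto_nhds_unique hlim hzero)
      split_ifs <;> simp

/-! ### Coefficients of skew-symmetric forms -/

theorem discrU_nonempty {n : ℕ} (k : ℕ) (z : Fin n ↪ ℂ) : (discrU k z).Nonempty := by
  have : (Set.range z)ᶜ.Infinite := (Set.finite_range z).infinite_compl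
  let f := this.natEmbedding
  refine ⟨fun i => f i, (mem_discrU_iff z _).2 ⟨fun i l h e => h ?_, fun i a e => ?_⟩⟩
  · exact Fin.ext (f.injective (Subtype.ext e))
  · exact (f i).2 ⟨a, e.symm⟩

theorem permFn_coeffFn {k n p : ℕ} (z : Fin n ↪ ℂ) (σ : Equiv.Perm (Fin k)) (v : Fin p → Fin k)
    (η : Form (discrU k z) p) :
    permFn z σ (coeffFn z v η) = coeffFn z (σ ∘ v) (permForm z σ η) := by
  funext t
  simp only [permFn_apply, coeffFn_apply, permForm, LinearMap.coe_mk, AddHom.coe_mk,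
    AlternatingMap.compLinearMap_apply]
  congr 1
  funext a
  ext i
  simp [LinearMap.funLeft_apply, Pi.single_apply]

theorem coeffFn_comp_perm {k n p : ℕ} (z : Fin n ↪ ℂ) (v : Fin p → Fin k)
    (η : Form (discrU k z) p) (τ : Equiv.Perm (Fin p)) :
    coeffFn z (v ∘ τ) η = (((Equiv.Perm.sign τ : ℤˣ) : ℤ) : ℂ) • coeffFn z v η := by
  funext t
  rw [Pi.smul_apply, coeffFn_apply, coeffFn_apply]
  have := (η t).map_perm (fun a => Pi.single (v a) 1) τ
  simp only [Function.comp_apply]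
  refine this.trans ?_
  rw [Units.smul_def, zsmul_eq_mul, smul_eq_mul]

theorem sign_sq {α : Type} [Fintype α] [DecidableEq α] (σ : Equiv.Perm α) :
    (((Equiv.Perm.sign σ : ℤˣ) : ℤ) : ℂ) * (((Equiv.Perm.sign σ : ℤˣ) : ℤ) : ℂ) = 1 := by
  rw [← Int.cast_mul, ← Units.val_mul, Int.units_mul_self]
  simp

theorem permFn_coeffFn_of_skew {k n p : ℕ} {z : Fin n ↪ ℂ} {η : Form (discrU k z) p}
    (hη : η ∈ skewOS k z p) (σ : Equiv.Perm (Fin k)) (v : Fin p → Fin k) :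
    permFn z σ (coeffFn z v η) =
      (((Equiv.Perm.sign σ : ℤˣ) : ℤ) : ℂ) • coeffFn z (σ ∘ v) η := by
  rw [permFn_coeffFn, hη.2, map_smul]

theorem coeffFn_comp_of_skew {k n p : ℕ} {z : Fin n ↪ ℂ} {η : Form (discrU k z) p}
    (hη : η ∈ skewOS k z p) (σ : Equiv.Perm (Fin k)) (v : Fin p → Fin k) :
    coeffFn z (σ ∘ v) η =
      (((Equiv.Perm.sign σ : ℤˣ) : ℤ) : ℂ) • permFn z σ (coeffFn z v η) := by
  rw [permFn_coeffFn_of_skew hη, smul_smul, sign_sq, one_smul]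

/-- Fixed points do not affect the sign, so `σ` can be restricted to the image of `v` and
transported to `Fin p`. This turns a permutation of coordinates into a reordering of the arguments
of the form with the same sign. -/
theorem exists_perm_of_fixed {k p : ℕ} {v : Fin p → Fin k} (hv : Function.Injective v)
    {σ : Equiv.Perm (Fin k)} (hσ : ∀ i ∉ Finset.univ.image v, σ i = i) :
    ∃ τ : Equiv.Perm (Fin p), σ ∘ v = v ∘ τ ∧ Equiv.Perm.sign τ = Equiv.Perm.sign σ := by
  have hmem : ∀ i, i ∈ Set.range v ↔ i ∈ Finset.univ.image v := fun i => by simp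
  have hS : ∀ i, σ i ∈ Set.range v ↔ i ∈ Set.range v := by
    intro i
    rw [hmem, hmem]
    by_cases hi : i ∈ Finset.univ.image v
    · refine iff_of_true ?_ hi
      by_contra h
      exact h (by rwa [σ.injective (hσ _ h)])
    · rw [hσ i hi]
  let f := Equiv.ofInjective v hv
  refine ⟨f.symm.permCongr (σ.subtypePerm hS), ?_, ?_⟩
  · funext a
    have : (f (f.symm (σ.subtypePerm hS (f a))) : Fin k) = σ (v a) := by
      rw [Equiv.apply_symm_apply]; rfl
    exact this.symm
  · rw [Equiv.Perm.sign_permCongr]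
    convert Equiv.Perm.sign_subtypePerm σ hS ?_
    intro i hi
    rw [hmem]
    by_contra h
    exact hi (hσ i h)

/-- A permutation of the indices in the image of `v` produces `sign σ` twice, once from
skew-symmetry and once from reordering the arguments. The coefficient is therefore symmetric, and
its forest expansion can be averaged. -/
theorem coeffFn_mem_pureFns {k n p : ℕ} {z : Fin n ↪ ℂ} {η : Form (discrU k z) p}
    (hη : η ∈ skewOS k z p) {v : Fin p → Fin k} (hv : Function.Injective v) :
    coeffFn z v η ∈ pureFns z (Finset.univ.image v) := by
  refine mem_pureFns_of_symmetric z ?_ fun σ hσ => ?_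
  · refine map_mem_of_mem_span (coeffFn z v) ?_ hη.1
    rintro _ ⟨s, rfl⟩
    beta_reduce
    rw [logForm_discrFn]
    refine map_mem_of_mem_span LinearMap.id ?_
      (coeffFn_edgeForm_mem z p v hv ∅ (fun a => (s a).edge) (by simp))
    rintro _ ⟨y, hy, rfl⟩
    exact forest_mem_pureModSymm z p v hv y hy.2
  · obtain ⟨τ, h1, h2⟩ := exists_perm_of_fixed hv hσ
    rw [permFn_coeffFn_of_skew hη, h1, coeffFn_comp_perm, h2, smul_smul, sign_sq, one_smul]

/-- The vertices other than the coordinates with index `v a`. -/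
abbrev OuterVertex {k p : ℕ} (n : ℕ) (v : Fin p → Fin k) : Type :=
  {l : Fin k // l ∉ Finset.univ.image v} ⊕ Fin n

/-- The inclusion of the outer vertices into all vertices. -/
def OuterVertex.val {k p n : ℕ} {v : Fin p → Fin k} : OuterVertex n v → Fin k ⊕ Fin n :=
  Sum.map Subtype.val id

theorem OuterVertex.val_injective {k p n : ℕ} {v : Fin p → Fin k} :
    Function.Injective (OuterVertex.val : OuterVertex n v → _) :=
  Sum.map_injective.2 ⟨Subtype.val_injective, Function.injective_id⟩

theorem OuterVertex.val_ne {k p n : ℕ} {v : Fin p → Fin k} (u : OuterVertex n v) (a : Fin p) :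
    u.val ≠ .inl (v a) := by
  rcases u with ⟨l, hl⟩ | b
  · intro h
    have h : l = v a := Sum.inl_injective h
    exact hl (h ▸ Finset.mem_image_of_mem _ (Finset.mem_univ a))
  · exact fun h => Sum.inr_ne_inl h

theorem OuterVertex.exists_val_eq {k p n : ℕ} {v : Fin p → Fin k} {w : Fin k ⊕ Fin n}
    (hw : ∀ a, w ≠ .inl (v a)) : ∃ u : OuterVertex n v, u.val = w := by
  rcases w with l | b
  · refine ⟨.inl ⟨l, fun h => ?_⟩, rfl⟩
    obtain ⟨a, _, rfl⟩ := Finset.mem_image.1 h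
    exact hw a rfl
  · exact ⟨.inr b, rfl⟩

theorem exists_outer_coeff {k n p : ℕ} {z : Fin n ↪ ℂ} {η : Form (discrU k z) p}
    (hη : η ∈ skewOS k z p) {v : Fin p → Fin k} (hv : Function.Injective v) :
    ∃ c : (Fin p → OuterVertex n v) → ℂ,
      ∑ y, c y • ∏ a, edgeInv z (v a) (y a).val = coeffFn z v η := by
  rw [← Submodule.mem_span_range_iff_exists_fun]
  refine Submodule.span_mono ?_ (coeffFn_mem_pureFns hη hv)
  rintro _ ⟨w, hw, rfl⟩
  have : ∀ a, ∃ u : OuterVertex n v, u.val = w (v a) := fun a =>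
    OuterVertex.exists_val_eq fun a' => hw _ (Finset.mem_image_of_mem _ (Finset.mem_univ a)) _
      (Finset.mem_image_of_mem _ (Finset.mem_univ a'))
  choose y hy using this
  refine ⟨y, ?_⟩
  beta_reduce
  rw [Finset.prod_image fun a _ a' _ h => hv h]
  simp only [hy]

/-! ### Regularity along the diagonals -/

theorem single_update {k p : ℕ} (v : Fin p → Fin k) (a₀ : Fin p) (l : Fin k) :
    (fun a => (Pi.single (Function.update v a₀ l a) 1 : Fin k → ℂ)) =
      Function.update (fun a => (Pi.single (v a) 1 : Fin k → ℂ)) a₀ (Pi.single l 1) := by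
  funext a
  by_cases h : a = a₀
  · subst h; simp
  · simp [h]

/-- By linearity in the argument `a₀`, the sum of the two coefficients is the value of `η` with
`e_{v a₀}` replaced by `e_{v a₀} + e_l`. The form `d log (t_{v a₀} - t_l)` vanishes on all the
resulting vectors, and every other factor is regular at `g 0`. In the application `g` is a line
through a generic point of the diagonal. -/
theorem exists_bound_of_mem_discrOS {k n p : ℕ} {z : Fin n ↪ ℂ} {η : Form (discrU k z) p}
    (hη : η ∈ discrOS k z p) {v : Fin p → Fin k} (hv : Function.Injective v) (a₀ : Fin p)
    {l : Fin k} (hl : ∀ a, v a ≠ l) {g : ℂ → Fin k → ℂ} (hg : ContinuousAt g 0)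
    (hτ : ∀ h : DiscrHyp k n, h.edge ≠ (.inl (v a₀), .inl l) → h.edge ≠ (.inl l, .inl (v a₀)) →
      discrFn z h (g 0) ≠ 0) :
    ∃ C : ℝ, ∀ᶠ s in 𝓝 (0 : ℂ), ∀ hs : g s ∈ discrU k z,
      ‖coeffFn z v η ⟨g s, hs⟩ + coeffFn z (Function.update v a₀ l) η ⟨g s, hs⟩‖ ≤ C := by
  set e : Fin p → Fin k → ℂ := fun a => Pi.single (v a) 1 with he
  have hval : ∀ (η : Form (discrU k z) p) (t : discrU k z),
      coeffFn z v η t + coeffFn z (Function.update v a₀ l) η t =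
        η t (Function.update e a₀ (Pi.single (v a₀) 1 + Pi.single l 1)) := by
    intro η t
    rw [AlternatingMap.map_update_add, coeffFn_apply, coeffFn_apply, single_update,
      show (Pi.single (v a₀) 1 : Fin k → ℂ) = e a₀ from rfl, Function.update_eq_self]
  simp only [hval]
  set w := Function.update e a₀ (Pi.single (v a₀) 1 + Pi.single l 1) with hw
  induction hη using Submodule.span_induction with
  | zero => exact ⟨0, by simp⟩
  | add η η' _ _ h h' =>
    obtain ⟨C, hC⟩ := h
    obtain ⟨C', hC'⟩ := h'
    refine ⟨C + C', ?_⟩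
    filter_upwards [hC, hC'] with s h h' hs
    exact (norm_add_le _ _).trans (add_le_add (h hs) (h' hs))
  | smul r η _ h =>
    obtain ⟨C, hC⟩ := h
    refine ⟨‖r‖ * C, ?_⟩
    filter_upwards [hC] with s h hs
    rw [Pi.smul_apply, AlternatingMap.smul_apply, norm_smul]
    exact mul_le_mul_of_nonneg_left (h hs) (norm_nonneg r)
  | mem η h =>
    obtain ⟨s, rfl⟩ := h
    by_cases hs : ∃ b, (s b).edge = (.inl (v a₀), .inl l) ∨ (s b).edge = (.inl l, .inl (v a₀))
    · obtain ⟨b, hb⟩ := hs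
      refine ⟨0, .of_forall fun x hx => ?_⟩
      suffices logForm (discrFn z) s ⟨g x, hx⟩ w = 0 by rw [this, norm_zero]
      refine Matrix.det_eq_zero_of_column_eq_zero b fun a => ?_
      have hdiff : w a (v a₀) = w a l := by
        by_cases ha : a = a₀
        · subst ha
          simp [hw, hl a, (hl a).symm]
        · have h1 : v a ≠ v a₀ := hv.ne ha
          simp [hw, he, ha, h1.symm, (hl a).symm]
      change dlog (discrFn z (s b)) (g x) (w a) = 0
      rw [dlog_discrFn]
      rcases hb with hb | hb <;> simp [hb, edgeLog, vdiff, hdiff]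
    · push Not at hs
      have hc : ContinuousAt (fun x => (Matrix.of fun a b : Fin p =>
          dlog (discrFn z (s b)) (g x) (w a)).det) 0 := by
        refine (continuous_id.matrix_det).continuousAt.comp ?_
        refine continuousAt_pi.2 fun a => continuousAt_pi.2 fun b => ?_
        have : ContinuousAt (fun x => discrFn z (s b) (g x)) 0 :=
          ((discrFn z (s b)).continuous_of_finiteDimensional.continuousAt (x := g 0)).comp hg
        exact (this.inv₀ (hτ _ (hs b).1 (hs b).2)).mul continuousAt_const
      refine ⟨_, (hc.norm.tendsto.eventually_le_const (lt_add_one _)).mono fun x hx hs => hx⟩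

theorem mem_discrU_of_vval_injective {k n : ℕ} {z : Fin n ↪ ℂ} {t : Fin k → ℂ}
    (h : Function.Injective (vval z t)) : t ∈ discrU k z :=
  (mem_discrU_iff z t).2 ⟨fun i l hil e => hil (Sum.inl_injective (h (a₁ := .inl i) (a₂ := .inl l) e)),
    fun i a e => Sum.inl_ne_inr (h (a₁ := .inl i) (a₂ := .inr a) e)⟩

theorem tendsto_mul_inv_add (x : ℂ) :
    Tendsto (fun s : ℂ => s * (x + s)⁻¹) (𝓝[≠] 0) (𝓝 (if x = 0 then 1 else 0)) := by
  -- The points `0` and `-x` coincide exactly when `x = 0`, so both cases follow at once.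
  have := tendsto_mul_inv_sub (P := fun b : ({0, -x} : Set ℂ) => (b : ℂ)) Subtype.val_injective
    ⟨-x, by simp⟩ ⟨0, by simp⟩
  simp only [sub_zero, sub_neg_eq_add, Subtype.mk.injEq, neg_eq_zero] at this
  simpa only [add_comm] using this

/-- Let `i = v a₀` and `σ = (i l)`. The coefficient at `σ ∘ v` is `-σ F`, and `σ` reverses the sign
of `1/(t_i - t_l)`, so `F` and `-σ F` have the same residue along `t_i = t_l`. Their sum is bounded
there, so twice the residue is zero; independence of the fractions in the remaining variables gives
the claim. -/
theorem outer_coeff_eq_zero {k n p : ℕ} {z : Fin n ↪ ℂ} {η : Form (discrU k z) p}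
    (hη : η ∈ skewOS k z p) {v : Fin p → Fin k} (hv : Function.Injective v)
    {c : (Fin p → OuterVertex n v) → ℂ}
    (hc : ∑ y, c y • ∏ a, edgeInv z (v a) (y a).val = coeffFn z v η)
    {y₀ : Fin p → OuterVertex n v} {a₀ : Fin p} {u₀ : {l : Fin k // l ∉ Finset.univ.image v}}
    (hy₀ : y₀ a₀ = .inl u₀) : c y₀ = 0 := by
  classical
  obtain ⟨T, hT⟩ := discrU_nonempty k z
  have hTinj := vval_injective hT
  obtain ⟨l, hl⟩ := u₀
  have hlv : ∀ a, v a ≠ l := fun a e => hl (e ▸ Finset.mem_image_of_mem _ (Finset.mem_univ a))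
  set u₀ : OuterVertex n v := .inl ⟨l, hl⟩ with hu₀
  set P : OuterVertex n v → ℂ := fun u => vval z T u.val with hP
  have hPinj : Function.Injective P := hTinj.comp OuterVertex.val_injective
  have hPu₀ : P u₀ = T l := rfl
  set J : Finset (Fin p) := Finset.univ.erase a₀ with hJ
  have hJmem : ∀ {a}, a ∈ J ↔ a ≠ a₀ := by simp [hJ]
  have key := sum_coeff_eq_zero hPinj (Finset.univ.image (vval z T)) J
    (fun y => if y a₀ = u₀ then c y else 0) (fun t ht htB => ?_) y₀
  · rw [Finset.sum_eq_single y₀] at key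
    · simpa [hy₀] using key
    · intro y _ hy
      by_cases h : ∀ a ∈ J, y a = y₀ a
      · rw [if_pos h, if_neg]
        intro h0
        refine hy (funext fun a => ?_)
        by_cases ha : a = a₀
        · rw [ha, h0, hy₀]
        · exact h a (hJmem.2 ha)
      · rw [if_neg h]
    · intro h; exact absurd (Finset.mem_univ _) h
  set i := v a₀ with hi
  have hil : i ≠ l := hlv a₀
  -- A generic point of the diagonal: `t_i = t_l = T l`, the other coordinates in the image of `v`
  -- are given by `t`, and the unused ones by `T`.
  set τ : Fin k → ℂ := Function.extend v (Function.update t a₀ (T l)) T with hτ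
  have hτi : τ i = T l := by rw [hτ, hi, hv.extend_apply, Function.update_self]
  have hτv : ∀ a, a ≠ a₀ → τ (v a) = t a := fun a ha => by
    rw [hτ, hv.extend_apply, Function.update_of_ne ha]
  have hτu : ∀ u : OuterVertex n v, vval z τ u.val = P u := by
    rintro (⟨m, hm⟩ | b)
    · change τ m = T m
      rw [hτ, Function.extend_apply']
      rintro ⟨a, rfl⟩
      exact hm (Finset.mem_image_of_mem _ (Finset.mem_univ a))
    · rfl
  have hcases : ∀ w : Fin k ⊕ Fin n, w ≠ .inl i →
      (∃ a, a ≠ a₀ ∧ w = .inl (v a)) ∨ ∃ u : OuterVertex n v, w = u.val := by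
    intro w hw
    by_cases h : ∃ a, w = .inl (v a)
    · obtain ⟨a, rfl⟩ := h
      exact Or.inl ⟨a, fun e => hw (e ▸ rfl), rfl⟩
    · push Not at h
      obtain ⟨u, hu⟩ := OuterVertex.exists_val_eq h
      exact Or.inr ⟨u, hu.symm⟩
  have htP : ∀ a, a ≠ a₀ → ∀ u, t a ≠ P u := fun a ha u e =>
    htB a (hJmem.2 ha) (Finset.mem_image.2 ⟨u.val, Finset.mem_univ _, e.symm⟩)
  have hτinj : ∀ w w' : Fin k ⊕ Fin n, w ≠ .inl i → w' ≠ .inl i → vval z τ w = vval z τ w' →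
      w = w' := by
    intro w w' hw hw' h
    rcases hcases w hw with ⟨a, ha, rfl⟩ | ⟨u, rfl⟩ <;>
      rcases hcases w' hw' with ⟨a', ha', rfl⟩ | ⟨u', rfl⟩
    · have h : t a = t a' := by rw [← hτv a ha, ← hτv a' ha']; exact h
      rw [ht (hJmem.2 ha) (hJmem.2 ha') h]
    · rw [hτu] at h
      exact absurd ((hτv a ha).symm.trans h) (htP a ha u')
    · rw [hτu] at h
      exact absurd ((hτv a' ha').symm.trans h.symm) (htP a' ha' u)
    · rw [hτu, hτu] at h
      rw [hPinj h]
  set g : ℂ → Fin k → ℂ := fun s => Function.update τ i (T l + s) with hgdef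
  have hg0 : g 0 = τ := by simp only [hgdef, add_zero, ← hτi, Function.update_eq_self]
  have hgi : ∀ s, g s i = T l + s := fun s => Function.update_self _ _ _
  have hgne : ∀ s m, m ≠ i → g s m = τ m := fun s m hm => Function.update_of_ne hm _ _
  have hgval : ∀ s (w : Fin k ⊕ Fin n), w ≠ .inl i → vval z (g s) w = vval z τ w := by
    rintro s (m | b) hw
    · exact hgne s m fun e => hw (e ▸ rfl)
    · rfl
  have hgc : ContinuousAt g 0 :=
    (by fun_prop : Continuous fun s : ℂ => Function.update τ i (T l + s)).continuousAt
  have hgU : ∀ᶠ s in 𝓝[≠] (0 : ℂ), g s ∈ discrU k z := by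
    filter_upwards [eventually_notMem_nhdsNE
      (Finset.univ.image fun w => vval z τ w - T l) 0] with s hs
    have hs' : ∀ w, T l + s ≠ vval z τ w := fun w e =>
      hs (Finset.mem_image.2 ⟨w, Finset.mem_univ _, by rw [← e]; ring⟩)
    refine mem_discrU_of_vval_injective fun w w' h => ?_
    by_cases hw : w = .inl i <;> by_cases hw' : w' = .inl i
    · rw [hw, hw']
    · subst hw
      rw [hgval s w' hw'] at h
      exact absurd ((hgi s).symm.trans h) (hs' w')
    · subst hw'
      rw [hgval s w hw] at h
      exact absurd ((hgi s).symm.trans h.symm) (hs' w)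
    · rw [hgval s w hw, hgval s w' hw'] at h
      exact hτinj w w' hw hw' h
  obtain ⟨C, hC⟩ := exists_bound_of_mem_discrOS hη.1 hv a₀ hlv hgc (fun h h1 h2 => by
    rw [hg0, discrFn_eq_vval, sub_ne_zero]
    intro e
    have hne : h.edge.1 ≠ h.edge.2 := by
      cases h with
      | diag i l h => exact fun e => h.ne (Sum.inl_injective e)
      | pt i a => exact Sum.inl_ne_inr
    have hl' : (.inl l : Fin k ⊕ Fin n) ≠ .inl i := fun e => hil (Sum.inl_injective e).symm
    have hil' : vval z τ (.inl i) = vval z τ (.inl l) := hτi.trans (hτu u₀).symm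
    by_cases hw : h.edge.1 = .inl i <;> by_cases hw' : h.edge.2 = .inl i
    · exact hne (hw.trans hw'.symm)
    · refine h1 (Prod.ext hw (hτinj _ _ hl' hw' ?_).symm)
      rw [← hil', ← e, hw]
    · refine h2 (Prod.ext (hτinj _ _ hl' hw ?_).symm hw')
      rw [← hil', e, hw']
    · exact hne (hτinj _ _ hw hw' e))
  set σ := Equiv.swap i l with hσ
  have hσv : Function.update v a₀ l = σ ∘ v := by
    funext a
    by_cases ha : a = a₀
    · subst ha; simp [hσ, hi]
    · rw [Function.update_of_ne ha, Function.comp_apply, hσ,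
        Equiv.swap_apply_of_ne_of_ne (hv.ne ha) (hlv a)]
  -- The positions of the outer vertices after the exchange: `u₀` moves with `t_i`, the others stay.
  -- The function `E` below is `s` times the bounded sum of coefficients, so it tends to `0`; its
  -- termwise limit is twice the residue.
  let P' : ℂ → OuterVertex n v → ℂ := fun s u => if u = u₀ then T l + s else P u
  let E : ℂ → ℂ := fun s => ∑ y, c y *
    ((s * (P u₀ - P (y a₀) + s)⁻¹) * (∏ a ∈ J, (t a - P (y a))⁻¹) -
      (s * (T l - P' s (y a₀))⁻¹) * ∏ a ∈ J, (t a - P' s (y a))⁻¹)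
  have hE : ∀ᶠ s in 𝓝[≠] (0 : ℂ), ‖E s‖ ≤ ‖s‖ * C := by
    filter_upwards [hgU, hC.filter_mono nhdsWithin_le_nhds] with s hs hCs
    refine le_trans (le_of_eq ?_) (mul_le_mul_of_nonneg_left (hCs hs) (norm_nonneg s))
    rw [← norm_mul]
    congr 1
    rw [hσv, coeffFn_comp_of_skew hη, ← hc, hσ, Equiv.Perm.sign_swap hil, ← hσ]
    simp only [Pi.smul_apply, permFn_apply, Finset.sum_apply, Finset.prod_apply, smul_eq_mul,
      Units.val_neg, Units.val_one, Int.cast_neg, Int.cast_one, neg_one_mul, E]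
    rw [← sub_eq_add_neg, ← Finset.sum_sub_distrib, Finset.mul_sum]
    refine Finset.sum_congr rfl fun y _ => ?_
    rw [← mul_sub, mul_left_comm]
    congr 1
    rw [mul_sub s, ← Finset.mul_prod_erase _ _ (Finset.mem_univ a₀),
      ← Finset.mul_prod_erase _ _ (Finset.mem_univ a₀), mul_assoc, mul_assoc]
    have hσl : ∀ m, m ≠ i → m ≠ l → σ m = m := fun m h1 h2 => Equiv.swap_apply_of_ne_of_ne h1 h2
    have hP' : ∀ u : OuterVertex n v, vval z (g s ∘ σ) u.val = P' s u := by
      intro u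
      by_cases hu : u = u₀
      · subst hu
        simp only [P', if_true]
        change g s (σ l) = _
        rw [hσ, Equiv.swap_apply_right, hgi]
      · simp only [P', if_neg hu]
        rw [← hτu, ← hgval s u.val (u.val_ne a₀)]
        rcases u with ⟨m, hm⟩ | b
        · change g s (σ m) = g s m
          rw [hσl m]
          · exact fun e => hm (e ▸ Finset.mem_image_of_mem _ (Finset.mem_univ a₀))
          · rintro rfl
            exact hu rfl
        · rfl
    congr 2
    · congr 1
      · rw [edgeInv, hgval s _ ((y a₀).val_ne a₀), hτu]
        congr 1
        change _ = g s i - _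
        rw [hgi, hPu₀]
        ring
      · refine Finset.prod_congr rfl fun a ha => ?_
        have ha := hJmem.1 ha
        rw [edgeInv, hgval s _ ((y a).val_ne a₀), hτu]
        change _ = (g s (v a) - _)⁻¹
        rw [hgne s _ (hv.ne ha), hτv a ha]
    · congr 1
      · rw [edgeInv, hP']
        change _ = (g s (σ i) - _)⁻¹
        rw [hσ, Equiv.swap_apply_left, hgne s l hil.symm, show τ l = P u₀ from hτu u₀, hPu₀]
      · refine Finset.prod_congr rfl fun a ha => ?_
        have ha := hJmem.1 ha
        rw [edgeInv, hP']
        change _ = (g s (σ (v a)) - _)⁻¹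
        rw [hσl _ (hv.ne ha) (hlv a), hgne s _ (hv.ne ha), hτv a ha]
  have hE0 : Tendsto E (𝓝[≠] 0) (𝓝 0) := by
    refine squeeze_zero_norm' hE ?_
    have : ContinuousAt (fun s : ℂ => ‖s‖ * C) 0 := by fun_prop
    simpa using this.tendsto.mono_left (nhdsWithin_le_nhds (s := {(0 : ℂ)}ᶜ))
  have hlim : Tendsto E (𝓝[≠] 0) (𝓝 (∑ y, c y *
      ((if P u₀ - P (y a₀) = 0 then 1 else 0) * (∏ a ∈ J, (t a - P (y a))⁻¹) -
        (if y a₀ = u₀ then -1 else 0) * ∏ a ∈ J, (t a - P (y a))⁻¹))) := by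
    refine tendsto_finsetSum _ fun y _ => (Tendsto.sub ?_ ?_).const_mul _
    · exact (tendsto_mul_inv_add _).mul_const _
    · refine Tendsto.mul ?_ (tendsto_finsetProd _ fun a ha => ?_)
      · by_cases h : y a₀ = u₀
        · simp only [P', h, if_true]
          refine tendsto_const_nhds.congr' ?_
          filter_upwards [self_mem_nhdsWithin] with s hs
          have hs : s ≠ 0 := hs
          rw [sub_add_cancel_left, inv_neg, mul_neg, mul_inv_cancel₀ hs]
        · simp only [P', h, if_false]
          have : ContinuousAt (fun s : ℂ => s * (T l - P (y a₀))⁻¹) 0 := by fun_prop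
          simpa using this.tendsto.mono_left (nhdsWithin_le_nhds (s := {(0 : ℂ)}ᶜ))
      · have h0 := sub_ne_zero.2 (htP a (hJmem.1 ha) (y a))
        by_cases h : y a = u₀
        · simp only [P', h, if_true]
          have hne : t a - (T l + (0 : ℂ)) ≠ 0 := by rw [add_zero, ← hPu₀, ← h]; exact h0
          have : ContinuousAt (fun s : ℂ => (t a - (T l + s))⁻¹) 0 :=
            (by fun_prop : ContinuousAt (fun s : ℂ => t a - (T l + s)) 0).inv₀ hne
          simpa [hPu₀] using this.tendsto.mono_left (nhdsWithin_le_nhds (s := {(0 : ℂ)}ᶜ))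
        · simp only [P', h, if_false]
          exact tendsto_const_nhds
  have h2 := tendsto_nhds_unique hlim hE0
  have h3 : (2 : ℂ) * ∑ y, (if y a₀ = u₀ then c y else 0) * ∏ a ∈ J, (t a - P (y a))⁻¹ = 0 := by
    rw [Finset.mul_sum]
    refine Eq.trans (Finset.sum_congr rfl fun y _ => ?_) h2
    by_cases h : y a₀ = u₀
    · simp only [h, sub_self, if_true]; ring
    · have : P u₀ - P (y a₀) ≠ 0 := sub_ne_zero.2 (hPinj.ne (Ne.symm h))
      simp only [h, this, if_false]; ring
  exact (mul_eq_zero.1 h3).resolve_left two_ne_zero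

/-- The coefficients of a skew-symmetric form only have poles along the hyperplanes
`t_i = z_a`. -/
theorem exists_point_coeff {k n p : ℕ} {z : Fin n ↪ ℂ} {η : Form (discrU k z) p}
    (hη : η ∈ skewOS k z p) {v : Fin p → Fin k} (hv : Function.Injective v) :
    ∃ c : (Fin p → Fin n) → ℂ,
      coeffFn z v η = ∑ y, c y • ∏ a, edgeInv z (v a) (.inr (y a)) := by
  obtain ⟨c, hc⟩ := exists_outer_coeff hη hv
  refine ⟨fun y => c fun a => .inr (y a), ?_⟩
  rw [← hc]
  symm
  refine Fintype.sum_of_injective (fun (y : Fin p → Fin n) a => (.inr (y a) : OuterVertex n v))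
    (fun y y' h => funext fun a => Sum.inr_injective (congrFun h a)) _ _ ?_ (fun y => rfl)
  intro y hy
  obtain ⟨a, ha⟩ : ∃ a, ∀ b, y a ≠ .inr b := by
    by_contra! h
    choose b hb using h
    exact hy ⟨b, funext fun a => (hb a).symm⟩
  rcases h : y a with u | b
  · rw [outer_coeff_eq_zero hη hv hc h, zero_smul]
  · exact absurd h (ha b)

/-! ### The skew-symmetric part of the Orlik-Solomon space -/

theorem form_ext {k n p : ℕ} {z : Fin n ↪ ℂ} {η η' : Form (discrU k z) p}
    (h : ∀ v : Fin p → Fin k, Function.Injective v → coeffFn z v η = coeffFn z v η') : η = η' := by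
  funext t
  refine Module.Basis.ext_alternating (Pi.basisFun ℂ (Fin k)) fun v hv => ?_
  simp only [Pi.basisFun_apply]
  exact congrFun (h v hv) t

theorem exists_perm_comp_eq {k p : ℕ} {v w : Fin p → Fin k} (hv : Function.Injective v)
    (hw : Function.Injective w) : ∃ σ : Equiv.Perm (Fin k), σ ∘ v = w := by
  classical
  let e := (Equiv.ofInjective v hv).symm.trans (Equiv.ofInjective w hw)
  refine ⟨Equiv.extendSubtype e, funext fun a => ?_⟩
  rw [Function.comp_apply, Equiv.extendSubtype_apply_of_mem e (v a) ⟨a, rfl⟩]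
  have : (Equiv.ofInjective v hv).symm ⟨v a, ⟨a, rfl⟩⟩ = a := Equiv.ofInjective_symm_apply hv a
  change (Equiv.ofInjective w hw ((Equiv.ofInjective v hv).symm ⟨v a, _⟩) : Fin k) = _
  rw [this]
  rfl

/-- The group `S_k` acts transitively on the injective tuples, and skew-symmetry carries one
coefficient to all the others. -/
theorem skewOS_ext {k n p : ℕ} {z : Fin n ↪ ℂ} {η η' : Form (discrU k z) p}
    (hη : η ∈ skewOS k z p) (hη' : η' ∈ skewOS k z p) {v : Fin p → Fin k}
    (hv : Function.Injective v) (h : coeffFn z v η = coeffFn z v η') : η = η' := by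
  refine form_ext fun w hw => ?_
  obtain ⟨σ, rfl⟩ := exists_perm_comp_eq hv hw
  rw [coeffFn_comp_of_skew hη, coeffFn_comp_of_skew hη', h]

theorem skewOS_eq_bot_of_lt {k n p : ℕ} (z : Fin n ↪ ℂ) (h : k < p) : skewOS k z p = ⊥ := by
  rw [eq_bot_iff]
  intro η _
  refine (Submodule.mem_bot ℂ).2 (form_ext fun v hv => absurd (Fintype.card_le_of_injective v hv) ?_)
  simpa using h

theorem permFn_prod_edgeInv_inr {k n p : ℕ} (z : Fin n ↪ ℂ) (σ : Equiv.Perm (Fin k))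
    (v : Fin p → Fin k) (y : Fin p → Fin n) :
    permFn z σ (∏ a, edgeInv z (v a) (.inr (y a))) = ∏ a, edgeInv z (σ (v a)) (.inr (y a)) := by
  rw [permFn_prod]
  exact Finset.prod_congr rfl fun a _ => permFn_edgeInv z σ _ _

/-- Two indices `l`, `l'` are unused by `v`. The coefficient does not involve `t_l` and `t_{l'}`, so
their exchange fixes it, while skew-symmetry makes it change sign. -/
theorem skewOS_eq_bot_of_add_two_le {k n p : ℕ} (z : Fin n ↪ ℂ) (h : p + 2 ≤ k) :
    skewOS k z p = ⊥ := by
  rw [eq_bot_iff]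
  intro η hη
  refine (Submodule.mem_bot ℂ).2 (form_ext fun v hv => ?_)
  obtain ⟨c, hc⟩ := exists_point_coeff hη hv
  obtain ⟨l, hl, l', hl', hne⟩ : ∃ l ∈ (Finset.univ.image v)ᶜ, ∃ l' ∈ (Finset.univ.image v)ᶜ,
      l ≠ l' := by
    rw [← Finset.one_lt_card, Finset.card_compl, Finset.card_image_of_injective _ hv]
    simp only [Fintype.card_fin, Finset.card_univ]
    omega
  simp only [Finset.mem_compl, Finset.mem_image, Finset.mem_univ, true_and, not_exists] at hl hl'
  have hσ : Equiv.swap l l' ∘ v = v :=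
    funext fun a => Equiv.swap_apply_of_ne_of_ne (hl a) (hl' a)
  have h1 := coeffFn_comp_of_skew hη (Equiv.swap l l') v
  have h2 : permFn z (Equiv.swap l l') (coeffFn z v η) = coeffFn z v η := by
    rw [hc]
    simp only [map_sum, map_smul, permFn_prod_edgeInv_inr]
    simp only [show ∀ a, Equiv.swap l l' (v a) = v a from congrFun hσ]
  rw [hσ, h2, Equiv.Perm.sign_swap hne] at h1
  rw [map_zero]
  simpa [eq_neg_iff_add_eq_zero, ← two_smul ℂ] using h1

/-- The form `d log (t_{v 0} - z_{y 0}) ∧ ⋯ ∧ d log (t_{v (p - 1)} - z_{y (p - 1)})`. -/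
def pointForm {k n p : ℕ} (z : Fin n ↪ ℂ) (v : Fin p → Fin k) (y : Fin p → Fin n) :
    Form (discrU k z) p :=
  logForm (discrFn z) fun a => DiscrHyp.pt (v a) (y a)

theorem permForm_pointForm {k n p : ℕ} (z : Fin n ↪ ℂ) (σ : Equiv.Perm (Fin k))
    (v : Fin p → Fin k) (y : Fin p → Fin n) :
    permForm z σ (pointForm z v y) = pointForm z (σ ∘ v) y := by
  funext t
  ext w
  change Matrix.det _ = Matrix.det _
  congr 1

theorem coeffFn_pointForm {k n p : ℕ} (z : Fin n ↪ ℂ) (v w : Fin p → Fin k) (y : Fin p → Fin n)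
    (t : discrU k z) : coeffFn z w (pointForm z v y) t =
      (Matrix.of fun a b => edgeInv z (v b) (.inr (y b)) t * if w a = v b then 1 else 0).det := by
  change Matrix.det _ = _
  congr 1
  ext a b
  change dlog (discrFn z (.pt (v b) (y b))) t.1 (Pi.single (w a) 1) = _
  simp [dlog, discrFn, coordFn, constFn, edgeInv, vval, Pi.single_apply, eq_comm]

theorem permForm_permForm {k n p : ℕ} (z : Fin n ↪ ℂ) (σ τ : Equiv.Perm (Fin k))
    (η : Form (discrU k z) p) : permForm z σ (permForm z τ η) = permForm z (σ * τ) η := rfl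

theorem skew_pointForm_mem {k n p : ℕ} (z : Fin n ↪ ℂ) (v : Fin p → Fin k) (y : Fin p → Fin n) :
    skew z (pointForm z v y) ∈ skewOS k z p := by
  refine ⟨Submodule.sum_mem _ fun σ _ => Submodule.smul_mem _ _ ?_, fun σ => ?_⟩
  · rw [permForm_pointForm]
    exact Submodule.subset_span ⟨_, rfl⟩
  · simp only [skew, map_sum, map_smul, permForm_permForm, Finset.smul_sum, smul_smul]
    refine Finset.sum_equiv (Equiv.mulLeft σ) (by simp) fun τ _ => ?_
    simp only [Equiv.coe_mulLeft, Equiv.Perm.sign_mul, Units.val_mul, Int.cast_mul]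
    rw [← mul_assoc, sign_sq, one_mul]

theorem skew_smul {k n p : ℕ} (z : Fin n ↪ ℂ) (r : ℂ) (η : Form (discrU k z) p) :
    skew z (r • η) = r • skew z η := by
  simp only [skew, map_smul, Finset.smul_sum]
  exact Finset.sum_congr rfl fun σ _ => smul_comm _ _ _

/-- The permutations that fix the indices which are not of the form `v a`. -/
def fixingPerms {k p : ℕ} (v : Fin p → Fin k) : Finset (Equiv.Perm (Fin k)) :=
  Finset.univ.filter fun σ => ∀ i ∉ Finset.univ.image v, σ i = i

theorem mem_fixingPerms {k p : ℕ} {v : Fin p → Fin k} {σ : Equiv.Perm (Fin k)} :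
    σ ∈ fixingPerms v ↔ ∀ i ∉ Finset.univ.image v, σ i = i := by
  simp [fixingPerms]

/-- At most one index lies outside the image of `v`, so a permutation preserving the image fixes it.
-/
theorem mem_fixingPerms_of_mapsTo {k p : ℕ} (hk : k ≤ p + 1) {v : Fin p → Fin k}
    (hv : Function.Injective v) {σ : Equiv.Perm (Fin k)}
    (h : ∀ a, σ (v a) ∈ Finset.univ.image v) : σ ∈ fixingPerms v := by
  rw [mem_fixingPerms]
  intro i hi
  have himg : (Finset.univ.image v).image σ = Finset.univ.image v := by
    refine Finset.eq_of_subset_of_card_le ?_ (Finset.card_image_of_injective _ σ.injective).ge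
    intro j hj
    obtain ⟨l, hl, rfl⟩ := Finset.mem_image.1 hj
    obtain ⟨a, _, rfl⟩ := Finset.mem_image.1 hl
    exact h a
  have hσi : σ i ∉ Finset.univ.image v := by
    rw [← himg]
    intro hj
    obtain ⟨l, hl, hli⟩ := Finset.mem_image.1 hj
    exact hi (σ.injective hli ▸ hl)
  have hcard : (Finset.univ.image v)ᶜ.card ≤ 1 := by
    rw [Finset.card_compl, Finset.card_image_of_injective _ hv]
    simp only [Fintype.card_fin, Finset.card_univ]
    omega
  exact Finset.card_le_one.1 hcard _ (Finset.mem_compl.2 hσi) _ (Finset.mem_compl.2 hi)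

/-- The summand of `σ` has a zero column unless `σ` preserves the image of `v`. Otherwise its matrix
is a permutation matrix times a diagonal one, and the determinant of the former cancels `sign σ`. -/
theorem coeffFn_skew_pointForm {k n p : ℕ} (z : Fin n ↪ ℂ) (hk : k ≤ p + 1) {v : Fin p → Fin k}
    (hv : Function.Injective v) (y : Fin p → Fin n) :
    coeffFn z v (skew z (pointForm z v y)) =
      ∑ σ ∈ fixingPerms v, ∏ a, edgeInv z (σ (v a)) (.inr (y a)) := by
  simp only [skew, map_sum, map_smul, permForm_pointForm]
  rw [← Finset.sum_subset (Finset.subset_univ (fixingPerms v))]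
  · refine Finset.sum_congr rfl fun σ hσ => ?_
    obtain ⟨τ, h1, h2⟩ := exists_perm_of_fixed hv (mem_fixingPerms.1 hσ)
    funext t
    have hm : (Matrix.of fun a b => edgeInv z ((σ ∘ v) b) (.inr (y b)) t *
        if v a = (σ ∘ v) b then 1 else 0) =
        (τ.permMatrix ℂ).transpose * Matrix.diagonal fun b => edgeInv z (σ (v b)) (.inr (y b)) t := by
      ext a b
      rw [Matrix.mul_diagonal, Matrix.transpose_apply, Equiv.Perm.permMatrix,
        PEquiv.toMatrix_apply, h1, mul_comm]
      simp only [Matrix.of_apply, Function.comp_apply, hv.eq_iff, Equiv.toPEquiv_apply,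
        Option.mem_def, Option.some.injEq]
      rw [show v (τ b) = σ (v b) from (congrFun h1 b).symm]
      congr 2
      exact propext eq_comm
    rw [Pi.smul_apply, coeffFn_pointForm, hm, Matrix.det_mul, Matrix.det_transpose,
      Matrix.det_permutation, Matrix.det_diagonal, h2, smul_eq_mul, ← mul_assoc, sign_sq, one_mul,
      Finset.prod_apply]
  · intro σ _ hσ
    obtain ⟨a, ha⟩ : ∃ a, σ (v a) ∉ Finset.univ.image v := by
      by_contra! h
      exact hσ (mem_fixingPerms_of_mapsTo hk hv h)
    funext t
    rw [Pi.smul_apply, coeffFn_pointForm, Matrix.det_eq_zero_of_column_eq_zero a, smul_zero]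
    · rfl
    · intro b
      have : v b ≠ σ (v a) := fun e => ha (e ▸ Finset.mem_image_of_mem _ (Finset.mem_univ b))
      simp [this]

/-- A rearrangement of the labels is absorbed into `σ`, so the coefficient of a skew-symmetrized
product depends only on how often each label occurs. -/
theorem sum_fixingPerms_comp {k n p : ℕ} (z : Fin n ↪ ℂ) (hk : k ≤ p + 1) {v : Fin p → Fin k}
    (hv : Function.Injective v) (y : Fin p → Fin n) (τ : Equiv.Perm (Fin p)) :
    ∑ σ ∈ fixingPerms v, ∏ a, edgeInv z (σ (v a)) (.inr (y (τ a))) =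
      ∑ σ ∈ fixingPerms v, ∏ a, edgeInv z (σ (v a)) (.inr (y a)) := by
  obtain ⟨τ', hτ'⟩ := exists_perm_comp_eq hv (hv.comp τ.injective)
  have hmem : τ' ∈ fixingPerms v := mem_fixingPerms_of_mapsTo hk hv fun a => by
    rw [show τ' (v a) = v (τ a) from congrFun hτ' a]
    exact Finset.mem_image_of_mem _ (Finset.mem_univ _)
  symm
  refine Finset.sum_equiv (Equiv.mulRight τ') (fun σ => ?_) fun σ _ => ?_
  · rw [mem_fixingPerms, mem_fixingPerms]
    refine forall₂_congr fun i hi => ?_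
    simp [mem_fixingPerms.1 hmem i hi]
  · rw [← Equiv.prod_comp τ]
    refine Finset.prod_congr rfl fun a _ => ?_
    rw [← show τ' (v a) = v (τ a) from congrFun hτ' a]
    rfl

/-! ### Spans of the forms `ω_K` -/

/-- The number of indices with a given label. -/
def fiberCard {n p : ℕ} (y : Fin p → Fin n) (i : Fin n) : ℕ :=
  (Finset.univ.filter fun a => y a = i).card

theorem sum_fiberCard {n p : ℕ} (y : Fin p → Fin n) : ∑ i, fiberCard y i = p := by
  have := Finset.card_eq_sum_card_fiberwise (f := y) (s := Finset.univ) (t := Finset.univ)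
    (fun _ _ => Finset.mem_univ _)
  simpa [fiberCard] using this.symm

theorem fiberCard_label {n p : ℕ} (K : Fin n → ℕ) (hK : ∑ i, K i = p) (i : Fin n) :
    fiberCard (label K hK) i = K i := by
  rw [fiberCard, ← Fintype.card_subtype, ← Fintype.card_fin (K i)]
  refine Fintype.card_congr (Equiv.trans ?_ (Equiv.sigmaSubtype (β := fun i => Fin (K i)) i))
  exact ((finCongr hK.symm).trans finSigmaFinEquiv.symm).subtypeEquiv fun a => Iff.rfl

theorem fiberCard_comp {n p : ℕ} (y : Fin p → Fin n) (τ : Equiv.Perm (Fin p)) :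
    fiberCard (y ∘ τ) = fiberCard y := by
  funext i
  rw [fiberCard, fiberCard, ← Fintype.card_subtype, ← Fintype.card_subtype]
  exact Fintype.card_congr (τ.subtypeEquiv fun a => Iff.rfl)

theorem exists_perm_comp_eq_of_fiberCard {n p : ℕ} {y y' : Fin p → Fin n}
    (h : fiberCard y = fiberCard y') : ∃ τ : Equiv.Perm (Fin p), y' ∘ τ = y := by
  let e : ∀ i, {a // y a = i} ≃ {a // y' a = i} := fun i => Fintype.equivOfCardEq (by
    rw [Fintype.card_subtype, Fintype.card_subtype]
    exact congrFun h i)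
  exact ⟨Equiv.ofFiberEquiv e, funext fun a => Equiv.ofFiberEquiv_map e a⟩

/-- The factor with `l = m i + 1` is the only one that can vanish, and it is present exactly when `K
i > m i`. -/
theorem beta_ne_zero_iff {n : ℕ} (m K : Fin n → ℕ) : beta m K ≠ 0 ↔ ∀ i, K i ≤ m i := by
  rw [beta, Finset.prod_ne_zero_iff]
  simp only [Finset.mem_univ, forall_true_left]
  refine forall_congr' fun i => ?_
  rw [mul_ne_zero_iff, Finset.prod_ne_zero_iff]
  have h0 : ((K i).factorial : ℂ) ≠ 0 := Nat.cast_ne_zero.2 (Nat.factorial_ne_zero _)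
  have h1 : ∀ l : ℕ, (m i : ℂ) + 1 - (l : ℂ) ≠ 0 ↔ l ≠ m i + 1 := fun l => by
    rw [sub_ne_zero, ne_comm, ← Nat.cast_add_one, Ne, Nat.cast_inj]
  simp only [h1, Finset.mem_Icc]
  constructor
  · rintro ⟨_, h⟩
    by_contra! hlt
    exact h (m i + 1) ⟨by omega, hlt⟩ rfl
  · exact fun h => ⟨h0, fun l hl => by omega⟩

theorem omegaForm_eq_smul {k n p : ℕ} (z : Fin n ↪ ℂ) {κ : ℂ} (hκ : κ ≠ 0) (hp : p ≤ k)
    (K : Fin n → ℕ) (hK : ∑ i, K i = p) :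
    ∃ r : ℂ, r ≠ 0 ∧
      omegaForm z κ hp K hK = r • skew z (pointForm z (Fin.castLE hp) (label K hK)) := by
  refine ⟨_, ?_, skew_smul z _ _⟩
  refine mul_ne_zero ?_ (inv_ne_zero (mul_ne_zero (pow_ne_zero _ hκ) ?_))
  · split_ifs
    · exact one_ne_zero
    · exact pow_ne_zero _ (neg_ne_zero.2 one_ne_zero)
  · exact Finset.prod_ne_zero_iff.2 fun i _ => Nat.cast_ne_zero.2 (Nat.factorial_ne_zero _)

theorem flagForms_le {k n p : ℕ} {z : Fin n ↪ ℂ} {m : Fin n → ℕ} {κ : ℂ} (hκ : κ ≠ 0)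
    {T : Submodule ℂ (Form (discrU k z) p)}
    (h : ∀ (hp : p ≤ k) (K : Fin n → ℕ) (hK : ∑ i, K i = p), k ≤ p + 1 → (∀ i, K i ≤ m i) →
      skew z (pointForm z (Fin.castLE hp) (label K hK)) ∈ T) : flagForms k z m κ p ≤ T := by
  refine Submodule.span_le.2 ?_
  rintro _ ⟨hp, K, hK, hpk, rfl⟩
  rw [SetLike.mem_coe]
  by_cases hb : beta m K = 0
  · rw [hb, zero_smul]; exact zero_mem _
  obtain ⟨r, -, hr⟩ := omegaForm_eq_smul z hκ hp K hK
  rw [hr]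
  exact Submodule.smul_mem _ _ (Submodule.smul_mem _ _
    (h hp K hK (by omega) ((beta_ne_zero_iff m K).1 hb)))

theorem skew_pointForm_mem_flagForms {k n p : ℕ} {z : Fin n ↪ ℂ} {m : Fin n → ℕ} {κ : ℂ}
    (hκ : κ ≠ 0) (hp : p ≤ k) (hk : k ≤ p + 1) (K : Fin n → ℕ) (hK : ∑ i, K i = p)
    (hKm : ∀ i, K i ≤ m i) :
    skew z (pointForm z (Fin.castLE hp) (label K hK)) ∈ flagForms k z m κ p := by
  obtain ⟨r, hr0, hr⟩ := omegaForm_eq_smul z hκ hp K hK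
  have hb := (beta_ne_zero_iff m K).2 hKm
  have : beta m K • omegaForm z κ hp K hK ∈ flagForms k z m κ p :=
    Submodule.subset_span ⟨hp, K, hK, by omega, rfl⟩
  rw [hr, smul_smul] at this
  exact (Submodule.smul_mem_iff _ (mul_ne_zero hb hr0)).1 this

/-- Averaging the given expansion over `fixingPerms` turns the term of `y` into a multiple of the
coefficient of a skew-symmetrized product whose labels are those of `y` in sorted order. As one
coefficient determines the form, `η` is a combination of these, over the `y` with `c y ≠ 0`. -/
theorem mem_flagForms_of_coeff {k n p : ℕ} {z : Fin n ↪ ℂ} {m : Fin n → ℕ} {κ : ℂ}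
    (hκ : κ ≠ 0) (hp : p ≤ k) (hk : k ≤ p + 1) {η : Form (discrU k z) p}
    (hη : η ∈ skewOS k z p) {c : (Fin p → Fin n) → ℂ}
    (hc : coeffFn z (Fin.castLE hp) η = ∑ y, c y • ∏ a, edgeInv z (Fin.castLE hp a) (.inr (y a)))
    (hcm : ∀ y, c y ≠ 0 → ∀ i, fiberCard y i ≤ m i) : η ∈ flagForms k z m κ p := by
  set v : Fin p → Fin k := Fin.castLE hp with hvdef
  have hv : Function.Injective v := Fin.castLE_injective hp
  set P := fixingPerms v with hP
  have hcard : (P.card : ℂ) ≠ 0 := Nat.cast_ne_zero.2 (Finset.card_ne_zero_of_mem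
    (mem_fixingPerms.2 fun _ _ => rfl : (1 : Equiv.Perm (Fin k)) ∈ P))
  have key : η = (P.card : ℂ)⁻¹ • ∑ y, c y •
      skew z (pointForm z v (label (fiberCard y) (sum_fiberCard y))) := by
    refine skewOS_ext hη (Submodule.smul_mem _ _ (Submodule.sum_mem _ fun y _ =>
      Submodule.smul_mem _ _ (skew_pointForm_mem z _ _))) hv ?_
    have hsum : (P.card : ℂ) • coeffFn z v η = ∑ σ ∈ P, permFn z σ (coeffFn z v η) := by
      rw [Nat.cast_smul_eq_nsmul ℂ, ← Finset.sum_const]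
      refine Finset.sum_congr rfl fun σ hσ => ?_
      obtain ⟨τ, h1, h2⟩ := exists_perm_of_fixed hv (mem_fixingPerms.1 hσ)
      rw [permFn_coeffFn_of_skew hη, h1, coeffFn_comp_perm, h2, smul_smul, sign_sq, one_smul]
    rw [map_smul, eq_inv_smul_iff₀ hcard, hsum, hc]
    simp only [map_sum, map_smul, permFn_prod_edgeInv_inr, coeffFn_skew_pointForm z hk hv]
    rw [Finset.sum_comm]
    refine Finset.sum_congr rfl fun y _ => ?_
    rw [← Finset.smul_sum]
    congr 1
    obtain ⟨τ, hτ⟩ := exists_perm_comp_eq_of_fiberCard (y := y)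
      (y' := label (fiberCard y) (sum_fiberCard y)) (funext fun i => (fiberCard_label _ _ i).symm)
    rw [← sum_fixingPerms_comp z hk hv (label (fiberCard y) (sum_fiberCard y)) τ]
    simp only [show ∀ a, label (fiberCard y) (sum_fiberCard y) (τ a) = y a from congrFun hτ]
    rfl
  rw [key]
  refine Submodule.smul_mem _ _ (Submodule.sum_mem _ fun y _ => ?_)
  by_cases hy : c y = 0
  · rw [hy, zero_smul]; exact zero_mem _
  · exact Submodule.smul_mem _ _ (skew_pointForm_mem_flagForms hκ hp hk _ _ (hcm y hy))

/-- Every permutation that contributes only rearranges the labels of `y₀`, and passing from `v` to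
`w` costs only a sign. -/
theorem exists_coeff_skew_pointForm {k n p : ℕ} (z : Fin n ↪ ℂ) (hk : k ≤ p + 1)
    {v w : Fin p → Fin k} (hv : Function.Injective v) (hw : Function.Injective w)
    (y₀ : Fin p → Fin n) :
    ∃ c : (Fin p → Fin n) → ℂ, (∀ y, c y ≠ 0 → fiberCard y = fiberCard y₀) ∧
      coeffFn z w (skew z (pointForm z v y₀)) =
        ∑ y, c y • ∏ a, edgeInv z (w a) (.inr (y a)) := by
  obtain ⟨ρ, rfl⟩ := exists_perm_comp_eq hv hw
  have hex : ∀ σ : Equiv.Perm (Fin k), ∃ τ : Equiv.Perm (Fin p), σ ∈ fixingPerms v →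
      σ ∘ v = v ∘ τ := fun σ => by
    by_cases hσ : σ ∈ fixingPerms v
    · obtain ⟨τ, h, -⟩ := exists_perm_of_fixed hv (mem_fixingPerms.1 hσ)
      exact ⟨τ, fun _ => h⟩
    · exact ⟨1, fun h => absurd h hσ⟩
  choose τ hτ using hex
  refine ⟨fun y => (((Equiv.Perm.sign ρ : ℤˣ) : ℤ) : ℂ) *
    ∑ σ ∈ fixingPerms v, if y = y₀ ∘ ⇑(τ σ).symm then 1 else 0, fun y hy => ?_, ?_⟩
  · obtain ⟨σ, _, hσ⟩ := Finset.exists_ne_zero_of_sum_ne_zero (right_ne_zero_of_mul hy)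
    rw [of_not_not fun h => hσ (if_neg h)]
    exact fiberCard_comp _ _
  · rw [coeffFn_comp_of_skew (skew_pointForm_mem z v y₀), coeffFn_skew_pointForm z hk hv]
    simp only [mul_smul, ← Finset.smul_sum, Finset.sum_smul, map_sum]
    congr 1
    rw [Finset.sum_comm]
    refine Finset.sum_congr rfl fun σ hσ => ?_
    simp only [ite_smul, one_smul, zero_smul, Finset.sum_ite_eq', Finset.mem_univ,
      if_true]
    rw [permFn_prod, ← Equiv.prod_comp (τ σ).symm]
    refine Finset.prod_congr rfl fun a _ => ?_
    rw [permFn_edgeInv, show σ (v ((τ σ).symm a)) = v (τ σ ((τ σ).symm a)) from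
      congrFun (hτ σ hσ) _, Equiv.apply_symm_apply]
    rfl

/-! ### Values of the residues at coordinate vectors -/

/-- The limit of `1 / (t_i - z_w)`, multiplied with `s` if `i ∈ I`, at the stratum `C_I`. -/
def stratumInv {k n : ℕ} (z : Fin n ↪ ℂ) (I : Finset (Fin k)) (b : Fin k) (j : Fin n)
    (x : {i : Fin k // i ≠ b} → ℂ) (i : Fin k) (w : Fin n) : ℂ :=
  if i ∈ I then if w = j then (hom b x i)⁻¹ else 0 else (hom b x i - z w)⁻¹

/-- For `i ∈ I` one has `t_i - z_j = s u_i`, whose pole the factor `s` cancels; for `w ≠ j` the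
difference tends to `z_j - z_w ≠ 0`, and the factor `s` makes the limit zero. -/
theorem tendsto_stratumInv {k n : ℕ} (z : Fin n ↪ ℂ) {I : Finset (Fin k)} {b : Fin k}
    (hb : b ∈ I) (j : Fin n) {x : {i : Fin k // i ≠ b} → ℂ} (hx : x ∈ stratum z I b) (i : Fin k)
    (w : Fin n) :
    Tendsto (fun s : ℂ => (if i ∈ I then s else 1) * (blowDown I b (z j) (x, s) i - z w)⁻¹)
      (𝓝[≠] 0) (𝓝 (stratumInv z I b j x i w)) := by
  by_cases hi : i ∈ I
  · simp only [hi, if_true, stratumInv, blowDown]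
    have h0 := ((mem_stratum_iff z hb x).1 hx).1 i hi
    split_ifs with hw
    · subst hw
      refine tendsto_const_nhds.congr' ?_
      filter_upwards [self_mem_nhdsWithin] with s hs
      have hs : s ≠ 0 := hs
      rw [add_sub_cancel_left]
      field_simp
    · have hne : z j + (0 : ℂ) * hom b x i - z w ≠ 0 := by
        rw [zero_mul, add_zero, sub_ne_zero]
        exact z.injective.ne (Ne.symm hw)
      have : ContinuousAt (fun s : ℂ => s * (z j + s * hom b x i - z w)⁻¹) 0 :=
        continuousAt_id.mul
          ((by fun_prop : ContinuousAt (fun s : ℂ => z j + s * hom b x i - z w) 0).inv₀ hne)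
      simpa using this.tendsto.mono_left (nhdsWithin_le_nhds (s := {(0 : ℂ)}ᶜ))
  · simp only [hi, if_false, stratumInv, blowDown, one_mul]
    exact tendsto_const_nhds

theorem fderiv_blowDown_normal {k : ℕ} (I : Finset (Fin k)) (b : Fin k) (c s : ℂ)
    (x : {i : Fin k // i ≠ b} → ℂ) :
    fderiv ℂ (blowDown I b c) (x, s) (0, 1) = ∑ i ∈ I, hom b x i • (Pi.single i 1 : Fin k → ℂ) := by
  funext l
  rw [fderiv_blowDown, Finset.sum_apply]
  simp [Pi.single_apply]

theorem fderiv_blowDown_single {k : ℕ} (I : Finset (Fin k)) (b : Fin k) (c s : ℂ)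
    (x : {i : Fin k // i ≠ b} → ℂ) (i : {i : Fin k // i ≠ b}) :
    fderiv ℂ (blowDown I b c) (x, s) (Pi.single i 1, 0) =
      (if i.1 ∈ I then s else 1) • (Pi.single i.1 1 : Fin k → ℂ) := by
  have h : ∀ l, homD b l (Pi.single i 1) = (Pi.single i.1 1 : Fin k → ℂ) l := by
    intro l
    by_cases hl : l = b
    · subst hl
      rw [homD_self, Pi.single_eq_of_ne i.2.symm]
      rfl
    · rw [homD_ne _ hl, Pi.single_apply, Pi.single_apply]
      congr 1
      exact propext Subtype.ext_iff
  funext l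
  rw [fderiv_blowDown, h, Pi.smul_apply, smul_eq_mul]
  by_cases hl : l = i.1
  · subst hl
    split_ifs <;> simp
  · rw [Pi.single_eq_of_ne hl]
    simp

theorem alternatingMap_sum_apply {E α : Type} [AddCommGroup E] [Module ℂ E] {q : ℕ}
    (S : Finset α) (f : α → E [⋀^Fin q]→ₗ[ℂ] ℂ) (v : Fin q → E) :
    (∑ i ∈ S, f i) v = ∑ i ∈ S, f i v := by
  classical
  induction S using Finset.induction_on with
  | empty => simp
  | insert a S ha ih => rw [Finset.sum_insert ha, Finset.sum_insert ha, AlternatingMap.add_apply, ih]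

theorem apply_cons_sum_smul {k q : ℕ} (f : (Fin k → ℂ) [⋀^Fin (q + 1)]→ₗ[ℂ] ℂ)
    (I : Finset (Fin k)) (u : Fin k → ℂ) (r : Fin q → Fin k) (a : Fin q → ℂ) :
    f (Fin.cons (∑ i ∈ I, u i • (Pi.single i 1 : Fin k → ℂ))
        fun b => a b • (Pi.single (r b) 1 : Fin k → ℂ)) =
      ∑ i ∈ I with ∀ b, r b ≠ i, u i * ((∏ b, a b) *
        f fun b => Pi.single ((Fin.cons i r : Fin (q + 1) → Fin k) b) 1) := by
  have h1 : ∀ w : Fin k → ℂ, f (Fin.cons w fun b => a b • (Pi.single (r b) 1 : Fin k → ℂ)) =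
      (∏ b, a b) * f.curryLeft w fun b => Pi.single (r b) 1 := fun w => by
    rw [← smul_eq_mul]
    exact (f.curryLeft w).toMultilinearMap.map_smul_univ a fun b => Pi.single (r b) 1
  have h2 : ∀ i, f.curryLeft (Pi.single i 1) (fun b => Pi.single (r b) 1) =
      f fun b => Pi.single ((Fin.cons i r : Fin (q + 1) → Fin k) b) 1 := fun i => by
    rw [AlternatingMap.curryLeft_apply_apply]
    congr 1
    funext b
    refine Fin.cases ?_ (fun b => ?_) b <;> simp [Matrix.vecCons]
  rw [h1, map_sum, alternatingMap_sum_apply, Finset.mul_sum, Finset.sum_filter]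
  refine Finset.sum_congr rfl fun i _ => ?_
  rw [map_smul, AlternatingMap.smul_apply, h2, smul_eq_mul]
  split_ifs with h
  · ring
  · push Not at h
    obtain ⟨b, hb⟩ := h
    rw [f.map_eq_zero_of_eq (i := 0) (j := b.succ) _ (by simp [hb]) (Fin.succ_ne_zero b).symm]
    ring

/-- In the original coordinates `∂_s` is `∑ u_i ∂_{t_i}` over `i ∈ I`, and `∂_{u_i}` is `s ∂_{t_i}`.
Thus every argument with index in `I` brings one factor `s`, to be paired with the fraction of the
same index, and the limit can be taken term by term. -/
theorem residue_single {k n q : ℕ} {z : Fin n ↪ ℂ} {I : Finset (Fin k)} {b : Fin k}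
    (hb : b ∈ I) {j : Fin n} {η : Form (discrU k z) (q + 1)} {ρ : Form (stratum z I b) q}
    (hρ : HasResidue z I b (z j) η ρ) (r : Fin q → {i : Fin k // i ≠ b})
    (d : Fin k → (Fin (q + 1) → Fin n) → ℂ)
    (hd : ∀ i ∈ I, (∀ a, (r a).1 ≠ i) → coeffFn z (Fin.cons i fun a => (r a).1) η =
      ∑ y, d i y • ∏ a, edgeInv z ((Fin.cons i fun a => (r a).1 : Fin (q + 1) → Fin k) a)
        (.inr (y a)))
    (x : stratum z I b) :
    ρ x (fun a => Pi.single (r a) 1) = ∑ i ∈ I with ∀ a, (r a).1 ≠ i, ∑ y, d i y *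
      ((if y 0 = j then 1 else 0) * ∏ a, stratumInv z I b j x.1 (r a).1 (y a.succ)) := by
  refine tendsto_nhds_unique (hρ x _) ?_
  have hlim : Tendsto (fun s : ℂ => ∑ i ∈ I with ∀ a, (r a).1 ≠ i, ∑ y, d i y *
      ((hom b x.1 i * ((if i ∈ I then s else 1) * (blowDown I b (z j) (x.1, s) i - z (y 0))⁻¹)) *
        ∏ a, ((if (r a).1 ∈ I then s else 1) *
          (blowDown I b (z j) (x.1, s) (r a).1 - z (y a.succ))⁻¹))) (𝓝[≠] 0)
      (𝓝 (∑ i ∈ I with ∀ a, (r a).1 ≠ i, ∑ y, d i y *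
        ((hom b x.1 i * stratumInv z I b j x.1 i (y 0)) *
          ∏ a, stratumInv z I b j x.1 (r a).1 (y a.succ)))) :=
    tendsto_finsetSum _ fun i _ => tendsto_finsetSum _ fun y _ => Tendsto.const_mul _
      (((tendsto_stratumInv z hb j x.2 _ _).const_mul _).mul
        (tendsto_finsetProd _ fun a _ => tendsto_stratumInv z hb j x.2 _ _))
  -- The weight `u_i` of `∂_{t_i}` cancels the limit `1/u_i` of the fraction with index `i`, so the
  -- summand depends on `i` only through `d i`.
  have hval : ∑ i ∈ I with ∀ a, (r a).1 ≠ i, ∑ y, d i y *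
        ((hom b x.1 i * stratumInv z I b j x.1 i (y 0)) *
          ∏ a, stratumInv z I b j x.1 (r a).1 (y a.succ)) =
      ∑ i ∈ I with ∀ a, (r a).1 ≠ i, ∑ y, d i y *
        ((if y 0 = j then 1 else 0) * ∏ a, stratumInv z I b j x.1 (r a).1 (y a.succ)) := by
    refine Finset.sum_congr rfl fun i hi => Finset.sum_congr rfl fun y _ => ?_
    have hiI := (Finset.mem_filter.1 hi).1
    have h0 := ((mem_stratum_iff z hb x.1).1 x.2).1 i hiI
    rw [stratumInv, if_pos hiI, mul_ite, mul_inv_cancel₀ h0, mul_zero]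
  rw [← hval]
  refine hlim.congr' ?_
  filter_upwards [eventually_mem_discrU z hb j x.2] with s hs
  rw [extendZero_of_mem _ hs, fderiv_blowDown_normal]
  simp only [fderiv_blowDown_single]
  rw [apply_cons_sum_smul _ _ _ (fun a => (r a).1), Finset.mul_sum]
  refine Finset.sum_congr rfl fun i hi => ?_
  obtain ⟨hiI, hir⟩ := Finset.mem_filter.1 hi
  rw [← coeffFn_apply, hd i hiI hir, Finset.sum_apply]
  simp only [Finset.mul_sum, Pi.smul_apply, Finset.prod_apply, smul_eq_mul, if_pos hiI]
  refine Finset.sum_congr rfl fun y _ => ?_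
  rw [Fin.prod_univ_succ, Finset.prod_mul_distrib]
  simp only [edgeInv, vval, Fin.cons_zero, Fin.cons_succ, Sum.elim_inr]
  ring

/-! ### Residues of skew-symmetric forms -/

theorem cons_injective_of_base {k q : ℕ} {i b : Fin k} {r : Fin q → {i : Fin k // i ≠ b}}
    (hr : Function.Injective r) (hi : ∀ a, (r a).1 ≠ i) :
    Function.Injective (Fin.cons i fun a => (r a).1 : Fin (q + 1) → Fin k) :=
  Fin.cons_injective_iff.2 ⟨fun ⟨a, ha⟩ => hi a ha, Subtype.val_injective.comp hr⟩

/-- The residue along `C_I` of a skew-symmetric form whose coefficients are sums over labels that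
take the value `j` at most `|I| - 1` times. -/
theorem hasResidue_zero_of_coeff {k n q : ℕ} {z : Fin n ↪ ℂ} {I : Finset (Fin k)} {b : Fin k}
    (hb : b ∈ I) {j : Fin n} (hk : k ≤ q + 2) {η : Form (discrU k z) (q + 1)}
    (hη : η ∈ skewOS k z (q + 1))
    (hc : ∀ v : Fin (q + 1) → Fin k, Function.Injective v → ∃ c : (Fin (q + 1) → Fin n) → ℂ,
      (∀ y, c y ≠ 0 → fiberCard y j < I.card) ∧
        coeffFn z v η = ∑ y, c y • ∏ a, edgeInv z (v a) (.inr (y a))) :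
    HasResidue z I b (z j) η 0 := by
  obtain ⟨ρ, -, hρ⟩ := exists_residue z hb j hη.1
  suffices ρ = 0 by rwa [← this]
  funext x
  refine Module.Basis.ext_alternating (Pi.basisFun ℂ _) fun r hr => ?_
  simp only [Pi.basisFun_apply, Pi.zero_apply, AlternatingMap.zero_apply]
  have hrb : ∀ a, (r a).1 ≠ b := fun a => (r a).2
  obtain ⟨c, hcI, hcv⟩ := hc _ (cons_injective_of_base hr hrb)
  have hswap : ∀ i, (∀ a, (r a).1 ≠ i) → i ≠ b →
      (Fin.cons i fun a => (r a).1 : Fin (q + 1) → Fin k) =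
        Equiv.swap b i ∘ (Fin.cons b fun a => (r a).1 : Fin (q + 1) → Fin k) := by
    intro i hi _
    funext a
    refine Fin.cases ?_ (fun a => ?_) a
    · simp
    · simp [Equiv.swap_apply_of_ne_of_ne (hrb a) (hi a)]
  -- Exchanging `b` and `i` carries the coefficient at `(b, r)` to minus the one at `(i, r)`, hence
  -- `-c` for `i ≠ b`.
  rw [residue_single hb hρ r (fun i => if i = b then c else -c) (fun i hi hir => ?_) x]
  · have hcard : (Finset.univ.image fun a => (r a).1)ᶜ.card ≤ 2 := by
      have := Finset.card_image_of_injective Finset.univ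
        (show Function.Injective fun a => (r a).1 from Subtype.val_injective.comp hr)
      rw [Finset.card_compl, this]
      simp only [Fintype.card_fin, Finset.card_univ]
      omega
    have hsub : I.filter (fun i => ∀ a, (r a).1 ≠ i) ⊆ (Finset.univ.image fun a => (r a).1)ᶜ := by
      intro i hi
      simpa using (Finset.mem_filter.1 hi).2
    -- Besides `b`, at most one index of `I` is missing from `r`. If there is one, its term cancels
    -- the term of `b`. If there is none, `I` is covered by `b` and `r`, and a surviving `y` would
    -- take the value `j` at least `|I|` times.
    by_cases hI : ∃ i ∈ I, (∀ a, (r a).1 ≠ i) ∧ i ≠ b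
    · obtain ⟨i, hiI, hir, hib⟩ := hI
      have hpair : I.filter (fun i => ∀ a, (r a).1 ≠ i) = {b, i} := by
        symm
        refine Finset.eq_of_subset_of_card_le ?_ ?_
        · intro l hl
          rcases Finset.mem_insert.1 hl with rfl | hl
          · exact Finset.mem_filter.2 ⟨hb, hrb⟩
          · rw [Finset.mem_singleton.1 hl]
            exact Finset.mem_filter.2 ⟨hiI, hir⟩
        · rw [Finset.card_pair hib.symm]
          exact (Finset.card_le_card hsub).trans hcard
      rw [hpair, Finset.sum_pair hib.symm, if_pos rfl, if_neg hib, ← Finset.sum_add_distrib]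
      exact Finset.sum_eq_zero fun y _ => by rw [Pi.neg_apply]; ring
    · push Not at hI
      refine Finset.sum_eq_zero fun i hi => Finset.sum_eq_zero fun y _ => ?_
      obtain ⟨hiI, hir⟩ := Finset.mem_filter.1 hi
      rw [hI i hiI hir, if_pos rfl]
      by_cases hcy : c y = 0
      · rw [hcy, zero_mul]
      by_contra hne
      have hne := right_ne_zero_of_mul hne
      have hy0 : y 0 = j := of_not_not fun h => left_ne_zero_of_mul hne (if_neg h)
      have hya : ∀ a, (r a).1 ∈ I → y a.succ = j := fun a ha => by
        have := Finset.prod_ne_zero_iff.1 (right_ne_zero_of_mul hne) a (Finset.mem_univ a)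
        rw [stratumInv, if_pos ha] at this
        exact of_not_not fun h => this (if_neg h)
      refine absurd (hcI y hcy) (not_lt.2 ?_)
      let v : Fin (q + 1) → Fin k := Fin.cons b fun a => (r a).1
      have hIsub : I ⊆ (Finset.univ.filter fun a => y a = j).image v := by
        intro i hiI
        by_cases hib : i = b
        · exact Finset.mem_image.2 ⟨0, by simp [hy0], hib.symm⟩
        · have : ∃ a, (r a).1 = i := by
            by_contra! h
            exact hib (hI i hiI h)
          obtain ⟨a, rfl⟩ := this
          exact Finset.mem_image.2 ⟨a.succ, by simp [hya a hiI], rfl⟩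
      exact (Finset.card_le_card hIsub).trans Finset.card_image_le
  · split_ifs with hib
    · rw [hib]; exact hcv
    · rw [hswap i hir hib, coeffFn_comp_of_skew hη, hcv, Equiv.Perm.sign_swap (Ne.symm hib)]
      simp only [map_sum, map_smul, permFn_prod_edgeInv_inr, Units.val_neg, Units.val_one,
        Int.cast_neg, Int.cast_one, neg_smul, one_smul, Pi.neg_apply, Finset.sum_neg_distrib]
      rfl

/-- Since `I` lies in the image of `v`, evaluating at the vectors with indices `v 1, …, v q` leaves
only the term of `v 0`. The labels that survive are `j` on `I`, and their sum is a nonzero constant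
times a combination of simple fractions in the variables outside `I`, to which independence applies.
-/
theorem coeff_eq_zero_of_hasResidue {k n q : ℕ} {z : Fin n ↪ ℂ} {η : Form (discrU k z) (q + 1)}
    {j : Fin n} {v : Fin (q + 1) → Fin k} (hv : Function.Injective v) {I : Finset (Fin k)}
    (hI : v 0 ∈ I) (hIv : I ⊆ Finset.univ.image v) (hres : HasResidue z I (v 0) (z j) η 0)
    {c : (Fin (q + 1) → Fin n) → ℂ}
    (hc : coeffFn z v η = ∑ y, c y • ∏ a, edgeInv z (v a) (.inr (y a)))
    {y₀ : Fin (q + 1) → Fin n} (hy₀ : ∀ a, v a ∈ I → y₀ a = j) : c y₀ = 0 := by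
  classical
  set b := v 0 with hb
  have hne : ∀ a : Fin q, v a.succ ≠ b := fun a e => Fin.succ_ne_zero a (hv e)
  let r : Fin q → {i : Fin k // i ≠ b} := fun a => ⟨v a.succ, hne a⟩
  have hvr : (Fin.cons b fun a => (r a).1 : Fin (q + 1) → Fin k) = v := Fin.cons_self_tail v
  have hfilter : I.filter (fun i => ∀ a, (r a).1 ≠ i) = {b} := by
    ext i
    rw [Finset.mem_filter, Finset.mem_singleton]
    constructor
    · rintro ⟨hiI, hir⟩
      obtain ⟨a, -, rfl⟩ := Finset.mem_image.1 (hIv hiI)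
      revert hir
      exact Fin.cases (fun _ => rfl) (fun a hir => absurd rfl (hir a)) a
    · rintro rfl
      exact ⟨hI, hne⟩
  have hsum : ∀ x : stratum z I b, ∑ y, c y *
      ((if y 0 = j then 1 else 0) * ∏ a, stratumInv z I b j x.1 (r a).1 (y a.succ)) = 0 := by
    intro x
    have := residue_single hI hres r (fun _ => c) (fun i hiI hir => by
      have hib : i ∈ ({b} : Finset (Fin k)) := hfilter ▸ Finset.mem_filter.2 ⟨hiI, hir⟩
      rw [Finset.mem_singleton.1 hib, hvr]
      exact hc) x
    rw [hfilter, Finset.sum_singleton] at this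
    exact this.symm
  obtain ⟨T, hT⟩ := discrU_nonempty k z
  set J : Finset (Fin (q + 1)) := Finset.univ.filter fun a => v a ∉ I with hJ
  have hJmem : ∀ {a}, a ∈ J ↔ v a ∉ I := by simp [hJ]
  have key := sum_coeff_eq_zero z.injective (Finset.univ.image (vval z T)) J
    (fun y => if ∀ a, v a ∈ I → y a = j then c y else 0) (fun t ht htB => ?_) y₀
  · rw [Finset.sum_eq_single y₀] at key
    · simpa [if_pos hy₀] using key
    · intro y _ hy
      by_cases h : ∀ a ∈ J, y a = y₀ a
      · rw [if_pos h, if_neg]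
        refine fun h' => hy (funext fun a => ?_)
        by_cases ha : v a ∈ I
        · rw [h' a ha, hy₀ a ha]
        · exact h a (hJmem.2 ha)
      · rw [if_neg h]
    · intro h; exact absurd (Finset.mem_univ _) h
  -- A point of the stratum is built whose coordinates outside `I` are the prescribed `t` on the
  -- image of `v` and generic values `T` elsewhere.
  set τ : Fin k → ℂ := Function.extend v t T with hτ
  have hτv : ∀ a, τ (v a) = t a := fun a => hv.extend_apply _ _ _
  have hτT : ∀ i, (∀ a, v a ≠ i) → τ i = T i := fun i hi =>
    Function.extend_apply' _ _ _ fun ⟨a, ha⟩ => hi a ha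
  -- Homogeneous coordinates on `I`: distinct nonzero numbers, normalized to `1` at `b`.
  let u : Fin k → ℂ := fun i => ((if i = b then 0 else (i : ℕ) + 1 : ℕ) : ℂ) + 1
  have hu : Function.Injective u := by
    intro i l h
    have h : (if i = b then 0 else (i : ℕ) + 1 : ℕ) = if l = b then 0 else (l : ℕ) + 1 := by
      exact_mod_cast add_right_cancel h
    split_ifs at h with h1 h2
    · rw [h1, h2]
    · exact Fin.ext (Nat.succ_injective h)
  have hu0 : ∀ i, u i ≠ 0 := fun i => Nat.cast_add_one_ne_zero _
  let x : {i : Fin k // i ≠ b} → ℂ := fun i => if i.1 ∈ I then u i else τ i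
  have hxI : ∀ i ∈ I, hom b x i = u i := by
    intro i hi
    by_cases hib : i = b
    · subst hib
      simp [hom_self, u]
    · rw [hom_ne x hib]
      exact if_pos hi
  have hxO : ∀ i, i ∉ I → hom b x i = τ i := by
    intro i hi
    rw [hom_ne x (show i ≠ b from fun e => hi (e ▸ hI))]
    exact if_neg hi
  have hTinj := vval_injective hT
  have hτinj : ∀ i, i ∉ I → ∀ l, l ∉ I → i ≠ l → τ i ≠ τ l := by
    intro i hi l hl hil e
    by_cases h1 : ∃ a, v a = i <;> by_cases h2 : ∃ a, v a = l
    · obtain ⟨a, rfl⟩ := h1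
      obtain ⟨a', rfl⟩ := h2
      rw [hτv, hτv] at e
      exact hil (congrArg v (ht (hJmem.2 hi) (hJmem.2 hl) e))
    · obtain ⟨a, rfl⟩ := h1
      push Not at h2
      rw [hτv, hτT l h2] at e
      exact htB a (hJmem.2 hi) (Finset.mem_image.2 ⟨.inl l, Finset.mem_univ _, e.symm⟩)
    · obtain ⟨a, rfl⟩ := h2
      push Not at h1
      rw [hτv, hτT i h1] at e
      exact htB a (hJmem.2 hl) (Finset.mem_image.2 ⟨.inl i, Finset.mem_univ _, e⟩)
    · push Not at h1 h2
      rw [hτT i h1, hτT l h2] at e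
      exact hil (Sum.inl_injective (hTinj (a₁ := .inl i) (a₂ := .inl l) e))
  have hτz : ∀ i, i ∉ I → ∀ a, τ i ≠ z a := by
    intro i hi a e
    by_cases h1 : ∃ a, v a = i
    · obtain ⟨a', rfl⟩ := h1
      rw [hτv] at e
      exact htB a' (hJmem.2 hi) (Finset.mem_image.2 ⟨.inr a, Finset.mem_univ _, e.symm⟩)
    · push Not at h1
      rw [hτT i h1] at e
      exact Sum.inl_ne_inr (hTinj (a₁ := .inl i) (a₂ := .inr a) e)
  have hx : x ∈ stratum z I b := by
    refine (mem_stratum_iff z hI x).2 ⟨fun i hi => ?_, fun i hi l hl hil => ?_,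
      fun i hi l hl hil => ?_, fun i hi a => ?_⟩
    · rw [hxI i hi]; exact hu0 i
    · rw [hxI i hi, hxI l hl]; exact hu.ne hil
    · rw [hxO i hi, hxO l hl]; exact hτinj i hi l hl hil
    · rw [hxO i hi]; exact hτz i hi a
  set C : ℂ := ∏ a : Fin q, if v a.succ ∈ I then (u (v a.succ))⁻¹ else 1 with hC
  have hC0 : C ≠ 0 := Finset.prod_ne_zero_iff.2 fun a _ => by
    split_ifs
    · exact inv_ne_zero (hu0 _)
    · exact one_ne_zero
  refine (mul_eq_zero.1 (Eq.trans ?_ (hsum ⟨x, hx⟩))).resolve_left hC0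
  rw [Finset.mul_sum]
  refine Finset.sum_congr rfl fun y _ => ?_
  have hprodJ : ∏ a ∈ J, (t a - z (y a))⁻¹ =
      ∏ a : Fin q, if v a.succ ∈ I then 1 else (t a.succ - z (y a.succ))⁻¹ := by
    rw [hJ, Finset.prod_filter, Fin.prod_univ_succ, if_neg (not_not.2 hI), one_mul]
    exact Finset.prod_congr rfl fun a _ => by split_ifs <;> simp_all
  by_cases hy : ∀ a, v a ∈ I → y a = j
  · rw [if_pos hy, if_pos (hy 0 hI), one_mul, hprodJ, mul_left_comm, hC,
      ← Finset.prod_mul_distrib]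
    congr 1
    refine Finset.prod_congr rfl fun a _ => ?_
    by_cases ha : v a.succ ∈ I
    · rw [if_pos ha, if_pos ha, mul_one, stratumInv, if_pos ha, if_pos (hy _ ha), hxI _ ha]
    · rw [if_neg ha, if_neg ha, one_mul, stratumInv, if_neg ha, hxO _ ha, hτv]
  · rw [if_neg hy, zero_mul, mul_zero]
    push Not at hy
    obtain ⟨a, ha, hya⟩ := hy
    symm
    refine mul_eq_zero_of_right _ ?_
    revert ha hya
    refine Fin.cases (fun _ h => ?_) (fun a ha hya => ?_) a
    · rw [if_neg h, zero_mul]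
    · refine mul_eq_zero_of_right _ (Finset.prod_eq_zero (Finset.mem_univ a) ?_)
      rw [stratumInv, if_pos ha, if_neg hya]

/-! ### The kernel of the residue map -/

theorem residueMap_eq_zero_iff {k n q : ℕ} (z : Fin n ↪ ℂ) (m : Fin n → ℕ) (n₀ : ℕ)
    (η : skewOS k z (q + 1)) :
    residueMap k z m n₀ q η = 0 ↔ ∀ j : Fin n, (j : ℕ) < n₀ → ∀ I : Edge k (m j),
      HasResidue z I.1 I.base (z j) η.1 0 := by
  constructor
  · intro h j hj I
    have h1 : residueAt k z (m j) j q η = 0 := congrFun h ⟨j, hj⟩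
    have h2 := residueAt_spec z (m j) j q η I
    rw [h1] at h2
    exact h2
  · intro h
    funext j
    refine Subtype.ext (funext fun I => ?_)
    exact (residueAt_spec z (m j) j q η I).unique (h j j.2 I)

theorem skew_pointForm_hasResidue_zero {k n q : ℕ} (z : Fin n ↪ ℂ) (hp : q + 1 ≤ k)
    (hk : k ≤ q + 2) (K : Fin n → ℕ) (hK : ∑ i, K i = q + 1) (j : Fin n) {r : ℕ} (hr : K j ≤ r)
    (I : Edge k r) :
    HasResidue z I.1 I.base (z j) (skew z (pointForm z (Fin.castLE hp) (label K hK))) 0 := by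
  refine hasResidue_zero_of_coeff I.base_mem hk (skew_pointForm_mem z _ _) fun v hv => ?_
  obtain ⟨c, h1, h2⟩ := exists_coeff_skew_pointForm z hk (Fin.castLE_injective hp) hv (label K hK)
  refine ⟨c, fun y hy => ?_, h2⟩
  rw [h1 y hy, fiberCard_label, I.2]
  omega

/-- If `y` takes the value `j` more than `r` times, `r + 1` of these positions give an edge `I`
inside the image of `v` with all labels equal to `j`. -/
theorem coeff_eq_zero_of_residues {k n q r : ℕ} {z : Fin n ↪ ℂ} {η : Form (discrU k z) (q + 1)}
    {j : Fin n} (hres : ∀ I : Edge k r, HasResidue z I.1 I.base (z j) η 0)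
    {v : Fin (q + 1) → Fin k} (hv : Function.Injective v) {c : (Fin (q + 1) → Fin n) → ℂ}
    (hc : coeffFn z v η = ∑ y, c y • ∏ a, edgeInv z (v a) (.inr (y a)))
    {y : Fin (q + 1) → Fin n} (hy : r < fiberCard y j) : c y = 0 := by
  obtain ⟨A, hA, hAcard⟩ := Finset.exists_subset_card_eq (Nat.succ_le_of_lt hy)
  let I : Edge k r := ⟨A.image v, by rw [Finset.card_image_of_injective _ hv, hAcard]⟩
  obtain ⟨a₀, ha₀, hb⟩ := Finset.mem_image.1 I.base_mem
  -- The chart of `I` is based at its smallest element, which has to be moved to the first place of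
  -- `v`; this permutes the labels and changes `c` by a sign.
  set τ := Equiv.swap 0 a₀ with hτ
  have hτ0 : (v ∘ τ) 0 = I.base := by simp [hτ, hb]
  have hres' := hres I
  rw [← hτ0] at hres'
  have hcoeff : coeffFn z (v ∘ τ) η = ∑ y, ((((Equiv.Perm.sign τ : ℤˣ) : ℤ) : ℂ) *
      c (y ∘ τ.symm)) • ∏ a, edgeInv z ((v ∘ τ) a) (.inr (y a)) := by
    rw [coeffFn_comp_perm, hc, Finset.smul_sum]
    refine Fintype.sum_equiv (τ.symm.arrowCongr (Equiv.refl _)) _ _ fun y => ?_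
    rw [smul_smul]
    congr 1
    · congr 2
      funext a
      simp
    · rw [← Equiv.prod_comp τ]
      exact Finset.prod_congr rfl fun a _ => by simp
  have := coeff_eq_zero_of_hasResidue (hv.comp τ.injective) (hτ0 ▸ I.base_mem) ?_ hres' hcoeff
    (y₀ := y ∘ τ) ?_
  · have hcomp : (y ∘ τ) ∘ τ.symm = y := by funext a; simp
    rw [hcomp] at this
    refine (mul_eq_zero.1 this).resolve_left fun h => ?_
    have := sign_sq τ
    rw [h, zero_mul] at this
    exact zero_ne_one this
  · intro i hi
    obtain ⟨a, -, rfl⟩ := Finset.mem_image.1 hi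
    exact Finset.mem_image.2 ⟨τ.symm a, Finset.mem_univ _, by simp⟩
  · intro a ha
    obtain ⟨a', ha', h⟩ := Finset.mem_image.1 ha
    rw [Function.comp_apply, ← hv h]
    exact (Finset.mem_filter.1 (hA ha')).2

/-- In degree `0` there are no residue conditions. Both spaces vanish for `k ≥ 2`, and for `k = 1`
the empty labelling satisfies every bound. -/
theorem flagForms_zero_eq {n k : ℕ} (hk : 0 < k) (z : Fin n ↪ ℂ) (m : Fin n → ℕ) {κ : ℂ}
    (hκ : κ ≠ 0) : flagForms k z m κ 0 = skewOS k z 0 := by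
  refine le_antisymm (flagForms_le hκ fun _ _ _ _ _ => skew_pointForm_mem z _ _) fun η hη => ?_
  by_cases hk2 : 0 + 2 ≤ k
  · rw [skewOS_eq_bot_of_add_two_le z hk2] at hη
    rw [(Submodule.mem_bot ℂ).1 hη]
    exact zero_mem _
  · obtain ⟨c, hc⟩ := exists_point_coeff hη (Fin.castLE_injective hk.le)
    exact mem_flagForms_of_coeff hκ hk.le (by omega) hη hc fun y _ i => by simp [fiberCard]

theorem flagForms_succ_eq {n k : ℕ} {n₀ : ℕ} (z : Fin n ↪ ℂ) {m : Fin n → ℕ}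
    (hgt : ∀ j : Fin n, n₀ ≤ (j : ℕ) → k - 1 < m j) {κ : ℂ} (hκ : κ ≠ 0) (q : ℕ) :
    flagForms k z m κ (q + 1) =
      (LinearMap.ker (residueMap k z m n₀ q)).map (skewOS k z (q + 1)).subtype := by
  refine le_antisymm (flagForms_le hκ fun hp K hK hk hKm => ?_) ?_
  · refine ⟨⟨_, skew_pointForm_mem z _ _⟩, ?_, rfl⟩
    rw [SetLike.mem_coe, LinearMap.mem_ker, residueMap_eq_zero_iff]
    exact fun j _ I => skew_pointForm_hasResidue_zero z hp hk K hK j (hKm j) I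
  · rintro _ ⟨⟨η, hη⟩, hker, rfl⟩
    rw [SetLike.mem_coe, LinearMap.mem_ker, residueMap_eq_zero_iff] at hker
    change η ∈ flagForms k z m κ (q + 1)
    by_cases hp : q + 1 ≤ k
    · by_cases hk2 : q + 1 + 2 ≤ k
      · rw [skewOS_eq_bot_of_add_two_le z hk2] at hη
        rw [(Submodule.mem_bot ℂ).1 hη]
        exact zero_mem _
      obtain ⟨c, hc⟩ := exists_point_coeff hη (Fin.castLE_injective hp)
      refine mem_flagForms_of_coeff hκ hp (by omega) hη hc fun y hy j => ?_
      by_contra! hlt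
      by_cases hj : (j : ℕ) < n₀
      · exact hy (coeff_eq_zero_of_residues (hker j hj) (Fin.castLE_injective hp) hc hlt)
      -- For `j ≥ n₀` the bound is automatic: a label occurs at most `q + 1 ≤ k ≤ m j` times.
      · have h1 := hgt j (not_lt.1 hj)
        have h2 : fiberCard y j ≤ q + 1 := (Finset.card_filter_le _ _).trans (by simp)
        omega
    · rw [skewOS_eq_bot_of_lt z (not_le.1 hp)] at hη
      rw [(Submodule.mem_bot ℂ).1 hη]
      exact zero_mem _

end Discr

end

open Discr in
theorem lemma6 {n : ℕ} (k n₀ : ℕ) (hk : 0 < k) (hn₀ : n₀ ≤ n) (z : Fin n ↪ ℂ) (m : Fin n → ℕ)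
    (hm : ∀ j, 0 < m j) (hle : ∀ j : Fin n, (j : ℕ) < n₀ → m j ≤ k - 1)
    (hgt : ∀ j : Fin n, n₀ ≤ (j : ℕ) → k - 1 < m j) (κ : ℂ) (hκ : κ ≠ 0) :
    flagForms k z m κ 0 = skewOS k z 0 ∧
    ∀ q : ℕ, flagForms k z m κ (q + 1) =
      (LinearMap.ker (residueMap k z m n₀ q)).map (skewOS k z (q + 1)).subtype := by
  exact ⟨flagForms_zero_eq hk z m hκ, flagForms_succ_eq z hgt hκ⟩
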